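/- **Conventions.** Fix $n\ge 0$. $\mathrm{U}(1)=\mathbb{R}/\mathbb{Z}$ and $\mathbb{T}^n=\mathbb{R}^n/\mathbb{Z}^n$ are written additively; $\mathfrak{so}(n,\mathbb{Z})$ is the discrete additive group of skew-symmetric integral $n\times n$ matrices; $\langle v|A|w\rangle=\sum_{i,j}A_{ij}v_iw_j$; $\langle v|A$ is the map $w\mapsto\langle v|A|w\rangle$; and $\langle v|B|w\rangle_{low}=\langle v|B_{low}|w\rangle$, where $B_{low}$ is the strictly lower triangular part of $B$. Real numbers are reduced modulo $\mathbb{Z}$ where an element of $\mathrm{U}(1)$ is expected, and elements of $\mathrm{U}(1)$ are regarded as constant maps where an element of $C^\infty(\mathbb{T}^n,\mathrm{U}(1))$ (a Fréchet Lie group) is expected. **Crossed modules.** A crossed module $(G,H,t,\alpha)$ of (Fréchet) Lie groups is a smooth homomorphism $t:H\to G$ with a smooth action $\alpha$ of $G$ on $H$ by automorphisms, with $t(\alpha(g,h))=g\,t(h)\,g^{-1}$ and $\alpha(t(h),h')=hh'h^{-1}$. All groups below are abelian. We use: * $\mathbb{TD}$: $G=\mathbb{R}^n\oplus\mathbb{R}^n$,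 $H=(\mathbb{Z}^n\oplus\mathbb{Z}^n)\times\mathrm{U}(1)$, $t(m\oplus\hat m,s)=m\oplus\hat m$, $\alpha(a\oplus\hat a,(m\oplus\hat m,s))=(m\oplus\hat m,s-\hat a\cdot m)$; * $\mathbb{TB}_{F_2}$: $G=\mathbb{R}^n$, $H=C^\infty(\mathbb{T}^n,\mathrm{U}(1))\times\mathbb{Z}^n$, $t(\tau,m)=m$, $\alpha(a,(\tau,m))=(\tau(\cdot-a),m)$. A crossed intertwiner $(G,H,t,\alpha)\to(G',H',t',\alpha')$ consists (for abelian groups) of smooth homomorphisms $\phi:G\to G'$, $f:H\to H'$ and a smooth map $\eta:G\times G\to H'$ with $t'\circ\eta=0$, $\phi\circ t=t'\circ f$, $\eta(t(h),t(h'))=0$, $\eta(g,t(h)-g)+f(\alpha(g,h))=\alpha'(\phi(g),\eta(t(h)-g,g)+f(h))$ and $\eta(g,g')+\eta(g+g',g'')=\alpha'(\phi(g),\eta(g',g''))+\eta(g,g'+g'')$. Composition is $(\phi_2,f_2,\eta_2)\circ(\phi_1,f_1,\eta_1)=(\phi_2\phi_1,f_2f_1,\eta_2(\phi_1\cdot,\phi_1\cdot)+f_2\eta_1)$.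 The group $\mathfrak{so}(n,\mathbb{Z})$ acts by crossed intertwiners: on $\mathbb{TD}$, $B$ acts by $$\phi(a\oplus\hat a)=a\oplus(Ba+\hat a),\quad f(m\oplus\hat m,s)=(m\oplus(Bm+\hat m),s),\quad \eta(a\oplus\hat a,b\oplus\hat b)=\langle a|B|b\rangle_{low},$$ and on $\mathbb{TB}_{F_2}$ it acts by $$\phi=\mathrm{id},\quad f(\tau,m)=(\tau-\langle m|B,\,m),\quad \eta(a,a')=\langle a'|B|a\rangle_{low}.$$ **Semi-direct products.** Let a discrete abelian group $U$ act on such a crossed module by crossed intertwiners $(\phi_u,f_u,\eta_u)$. The semi-strict Lie 2-group $\Gamma\ltimes U$ has objects $(g,u)\in G\times U$ and morphisms $(h,g,u):(g,u)\to(t(h)+g,u)$, composed by addition in $H$; its multiplication is $(g_2,u_2)(g_1,u_1)=(g_2+\phi_{u_2}(g_1),u_2+u_1)$ on objects, and on morphisms it sends $(h_2,g_2,u_2),(h_1,g_1,u_1)$ to the morphism with $H$-component $h_2+\alpha(g_2,f_{u_2}(h_1)-\eta_{u_2}(t(h_1),g_1))$ and source the product of the sources; its associator $(XY)Z\to X(YZ)$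 at $X=(g_3,u_3),Y=(g_2,u_2),Z=(g_1,u_1)$ has $H$-component $-\alpha(g_3,\eta_{u_3}(g_2,\phi_{u_2}(g_1)))$. Put $$\mathbb{TD}^{\frac12\text{-}geo}:=\mathbb{TD}\ltimes\mathfrak{so}(n,\mathbb{Z}),\qquad \mathbb{TB}_{F_1}:=\mathbb{TB}_{F_2}\ltimes\mathfrak{so}(n,\mathbb{Z}).$$ The first is the 2-group of *half-geometric T-duality correspondences* (by definition, these are its cocycles); the second represents $F_1$ T-backgrounds with torus fibres of dimension $n$. **Left leg.** The crossed intertwiner $\mathbb{TD}\to\mathbb{TB}_{F_2}$ with $$\phi(a\oplus\hat a)=a,\qquad f(m\oplus\hat m,s)=(c\mapsto s+\hat m\cdot c,\;m),\qquad \eta(a\oplus\hat a,a'\oplus\hat a')=\hat a\cdot a'$$ is strictly $\mathfrak{so}(n,\mathbb{Z})$-equivariant. Hence it induces a semi-strict homomorphism $\ell:\mathbb{TD}\ltimes\mathfrak{so}(n,\mathbb{Z})\to\mathbb{TB}_{F_1}$: on objects $(g,u)\mapsto(\phi(g),u)$, on morphisms $(h,g,u)\mapsto(f(h)-\eta(t(h),g),\phi(g),u)$,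 with multiplicator $\chi:\ell(XY)\to\ell(X)\ell(Y)$ at $X=(g_2,u_2)$, $Y=(g_1,u_1)$ of $H$-component $\eta(g_2,\phi_{u_2}(g_1))$, where $\phi_{u_2}$ belongs to the action on $\mathbb{TD}$. **Cohomology.** For a semi-strict Lie 2-group $\Gamma$ with associator $\lambda$ and a smooth manifold $X$, a $\Gamma$-cocycle with respect to an open cover $(U_i)$ consists of smooth maps $g_{ij}:U_i\cap U_j\to\mathrm{Ob}\,\Gamma$ and $\gamma_{ijk}:U_i\cap U_j\cap U_k\to\mathrm{Mor}\,\Gamma$, $\gamma_{ijk}:g_{jk}g_{ij}\to g_{ik}$, with $g_{ii}=1$, $\gamma_{iij}=\gamma_{ijj}=\mathrm{id}_{g_{ij}}$ and $$\gamma_{ikl}\circ(\mathrm{id}_{g_{kl}}\cdot\gamma_{ijk})\circ\lambda(g_{kl},g_{jk},g_{ij})=\gamma_{ijl}\circ(\gamma_{jkl}\cdot\mathrm{id}_{g_{ij}}).$$ Two cocycles $(g,\gamma)$, $(g',\gamma')$ are equivalent if there are smooth maps $h_i:U_i\to\mathrm{Ob}\,\Gamma$ and $\varepsilon_{ij}:h_jg_{ij}\to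 g'_{ij}h_i$ with $\varepsilon_{ii}=\mathrm{id}$ and $$(\gamma'_{ijk}\cdot\mathrm{id}_{h_i})\circ\lambda(g'_{jk},g'_{ij},h_i)^{-1}\circ(\mathrm{id}_{g'_{jk}}\cdot\varepsilon_{ij})\circ\lambda(g'_{jk},h_j,g_{ij})\circ(\varepsilon_{jk}\cdot\mathrm{id}_{g_{ij}})=\varepsilon_{ik}\circ(\mathrm{id}_{h_k}\cdot\gamma_{ijk})\circ\lambda(h_k,g_{jk},g_{ij}).$$ $\mathrm{H}^1(X,\Gamma)$ is the set of cocycles on all open covers modulo equivalence after restriction to a common refinement. A homomorphism $F$ with multiplicator $\chi$ induces $F_*:(g_{ij},\gamma_{ijk})\mapsto(F(g_{ij}),F(\gamma_{ijk})\circ\chi(g_{jk},g_{ij})^{-1})$. For $F=\ell$ this sends a cocycle $(B_{ij},a_{ij},\hat a_{ij},m_{ijk},\hat m_{ijk},t_{ijk})$ to $(B_{ij},a_{ij},m_{ijk},\tau_{ijk})$ with $\tau_{ijk}(x)(c)=t_{ijk}(x)+\hat m_{ijk}\cdot(c-a_{ik}(x))-a_{ij}(x)\cdot\hat a_{jk}(x)$.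 **Theorem.** For every smooth manifold $X$ (finite-dimensional, Hausdorff, second countable), the left leg projection $$\ell_*:\mathrm{H}^1\big(X,\mathbb{TD}\ltimes\mathfrak{so}(n,\mathbb{Z})\big)\longrightarrow\mathrm{H}^1(X,\mathbb{TB}_{F_1})$$ is a bijection. In other words, since $\mathrm{H}^1(X,\mathbb{TB}_{F_1})$ is the set of isomorphism classes of $F_1$ T-backgrounds over $X$, up to isomorphism every $F_1$ T-background is the left leg of a unique half-geometric T-duality correspondence. -/

import Mathlib

open Set Topology
open scoped Manifold ContDiff Matrix

universe u

namespace HalfGeo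

/-! ## Smooth structures -/

/-- A smooth structure on a set `S`, given by its functor of points: it says which maps
`p : X → S`, defined on a smooth manifold `X` of some dimension `d`, are smooth on a subset `U`
of `X`. Only the values of `p` on `U` matter, and smoothness is a local condition. -/
structure SmoothStructure (S : Type) where
  SmoothOn : ∀ (d : ℕ) {X : Type u} [TopologicalSpace X]
    [ChartedSpace (EuclideanSpace ℝ (Fin d)) X], (X → S) → Set X → Prop
  mono : ∀ (d : ℕ) {X : Type u} [TopologicalSpace X]
    [ChartedSpace (EuclideanSpace ℝ (Fin d)) X] {p : X → S} {U V : Set X},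
    SmoothOn d p U → V ⊆ U → SmoothOn d p V
  congr : ∀ (d : ℕ) {X : Type u} [TopologicalSpace X]
    [ChartedSpace (EuclideanSpace ℝ (Fin d)) X] {p q : X → S} {U : Set X},
    SmoothOn d p U → (∀ x ∈ U, q x = p x) → SmoothOn d q U
  of_local : ∀ (d : ℕ) {X : Type u} [TopologicalSpace X]
    [ChartedSpace (EuclideanSpace ℝ (Fin d)) X] {p : X → S} {U : Set X},
    (∀ x ∈ U, ∃ V : Set X, IsOpen V ∧ x ∈ V ∧ SmoothOn d p (U ∩ V)) → SmoothOn d p U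
  const : ∀ (d : ℕ) {X : Type u} [TopologicalSpace X]
    [ChartedSpace (EuclideanSpace ℝ (Fin d)) X] (s : S) (U : Set X),
    SmoothOn d (fun _ : X => s) U

namespace SmoothStructure

/-- Smooth maps: those which send smooth families to smooth families. -/
def Smooth {S T : Type} (A : SmoothStructure.{u} S) (B : SmoothStructure.{u} T)
    (f : S → T) : Prop :=
  ∀ (d : ℕ) {X : Type u} [TopologicalSpace X] [ChartedSpace (EuclideanSpace ℝ (Fin d)) X]
    (p : X → S) (U : Set X), A.SmoothOn d p U → B.SmoothOn d (fun x => f (p x)) U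

/-- The product smooth structure. -/
def prod {S T : Type} (A : SmoothStructure.{u} S) (B : SmoothStructure.{u} T) :
    SmoothStructure.{u} (S × T) where
  SmoothOn d _ _ _ p U := A.SmoothOn d (fun x => (p x).1) U ∧ B.SmoothOn d (fun x => (p x).2) U
  mono d _ _ _ _ _ _ h hV := ⟨A.mono d h.1 hV, B.mono d h.2 hV⟩
  congr d _ _ _ _ _ _ h hq :=
    ⟨A.congr d h.1 fun x hx => by rw [hq x hx], B.congr d h.2 fun x hx => by rw [hq x hx]⟩
  of_local d _ _ _ _ _ h :=
    ⟨A.of_local d fun x hx => (h x hx).imp fun _ hV => ⟨hV.1, hV.2.1, hV.2.2.1⟩,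
      B.of_local d fun x hx => (h x hx).imp fun _ hV => ⟨hV.1, hV.2.1, hV.2.2.2⟩⟩
  const d _ _ _ s U := ⟨A.const d s.1 U, B.const d s.2 U⟩

/-- The smooth structure of a discrete set: the smooth maps are the locally constant ones. -/
def discrete (S : Type) : SmoothStructure.{u} S where
  SmoothOn _ _ _ _ p U := ∀ x ∈ U, ∀ᶠ y in 𝓝[U] x, p y = p x
  mono _ _ _ _ _ _ _ h hV x hx := (h x (hV hx)).filter_mono (nhdsWithin_mono x hV)
  congr _ _ _ _ _ _ U h hq x hx := by
    filter_upwards [h x hx, self_mem_nhdsWithin] with y hy hyU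
    rw [hq y hyU, hq x hx, hy]
  of_local _ _ _ _ _ U h x hx := by
    obtain ⟨V, hV, hxV, h⟩ := h x hx
    have := h x ⟨hx, hxV⟩
    rwa [inter_comm, nhdsWithin_inter_of_mem (mem_nhdsWithin_of_mem_nhds (hV.mem_nhds hxV))] at this
  const _ _ _ _ _ _ _ _ := Filter.Eventually.of_forall fun _ => rfl

/-- The standard smooth structure of a real normed space. -/
def ofNormed (V : Type) [NormedAddCommGroup V] [NormedSpace ℝ V] : SmoothStructure.{u} V where
  SmoothOn d _ _ _ p U := ContMDiffOn (𝓡 d) 𝓘(ℝ, V) ∞ p U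
  mono _ _ _ _ _ _ _ h hV := h.mono hV
  congr _ _ _ _ _ _ _ h hq := h.congr hq
  of_local _ _ _ _ _ _ h := contMDiffOn_of_locally_contMDiffOn h
  const _ _ _ _ _ _ := contMDiffOn_const

/-- The standard smooth structure of `U(1) = ℝ / ℤ`, transported from the unit circle. -/
def circle : SmoothStructure.{u} UnitAddCircle where
  SmoothOn d _ _ _ p U := ContMDiffOn (𝓡 d) (𝓡 1) ∞ (fun x => (p x).toCircle) U
  mono _ _ _ _ _ _ _ h hV := h.mono hV
  congr _ _ _ _ _ _ _ h hq := h.congr fun x hx => by rw [hq x hx]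
  of_local _ _ _ _ _ _ h := contMDiffOn_of_locally_contMDiffOn h
  const _ _ _ _ _ _ := contMDiffOn_const

theorem smoothOn_param {S T D : Type} {A : SmoothStructure.{u} S} {B : SmoothStructure.{u} T}
    {F : D → S → T} (hF : ∀ c, A.Smooth B (F c)) (d : ℕ) {X : Type u} [TopologicalSpace X]
    [ChartedSpace (EuclideanSpace ℝ (Fin d)) X] {p : X → S} {q : X → D} {U : Set X}
    (hp : A.SmoothOn d p U) (hq : (discrete.{u} D).SmoothOn d q U) :
    B.SmoothOn d (fun x => F (q x) (p x)) U := by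
  refine B.of_local d fun x hx => ?_
  obtain ⟨V, hV, hxV, h⟩ := mem_nhdsWithin.1 (hq x hx)
  refine ⟨V, hV, hxV, B.congr d (hF (q x) d p _ (A.mono d hp inter_subset_left)) ?_⟩
  intro y hy
  have e : q y = q x := h ⟨hy.2, hy.1⟩
  simp only [e]

end SmoothStructure

/-! ## Semi-strict Lie 2-groups and their homomorphisms -/

/-- A semi-strict Lie 2-group: a groupoid with smooth structure maps, together with a smooth
multiplication functor `mul`, `mulM`, a strict unit `one`, inverses of objects, and a coherent
associator `lam` whose components `(ab)c ⟶ a(bc)` are endomorphisms.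
The composite `β ∘ α` is `comp β α`; it is meaningful for `src β = tgt α`. -/
structure TwoGroup where
  Obj : Type
  Mor : Type
  smObj : SmoothStructure.{u} Obj
  smMor : SmoothStructure.{u} Mor
  src : Mor → Obj
  tgt : Mor → Obj
  idm : Obj → Mor
  comp : Mor → Mor → Mor
  minv : Mor → Mor
  mul : Obj → Obj → Obj
  mulM : Mor → Mor → Mor
  one : Obj
  inv : Obj → Obj
  lam : Obj → Obj → Obj → Mor
  -- the groupoid
  src_idm : ∀ a, src (idm a) = a
  tgt_idm : ∀ a, tgt (idm a) = a
  src_comp : ∀ β α, src β = tgt α → src (comp β α) = src α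
  tgt_comp : ∀ β α, src β = tgt α → tgt (comp β α) = tgt β
  comp_assoc : ∀ γ β α, src γ = tgt β → src β = tgt α →
    comp (comp γ β) α = comp γ (comp β α)
  idm_comp : ∀ α, comp (idm (tgt α)) α = α
  comp_idm : ∀ α, comp α (idm (src α)) = α
  src_minv : ∀ α, src (minv α) = tgt α
  tgt_minv : ∀ α, tgt (minv α) = src α
  minv_comp : ∀ α, comp (minv α) α = idm (src α)
  comp_minv : ∀ α, comp α (minv α) = idm (tgt α)
  -- the multiplication functor
  src_mulM : ∀ β α, src (mulM β α) = mul (src β) (src α)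
  tgt_mulM : ∀ β α, tgt (mulM β α) = mul (tgt β) (tgt α)
  mulM_idm : ∀ b a, mulM (idm b) (idm a) = idm (mul b a)
  mulM_comp : ∀ β' β α' α, src β' = tgt β → src α' = tgt α →
    mulM (comp β' β) (comp α' α) = comp (mulM β' α') (mulM β α)
  -- the strict unit, and inverses of objects
  mulM_one : ∀ α, mulM α (idm one) = α
  one_mulM : ∀ α, mulM (idm one) α = α
  mul_inv : ∀ a, mul a (inv a) = one
  inv_mul : ∀ a, mul (inv a) a = one
  -- the associator
  src_lam : ∀ c b a, src (lam c b a) = mul (mul c b) a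
  tgt_lam : ∀ c b a, tgt (lam c b a) = mul c (mul b a)
  mul_assoc : ∀ c b a, mul (mul c b) a = mul c (mul b a)
  lam_natural : ∀ γ β α, comp (lam (tgt γ) (tgt β) (tgt α)) (mulM (mulM γ β) α) =
    comp (mulM γ (mulM β α)) (lam (src γ) (src β) (src α))
  pentagon : ∀ d c b a,
    comp (mulM (idm d) (lam c b a)) (comp (lam d (mul c b) a) (mulM (lam d c b) (idm a))) =
      comp (lam d c (mul b a)) (lam (mul d c) b a)
  lam_one : ∀ b a, lam b one a = idm (mul b a)
  -- smoothness
  smooth_src : smMor.Smooth smObj src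
  smooth_tgt : smMor.Smooth smObj tgt
  smooth_idm : smObj.Smooth smMor idm
  smooth_comp : ∀ (d : ℕ) {X : Type u} [TopologicalSpace X]
    [ChartedSpace (EuclideanSpace ℝ (Fin d)) X] (p q : X → Mor) (U : Set X),
    smMor.SmoothOn d p U → smMor.SmoothOn d q U → (∀ x ∈ U, src (p x) = tgt (q x)) →
    smMor.SmoothOn d (fun x => comp (p x) (q x)) U
  smooth_minv : smMor.Smooth smMor minv
  smooth_mul : (smObj.prod smObj).Smooth smObj fun p => mul p.1 p.2
  smooth_mulM : (smMor.prod smMor).Smooth smMor fun p => mulM p.1 p.2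
  smooth_inv : smObj.Smooth smObj inv
  smooth_lam : (smObj.prod (smObj.prod smObj)).Smooth smMor fun p => lam p.1 p.2.1 p.2.2

namespace TwoGroup

variable (Γ : TwoGroup.{u})

/-- The commuting square `A ∘ P = Q ∘ A'`, with matching sources and targets. -/
def Sq (A P Q A' : Γ.Mor) : Prop :=
  Γ.src A = Γ.tgt P ∧ Γ.src Q = Γ.tgt A' ∧ Γ.comp A P = Γ.comp Q A'

variable {Γ}

theorem Sq.tgt_eq {A P Q A' : Γ.Mor} (h : Γ.Sq A P Q A') : Γ.tgt A = Γ.tgt Q := by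
  have := congrArg Γ.tgt h.2.2
  rwa [Γ.tgt_comp _ _ h.1, Γ.tgt_comp _ _ h.2.1] at this

theorem Sq.src_eq {A P Q A' : Γ.Mor} (h : Γ.Sq A P Q A') : Γ.src P = Γ.src A' := by
  have := congrArg Γ.src h.2.2
  rwa [Γ.src_comp _ _ h.1, Γ.src_comp _ _ h.2.1] at this

theorem Sq.comp {A B P Q R A' B' : Γ.Mor} (h : Γ.Sq A P Q A') (k : Γ.Sq B Q R B') :
    Γ.Sq (Γ.comp B A) P R (Γ.comp B' A') := by
  have e1 : Γ.src B = Γ.tgt A := by rw [k.1, h.tgt_eq]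
  have e2 : Γ.src B' = Γ.tgt A' := by rw [← k.src_eq, h.2.1]
  refine ⟨by rw [Γ.src_comp _ _ e1, h.1], by rw [Γ.tgt_comp _ _ e2, k.2.1], ?_⟩
  rw [Γ.comp_assoc _ _ _ e1 h.1, h.2.2, ← Γ.comp_assoc _ _ _ k.1 h.2.1, k.2.2,
    Γ.comp_assoc _ _ _ k.2.1 e2]

theorem comp_right_cancel {A B P : Γ.Mor} (hA : Γ.src A = Γ.tgt P) (hB : Γ.src B = Γ.tgt P)
    (h : Γ.comp A P = Γ.comp B P) : A = B := by
  have : Γ.comp (Γ.comp A P) (Γ.minv P) = Γ.comp (Γ.comp B P) (Γ.minv P) := by rw [h]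
  rwa [Γ.comp_assoc _ _ _ hA (Γ.tgt_minv P).symm, Γ.comp_assoc _ _ _ hB (Γ.tgt_minv P).symm,
    Γ.comp_minv, ← hA, Γ.comp_idm, hA, ← hB, Γ.comp_idm] at this

/-- Two vertical composites over the same square are equal. -/
theorem Sq.unique {A B P Q A' : Γ.Mor} (h : Γ.Sq A P Q A') (k : Γ.Sq B P Q A') : A = B :=
  comp_right_cancel h.1 k.1 (h.2.2.trans k.2.2.symm)

theorem minv_unique {A B : Γ.Mor} (h : Γ.src A = Γ.tgt B) (e : Γ.comp A B = Γ.idm (Γ.src B)) :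
    Γ.minv B = A := by
  refine comp_right_cancel (P := B) (Γ.src_minv B) h ?_
  rw [Γ.minv_comp, e]

theorem minv_idm (a : Γ.Obj) : Γ.minv (Γ.idm a) = Γ.idm a := by
  refine minv_unique (by rw [Γ.src_idm, Γ.tgt_idm]) ?_
  have := Γ.idm_comp (Γ.idm a)
  rw [Γ.tgt_idm] at this
  rw [this, Γ.src_idm]

theorem Sq.minv {A P Q A' : Γ.Mor} (h : Γ.Sq A P Q A') : Γ.Sq (Γ.minv A) Q P (Γ.minv A') := by
  refine ⟨by rw [Γ.src_minv, h.tgt_eq], by rw [Γ.tgt_minv, h.src_eq], ?_⟩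
  have e1 : Γ.src (Γ.minv A) = Γ.tgt Q := by rw [Γ.src_minv, h.tgt_eq]
  have e2 : Γ.src P = Γ.tgt (Γ.minv A') := by rw [Γ.tgt_minv, h.src_eq]
  have e3 : Γ.src (Γ.comp (Γ.minv A) Q) = Γ.tgt A' := by rw [Γ.src_comp _ _ e1, h.2.1]
  refine comp_right_cancel (P := A') e3 (by rw [Γ.src_comp _ _ e2, Γ.src_minv]) ?_
  rw [Γ.comp_assoc _ _ _ e1 h.2.1, ← h.2.2, ← Γ.comp_assoc _ _ _ (Γ.src_minv A) h.1,
    Γ.minv_comp, Γ.comp_assoc _ _ _ e2 (Γ.src_minv A'), Γ.minv_comp, ← h.src_eq, Γ.comp_idm,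
    h.1, Γ.idm_comp]

theorem mul_one (a : Γ.Obj) : Γ.mul a Γ.one = a := by
  have := congrArg Γ.src (Γ.mulM_one (Γ.idm a))
  rwa [Γ.src_mulM, Γ.src_idm, Γ.src_idm] at this

theorem one_mul (a : Γ.Obj) : Γ.mul Γ.one a = a := by
  have := congrArg Γ.src (Γ.one_mulM (Γ.idm a))
  rwa [Γ.src_mulM, Γ.src_idm, Γ.src_idm] at this

/-- An idempotent is an identity. -/
theorem eq_idm_of_comp_self {A : Γ.Mor} (h : Γ.src A = Γ.tgt A) (e : Γ.comp A A = A) :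
    A = Γ.idm (Γ.src A) := by
  refine comp_right_cancel (P := A) h (by rw [Γ.src_idm, h]) ?_
  rw [e]
  conv_rhs => rw [h, Γ.idm_comp]

theorem lam_one_right (b a : Γ.Obj) : Γ.lam b a Γ.one = Γ.idm (Γ.mul b a) := by
  have h := Γ.pentagon b a Γ.one Γ.one
  rw [Γ.lam_one, Γ.lam_one, mul_one, mul_one, mul_one, Γ.mulM_one, Γ.mulM_idm] at h
  have hs : Γ.src (Γ.lam b a Γ.one) = Γ.mul b a := by rw [Γ.src_lam, mul_one]
  have ht : Γ.tgt (Γ.lam b a Γ.one) = Γ.mul b a := by rw [Γ.tgt_lam, mul_one]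
  have e1 : Γ.comp (Γ.lam b a Γ.one) (Γ.idm (Γ.mul b a)) = Γ.lam b a Γ.one := by
    have := Γ.comp_idm (Γ.lam b a Γ.one)
    rwa [hs] at this
  rw [e1] at h
  have e2 : Γ.comp (Γ.idm (Γ.mul b a)) (Γ.comp (Γ.lam b a Γ.one) (Γ.lam b a Γ.one)) =
      Γ.comp (Γ.lam b a Γ.one) (Γ.lam b a Γ.one) := by
    have := Γ.idm_comp (Γ.comp (Γ.lam b a Γ.one) (Γ.lam b a Γ.one))
    rwa [Γ.tgt_comp _ _ (by rw [hs, ht]), ht] at this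
  rw [e2] at h
  have := eq_idm_of_comp_self (by rw [hs, ht]) h
  rwa [hs] at this

theorem lam_one_left (b a : Γ.Obj) : Γ.lam Γ.one b a = Γ.idm (Γ.mul b a) := by
  have h := Γ.pentagon Γ.one Γ.one b a
  rw [Γ.lam_one, Γ.lam_one, one_mul, one_mul, one_mul, Γ.one_mulM, Γ.mulM_idm] at h
  have hs : Γ.src (Γ.lam Γ.one b a) = Γ.mul b a := by rw [Γ.src_lam, one_mul]
  have ht : Γ.tgt (Γ.lam Γ.one b a) = Γ.mul b a := by rw [Γ.tgt_lam, one_mul]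
  have e1 : Γ.comp (Γ.lam Γ.one b a) (Γ.idm (Γ.mul b a)) = Γ.lam Γ.one b a := by
    have := Γ.comp_idm (Γ.lam Γ.one b a)
    rwa [hs] at this
  have e2 : Γ.comp (Γ.idm (Γ.mul b a)) (Γ.lam Γ.one b a) = Γ.lam Γ.one b a := by
    have := Γ.idm_comp (Γ.lam Γ.one b a)
    rwa [ht] at this
  rw [e1, e2] at h
  have := eq_idm_of_comp_self (by rw [hs, ht]) h
  rwa [hs] at this

end TwoGroup

/-- A semi-strict homomorphism between semi-strict Lie 2-groups: a smooth functor together with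
a smooth multiplicator `χ b a : F (b a) ⟶ F b F a`, whose components are endomorphisms. -/
structure TwoHom (Γ Γ' : TwoGroup.{u}) where
  obj : Γ.Obj → Γ'.Obj
  mor : Γ.Mor → Γ'.Mor
  χ : Γ.Obj → Γ.Obj → Γ'.Mor
  src_mor : ∀ α, Γ'.src (mor α) = obj (Γ.src α)
  tgt_mor : ∀ α, Γ'.tgt (mor α) = obj (Γ.tgt α)
  mor_idm : ∀ a, mor (Γ.idm a) = Γ'.idm (obj a)
  mor_comp : ∀ β α, Γ.src β = Γ.tgt α → mor (Γ.comp β α) = Γ'.comp (mor β) (mor α)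
  src_χ : ∀ b a, Γ'.src (χ b a) = obj (Γ.mul b a)
  tgt_χ : ∀ b a, Γ'.tgt (χ b a) = Γ'.mul (obj b) (obj a)
  obj_mul : ∀ b a, obj (Γ.mul b a) = Γ'.mul (obj b) (obj a)
  χ_one : χ Γ.one Γ.one = Γ'.idm Γ'.one
  χ_natural : ∀ β α, Γ'.comp (χ (Γ.tgt β) (Γ.tgt α)) (mor (Γ.mulM β α)) =
    Γ'.comp (Γ'.mulM (mor β) (mor α)) (χ (Γ.src β) (Γ.src α))
  χ_coherent : ∀ c b a,
    Γ'.comp (Γ'.lam (obj c) (obj b) (obj a))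
        (Γ'.comp (Γ'.mulM (χ c b) (Γ'.idm (obj a))) (χ (Γ.mul c b) a)) =
      Γ'.comp (Γ'.comp (Γ'.mulM (Γ'.idm (obj c)) (χ b a)) (χ c (Γ.mul b a)))
        (mor (Γ.lam c b a))
  smooth_obj : Γ.smObj.Smooth Γ'.smObj obj
  smooth_mor : Γ.smMor.Smooth Γ'.smMor mor
  smooth_χ : (Γ.smObj.prod Γ.smObj).Smooth Γ'.smMor fun p => χ p.1 p.2

namespace TwoHom

open TwoGroup

variable {Γ Γ' : TwoGroup.{u}} (F : TwoHom Γ Γ')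

theorem obj_one : F.obj Γ.one = Γ'.one := by
  have := congrArg Γ'.src F.χ_one
  rwa [F.src_χ, Γ'.src_idm, TwoGroup.mul_one] at this

/-- The iterated multiplicator `F ((c b) a) ⟶ (F c F b) F a`. -/
def χl (c b a : Γ.Obj) : Γ'.Mor :=
  Γ'.comp (Γ'.mulM (F.χ c b) (Γ'.idm (F.obj a))) (F.χ (Γ.mul c b) a)

/-- The iterated multiplicator `F (c (b a)) ⟶ F c (F b F a)`. -/
def χr (c b a : Γ.Obj) : Γ'.Mor :=
  Γ'.comp (Γ'.mulM (Γ'.idm (F.obj c)) (F.χ b a)) (F.χ c (Γ.mul b a))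

theorem comp_l (c b a : Γ.Obj) :
    Γ'.src (Γ'.mulM (F.χ c b) (Γ'.idm (F.obj a))) = Γ'.tgt (F.χ (Γ.mul c b) a) := by
  rw [Γ'.src_mulM, F.src_χ, F.tgt_χ, Γ'.src_idm]

theorem comp_r (c b a : Γ.Obj) :
    Γ'.src (Γ'.mulM (Γ'.idm (F.obj c)) (F.χ b a)) = Γ'.tgt (F.χ c (Γ.mul b a)) := by
  rw [Γ'.src_mulM, F.src_χ, F.tgt_χ, Γ'.src_idm]

theorem sq_lam (c b a : Γ.Obj) :
    Γ'.Sq (Γ'.lam (F.obj c) (F.obj b) (F.obj a)) (F.χl c b a) (F.χr c b a)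
      (F.mor (Γ.lam c b a)) := by
  refine ⟨?_, ?_, F.χ_coherent c b a⟩
  · rw [χl, Γ'.tgt_comp _ _ (F.comp_l c b a), Γ'.src_lam, Γ'.tgt_mulM, F.tgt_χ, Γ'.tgt_idm]
  · rw [χr, Γ'.src_comp _ _ (F.comp_r c b a), F.src_χ, F.tgt_mor, Γ.tgt_lam]

/-- Whiskering a square on the right. -/
theorem sq_right {A Q : Γ'.Mor} {δ : Γ.Mor} {c b : Γ.Obj} (hδ : Γ.src δ = Γ.mul c b)
    (h : Γ'.Sq A (F.χ c b) Q (F.mor δ)) (a : Γ.Obj) :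
    Γ'.Sq (Γ'.mulM A (Γ'.idm (F.obj a))) (F.χl c b a)
      (Γ'.comp (Γ'.mulM Q (Γ'.idm (F.obj a))) (F.χ (Γ.tgt δ) a))
      (F.mor (Γ.mulM δ (Γ.idm a))) := by
  have i1 : ∀ x : Γ'.Obj, Γ'.comp (Γ'.idm x) (Γ'.idm x) = Γ'.idm x := fun x => by
    have := Γ'.idm_comp (Γ'.idm x); rwa [Γ'.tgt_idm] at this
  have e0 : Γ'.src (Γ'.mulM Q (Γ'.idm (F.obj a))) = Γ'.tgt (F.χ (Γ.tgt δ) a) := by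
    rw [Γ'.src_mulM, h.2.1, F.tgt_mor, F.tgt_χ, Γ'.src_idm]
  have e1 : Γ'.src (Γ'.mulM A (Γ'.idm (F.obj a))) =
      Γ'.tgt (Γ'.mulM (F.χ c b) (Γ'.idm (F.obj a))) := by
    rw [Γ'.src_mulM, Γ'.tgt_mulM, h.1, Γ'.src_idm, Γ'.tgt_idm]
  have e2 : Γ'.src (Γ'.mulM (F.mor δ) (Γ'.idm (F.obj a))) = Γ'.tgt (F.χ (Γ.mul c b) a) := by
    rw [Γ'.src_mulM, F.src_mor, hδ, F.tgt_χ, Γ'.src_idm]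
  have e3 : Γ'.src (Γ'.mulM Q (Γ'.idm (F.obj a))) =
      Γ'.tgt (Γ'.mulM (F.mor δ) (Γ'.idm (F.obj a))) := by
    rw [Γ'.src_mulM, Γ'.tgt_mulM, h.2.1, Γ'.src_idm, Γ'.tgt_idm]
  have e4 : Γ'.src (F.χ (Γ.tgt δ) a) = Γ'.tgt (F.mor (Γ.mulM δ (Γ.idm a))) := by
    rw [F.src_χ, F.tgt_mor, Γ.tgt_mulM, Γ.tgt_idm]
  refine ⟨?_, ?_, ?_⟩
  · rw [χl, Γ'.tgt_comp _ _ (F.comp_l c b a), e1]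
  · rw [Γ'.src_comp _ _ e0, e4]
  · have n := F.χ_natural δ (Γ.idm a)
    rw [Γ.tgt_idm, Γ.src_idm, F.mor_idm, hδ] at n
    rw [χl, ← Γ'.comp_assoc _ _ _ e1 (F.comp_l c b a),
      ← Γ'.mulM_comp _ _ _ _ h.1 (by rw [Γ'.src_idm, Γ'.tgt_idm]), h.2.2,
      Γ'.mulM_comp _ _ _ _ h.2.1 (by rw [Γ'.src_idm, Γ'.tgt_idm]),
      Γ'.comp_assoc _ _ _ e3 e2, ← n, Γ'.comp_assoc _ _ _ e0 e4]

/-- Whiskering a square on the left. -/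
theorem sq_left {A Q : Γ'.Mor} {δ : Γ.Mor} {b a : Γ.Obj} (hδ : Γ.src δ = Γ.mul b a)
    (h : Γ'.Sq A (F.χ b a) Q (F.mor δ)) (c : Γ.Obj) :
    Γ'.Sq (Γ'.mulM (Γ'.idm (F.obj c)) A) (F.χr c b a)
      (Γ'.comp (Γ'.mulM (Γ'.idm (F.obj c)) Q) (F.χ c (Γ.tgt δ)))
      (F.mor (Γ.mulM (Γ.idm c) δ)) := by
  have e0 : Γ'.src (Γ'.mulM (Γ'.idm (F.obj c)) Q) = Γ'.tgt (F.χ c (Γ.tgt δ)) := by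
    rw [Γ'.src_mulM, h.2.1, F.tgt_mor, F.tgt_χ, Γ'.src_idm]
  have e1 : Γ'.src (Γ'.mulM (Γ'.idm (F.obj c)) A) =
      Γ'.tgt (Γ'.mulM (Γ'.idm (F.obj c)) (F.χ b a)) := by
    rw [Γ'.src_mulM, Γ'.tgt_mulM, h.1, Γ'.src_idm, Γ'.tgt_idm]
  have e2 : Γ'.src (Γ'.mulM (Γ'.idm (F.obj c)) (F.mor δ)) = Γ'.tgt (F.χ c (Γ.mul b a)) := by
    rw [Γ'.src_mulM, F.src_mor, hδ, F.tgt_χ, Γ'.src_idm]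
  have e3 : Γ'.src (Γ'.mulM (Γ'.idm (F.obj c)) Q) =
      Γ'.tgt (Γ'.mulM (Γ'.idm (F.obj c)) (F.mor δ)) := by
    rw [Γ'.src_mulM, Γ'.tgt_mulM, h.2.1, Γ'.src_idm, Γ'.tgt_idm]
  have e4 : Γ'.src (F.χ c (Γ.tgt δ)) = Γ'.tgt (F.mor (Γ.mulM (Γ.idm c) δ)) := by
    rw [F.src_χ, F.tgt_mor, Γ.tgt_mulM, Γ.tgt_idm]
  have i1 : Γ'.comp (Γ'.idm (F.obj c)) (Γ'.idm (F.obj c)) = Γ'.idm (F.obj c) := by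
    have := Γ'.idm_comp (Γ'.idm (F.obj c)); rwa [Γ'.tgt_idm] at this
  refine ⟨?_, ?_, ?_⟩
  · rw [χr, Γ'.tgt_comp _ _ (F.comp_r c b a), e1]
  · rw [Γ'.src_comp _ _ e0, e4]
  · have n := F.χ_natural (Γ.idm c) δ
    rw [Γ.tgt_idm, Γ.src_idm, F.mor_idm, hδ] at n
    rw [χr, ← Γ'.comp_assoc _ _ _ e1 (F.comp_r c b a),
      ← Γ'.mulM_comp _ _ _ _ (by rw [Γ'.src_idm, Γ'.tgt_idm]) h.1, h.2.2,
      Γ'.mulM_comp _ _ _ _ (by rw [Γ'.src_idm, Γ'.tgt_idm]) h.2.1,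
      Γ'.comp_assoc _ _ _ e3 e2, ← n, Γ'.comp_assoc _ _ _ e0 e4]

theorem χ_one_right (a : Γ.Obj) : F.χ a Γ.one = Γ'.idm (F.obj a) := by
  have h := (F.sq_lam a Γ.one Γ.one).2.2
  rw [χl, χr, F.χ_one, F.obj_one, Γ.lam_one, Γ'.lam_one, TwoGroup.mul_one, TwoGroup.mul_one,
    TwoGroup.mul_one, Γ'.mulM_one, F.mor_idm, Γ'.mulM_idm, TwoGroup.mul_one] at h
  have hs : Γ'.src (F.χ a Γ.one) = F.obj a := by rw [F.src_χ, TwoGroup.mul_one]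
  have ht : Γ'.tgt (F.χ a Γ.one) = F.obj a := by rw [F.tgt_χ, F.obj_one, TwoGroup.mul_one]
  have e1 : Γ'.comp (Γ'.idm (F.obj a)) (F.χ a Γ.one) = F.χ a Γ.one := by
    have := Γ'.idm_comp (F.χ a Γ.one); rwa [ht] at this
  have e2 : Γ'.comp (F.χ a Γ.one) (Γ'.idm (F.obj a)) = F.χ a Γ.one := by
    have := Γ'.comp_idm (F.χ a Γ.one); rwa [hs] at this
  have e3 : Γ'.comp (Γ'.idm (F.obj a)) (Γ'.comp (F.χ a Γ.one) (F.χ a Γ.one)) =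
      Γ'.comp (F.χ a Γ.one) (F.χ a Γ.one) := by
    have := Γ'.idm_comp (Γ'.comp (F.χ a Γ.one) (F.χ a Γ.one))
    rwa [Γ'.tgt_comp _ _ (by rw [hs, ht]), ht] at this
  rw [e1, e2, e3] at h
  have := eq_idm_of_comp_self (by rw [hs, ht]) h
  rwa [hs] at this

theorem χ_one_left (a : Γ.Obj) : F.χ Γ.one a = Γ'.idm (F.obj a) := by
  have h := (F.sq_lam Γ.one Γ.one a).2.2
  rw [χl, χr, F.χ_one, F.obj_one, Γ.lam_one, Γ'.lam_one, TwoGroup.one_mul, TwoGroup.one_mul,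
    TwoGroup.one_mul, Γ'.one_mulM, Γ'.one_mulM, F.mor_idm] at h
  have hs : Γ'.src (F.χ Γ.one a) = F.obj a := by rw [F.src_χ, TwoGroup.one_mul]
  have ht : Γ'.tgt (F.χ Γ.one a) = F.obj a := by rw [F.tgt_χ, F.obj_one, TwoGroup.one_mul]
  have e1 : Γ'.comp (Γ'.idm (F.obj a)) (F.χ Γ.one a) = F.χ Γ.one a := by
    have := Γ'.idm_comp (F.χ Γ.one a); rwa [ht] at this
  have e2 : Γ'.comp (Γ'.comp (F.χ Γ.one a) (F.χ Γ.one a)) (Γ'.idm (F.obj a)) =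
      Γ'.comp (F.χ Γ.one a) (F.χ Γ.one a) := by
    have := Γ'.comp_idm (Γ'.comp (F.χ Γ.one a) (F.χ Γ.one a))
    rwa [Γ'.src_comp _ _ (by rw [hs, ht]), hs] at this
  rw [e1, e1, e2] at h
  have := eq_idm_of_comp_self (by rw [hs, ht]) h.symm
  rwa [hs] at this

end TwoHom

/-! ## Non-abelian Čech cohomology -/

/-- Open covers of a space. -/
structure OpenCover (X : Type u) [TopologicalSpace X] where
  ι : Type u
  U : ι → Set X
  isOpen : ∀ i, IsOpen (U i)
  covers : ∀ x, ∃ i, x ∈ U i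

/-- A `Γ`-cocycle with respect to an open cover: smooth maps `g i j` on double overlaps and
`γ i j k : g j k * g i j ⟶ g i k` on triple overlaps. Only the values on the overlaps matter. -/
structure Cocycle (d : ℕ) {X : Type u} [TopologicalSpace X]
    [ChartedSpace (EuclideanSpace ℝ (Fin d)) X] (Γ : TwoGroup.{u}) (𝒰 : OpenCover X) where
  g : 𝒰.ι → 𝒰.ι → X → Γ.Obj
  γ : 𝒰.ι → 𝒰.ι → 𝒰.ι → X → Γ.Mor
  smooth_g : ∀ i j, Γ.smObj.SmoothOn d (g i j) (𝒰.U i ∩ 𝒰.U j)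
  smooth_γ : ∀ i j k, Γ.smMor.SmoothOn d (γ i j k) (𝒰.U i ∩ 𝒰.U j ∩ 𝒰.U k)
  g_self : ∀ i, ∀ x ∈ 𝒰.U i, g i i x = Γ.one
  γ_left : ∀ i j, ∀ x ∈ 𝒰.U i ∩ 𝒰.U j, γ i i j x = Γ.idm (g i j x)
  γ_right : ∀ i j, ∀ x ∈ 𝒰.U i ∩ 𝒰.U j, γ i j j x = Γ.idm (g i j x)
  src_γ : ∀ i j k, ∀ x ∈ 𝒰.U i ∩ 𝒰.U j ∩ 𝒰.U k, Γ.src (γ i j k x) = Γ.mul (g j k x) (g i j x)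
  tgt_γ : ∀ i j k, ∀ x ∈ 𝒰.U i ∩ 𝒰.U j ∩ 𝒰.U k, Γ.tgt (γ i j k x) = g i k x
  cocycle : ∀ i j k l, ∀ x ∈ 𝒰.U i ∩ 𝒰.U j ∩ 𝒰.U k ∩ 𝒰.U l,
    Γ.comp (γ i k l x) (Γ.comp (Γ.mulM (Γ.idm (g k l x)) (γ i j k x))
        (Γ.lam (g k l x) (g j k x) (g i j x))) =
      Γ.comp (γ i j l x) (Γ.mulM (γ j k l x) (Γ.idm (g i j x)))

namespace Cocycle

variable {d : ℕ} {X : Type u} [TopologicalSpace X] [ChartedSpace (EuclideanSpace ℝ (Fin d)) X]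
  {Γ Γ' : TwoGroup.{u}} {𝒰 𝒱 : OpenCover X}

/-- Equivalence of `Γ`-cocycles with respect to the same open cover. -/
def Equivalent (c c' : Cocycle d Γ 𝒰) : Prop :=
  ∃ (h : 𝒰.ι → X → Γ.Obj) (ε : 𝒰.ι → 𝒰.ι → X → Γ.Mor),
    (∀ i, Γ.smObj.SmoothOn d (h i) (𝒰.U i)) ∧
    (∀ i j, Γ.smMor.SmoothOn d (ε i j) (𝒰.U i ∩ 𝒰.U j)) ∧
    (∀ i, ∀ x ∈ 𝒰.U i, ε i i x = Γ.idm (h i x)) ∧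
    (∀ i j, ∀ x ∈ 𝒰.U i ∩ 𝒰.U j, Γ.src (ε i j x) = Γ.mul (h j x) (c.g i j x)) ∧
    (∀ i j, ∀ x ∈ 𝒰.U i ∩ 𝒰.U j, Γ.tgt (ε i j x) = Γ.mul (c'.g i j x) (h i x)) ∧
    ∀ i j k, ∀ x ∈ 𝒰.U i ∩ 𝒰.U j ∩ 𝒰.U k,
      Γ.comp (Γ.mulM (c'.γ i j k x) (Γ.idm (h i x)))
          (Γ.comp (Γ.minv (Γ.lam (c'.g j k x) (c'.g i j x) (h i x)))
            (Γ.comp (Γ.mulM (Γ.idm (c'.g j k x)) (ε i j x))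
              (Γ.comp (Γ.lam (c'.g j k x) (h j x) (c.g i j x))
                (Γ.mulM (ε j k x) (Γ.idm (c.g i j x)))))) =
        Γ.comp (ε i k x) (Γ.comp (Γ.mulM (Γ.idm (h k x)) (c.γ i j k x))
          (Γ.lam (h k x) (c.g j k x) (c.g i j x)))

/-- Restriction of a cocycle to a refinement. -/
def restrict (c : Cocycle d Γ 𝒰) (r : 𝒱.ι → 𝒰.ι) (hr : ∀ a, 𝒱.U a ⊆ 𝒰.U (r a)) :
    Cocycle d Γ 𝒱 where
  g i j := c.g (r i) (r j)
  γ i j k := c.γ (r i) (r j) (r k)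
  smooth_g i j := Γ.smObj.mono d (c.smooth_g _ _) (inter_subset_inter (hr i) (hr j))
  smooth_γ i j k := Γ.smMor.mono d (c.smooth_γ _ _ _)
    (inter_subset_inter (inter_subset_inter (hr i) (hr j)) (hr k))
  g_self i x hx := c.g_self _ x (hr i hx)
  γ_left i j x hx := c.γ_left _ _ x ⟨hr i hx.1, hr j hx.2⟩
  γ_right i j x hx := c.γ_right _ _ x ⟨hr i hx.1, hr j hx.2⟩
  src_γ i j k x hx := c.src_γ _ _ _ x ⟨⟨hr i hx.1.1, hr j hx.1.2⟩, hr k hx.2⟩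
  tgt_γ i j k x hx := c.tgt_γ _ _ _ x ⟨⟨hr i hx.1.1, hr j hx.1.2⟩, hr k hx.2⟩
  cocycle i j k l x hx :=
    c.cocycle _ _ _ _ x ⟨⟨⟨hr i hx.1.1.1, hr j hx.1.1.2⟩, hr k hx.1.2⟩, hr l hx.2⟩

end Cocycle

namespace TwoHom

open TwoGroup

variable {Γ Γ' : TwoGroup.{u}} (F : TwoHom Γ Γ')

theorem mor_minv (α : Γ.Mor) : F.mor (Γ.minv α) = Γ'.minv (F.mor α) := by
  refine (minv_unique ?_ ?_).symm
  · rw [F.src_mor, F.tgt_mor, Γ.src_minv]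
  · rw [← F.mor_comp _ _ (Γ.src_minv α), Γ.minv_comp, F.mor_idm, F.src_mor]

/-- The image of `γ : c b ⟶ a` under `F`, as a morphism `F c F b ⟶ F a`. -/
def imγ (c b : Γ.Obj) (δ : Γ.Mor) : Γ'.Mor := Γ'.comp (F.mor δ) (Γ'.minv (F.χ c b))

/-- The image of `ε : c b ⟶ c' b'` under `F`, as a morphism `F c F b ⟶ F c' F b'`. -/
def imε (c' b' c b : Γ.Obj) (δ : Γ.Mor) : Γ'.Mor :=
  Γ'.comp (F.χ c' b') (Γ'.comp (F.mor δ) (Γ'.minv (F.χ c b)))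

theorem im_cmp {c b : Γ.Obj} {δ : Γ.Mor} (hs : Γ.src δ = Γ.mul c b) :
    Γ'.src (F.mor δ) = Γ'.tgt (Γ'.minv (F.χ c b)) := by
  rw [F.src_mor, hs, Γ'.tgt_minv, F.src_χ]

theorem imε_cmp {c' b' c b : Γ.Obj} {δ : Γ.Mor} (hs : Γ.src δ = Γ.mul c b)
    (ht : Γ.tgt δ = Γ.mul c' b') :
    Γ'.src (F.χ c' b') = Γ'.tgt (Γ'.comp (F.mor δ) (Γ'.minv (F.χ c b))) := by
  rw [Γ'.tgt_comp _ _ (F.im_cmp hs), F.tgt_mor, ht, F.src_χ]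

theorem sq_imγ {c b a : Γ.Obj} {δ : Γ.Mor} (hs : Γ.src δ = Γ.mul c b) (ht : Γ.tgt δ = a) :
    Γ'.Sq (F.imγ c b δ) (F.χ c b) (Γ'.idm (F.obj a)) (F.mor δ) := by
  refine ⟨?_, ?_, ?_⟩
  · rw [imγ, Γ'.src_comp _ _ (F.im_cmp hs), Γ'.src_minv]
  · rw [Γ'.src_idm, F.tgt_mor, ht]
  · rw [imγ, Γ'.comp_assoc _ _ _ (F.im_cmp hs) (Γ'.src_minv _), Γ'.minv_comp]
    have h1 : Γ'.src (F.χ c b) = Γ'.src (F.mor δ) := by rw [F.src_χ, F.src_mor, hs]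
    have h2 : F.obj a = Γ'.tgt (F.mor δ) := by rw [F.tgt_mor, ht]
    rw [h1, Γ'.comp_idm, h2, Γ'.idm_comp]

theorem sq_imε {c' b' c b : Γ.Obj} {δ : Γ.Mor} (hs : Γ.src δ = Γ.mul c b)
    (ht : Γ.tgt δ = Γ.mul c' b') :
    Γ'.Sq (F.imε c' b' c b δ) (F.χ c b) (F.χ c' b') (F.mor δ) := by
  refine ⟨?_, ?_, ?_⟩
  · rw [imε, Γ'.src_comp _ _ (F.imε_cmp hs ht), Γ'.src_comp _ _ (F.im_cmp hs), Γ'.src_minv]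
  · rw [F.src_χ, F.tgt_mor, ht]
  · have h1 : Γ'.src (F.χ c b) = Γ'.src (F.mor δ) := by rw [F.src_χ, F.src_mor, hs]
    rw [imε, Γ'.comp_assoc _ _ _ (F.imε_cmp hs ht)
        (by rw [Γ'.src_comp _ _ (F.im_cmp hs), Γ'.src_minv]),
      Γ'.comp_assoc _ _ _ (F.im_cmp hs) (Γ'.src_minv _), Γ'.minv_comp, h1, Γ'.comp_idm]

theorem sq_imγ_right {c b a : Γ.Obj} {δ : Γ.Mor} (hs : Γ.src δ = Γ.mul c b) (ht : Γ.tgt δ = a)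
    (z : Γ.Obj) :
    Γ'.Sq (Γ'.mulM (F.imγ c b δ) (Γ'.idm (F.obj z))) (F.χl c b z) (F.χ a z)
      (F.mor (Γ.mulM δ (Γ.idm z))) := by
  have h := F.sq_right hs (F.sq_imγ hs ht) z
  have e : Γ'.mul (F.obj a) (F.obj z) = Γ'.tgt (F.χ a z) := (F.tgt_χ a z).symm
  rwa [ht, Γ'.mulM_idm, e, Γ'.idm_comp] at h

theorem sq_imγ_left {c b a : Γ.Obj} {δ : Γ.Mor} (hs : Γ.src δ = Γ.mul c b) (ht : Γ.tgt δ = a)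
    (z : Γ.Obj) :
    Γ'.Sq (Γ'.mulM (Γ'.idm (F.obj z)) (F.imγ c b δ)) (F.χr z c b) (F.χ z a)
      (F.mor (Γ.mulM (Γ.idm z) δ)) := by
  have h := F.sq_left hs (F.sq_imγ hs ht) z
  have e : Γ'.mul (F.obj z) (F.obj a) = Γ'.tgt (F.χ z a) := (F.tgt_χ z a).symm
  rwa [ht, Γ'.mulM_idm, e, Γ'.idm_comp] at h

theorem sq_imε_right {c' b' c b : Γ.Obj} {δ : Γ.Mor} (hs : Γ.src δ = Γ.mul c b)
    (ht : Γ.tgt δ = Γ.mul c' b') (z : Γ.Obj) :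
    Γ'.Sq (Γ'.mulM (F.imε c' b' c b δ) (Γ'.idm (F.obj z))) (F.χl c b z) (F.χl c' b' z)
      (F.mor (Γ.mulM δ (Γ.idm z))) := by
  have h := F.sq_right hs (F.sq_imε hs ht) z
  rwa [ht] at h

theorem sq_imε_left {c' b' c b : Γ.Obj} {δ : Γ.Mor} (hs : Γ.src δ = Γ.mul c b)
    (ht : Γ.tgt δ = Γ.mul c' b') (z : Γ.Obj) :
    Γ'.Sq (Γ'.mulM (Γ'.idm (F.obj z)) (F.imε c' b' c b δ)) (F.χr z c b) (F.χr z c' b')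
      (F.mor (Γ.mulM (Γ.idm z) δ)) := by
  have h := F.sq_left hs (F.sq_imε hs ht) z
  rwa [ht] at h

theorem imγ_idm_right (a : Γ.Obj) : F.imγ a Γ.one (Γ.idm a) = Γ'.idm (F.obj a) := by
  rw [imγ, F.χ_one_right, minv_idm, F.mor_idm]
  have := Γ'.comp_idm (Γ'.idm (F.obj a))
  rwa [Γ'.src_idm] at this

theorem imγ_idm_left (a : Γ.Obj) : F.imγ Γ.one a (Γ.idm a) = Γ'.idm (F.obj a) := by
  rw [imγ, F.χ_one_left, minv_idm, F.mor_idm]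
  have := Γ'.comp_idm (Γ'.idm (F.obj a))
  rwa [Γ'.src_idm] at this

theorem imε_idm (a : Γ.Obj) : F.imε Γ.one a a Γ.one (Γ.idm a) = Γ'.idm (F.obj a) := by
  have h := F.imγ_idm_right a
  rw [imγ] at h
  rw [imε, h, F.χ_one_left]
  have := Γ'.comp_idm (Γ'.idm (F.obj a))
  rwa [Γ'.src_idm] at this

theorem imγ_cocycle {kl jk ij ik jl il : Γ.Obj} {γikl γijk γijl γjkl : Γ.Mor}
    (s1 : Γ.src γikl = Γ.mul kl ik) (t1 : Γ.tgt γikl = il)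
    (s2 : Γ.src γijk = Γ.mul jk ij) (t2 : Γ.tgt γijk = ik)
    (s3 : Γ.src γijl = Γ.mul jl ij) (t3 : Γ.tgt γijl = il)
    (s4 : Γ.src γjkl = Γ.mul kl jk) (t4 : Γ.tgt γjkl = jl)
    (h : Γ.comp γikl (Γ.comp (Γ.mulM (Γ.idm kl) γijk) (Γ.lam kl jk ij)) =
      Γ.comp γijl (Γ.mulM γjkl (Γ.idm ij))) :
    Γ'.comp (F.imγ kl ik γikl) (Γ'.comp (Γ'.mulM (Γ'.idm (F.obj kl)) (F.imγ jk ij γijk))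
        (Γ'.lam (F.obj kl) (F.obj jk) (F.obj ij))) =
      Γ'.comp (F.imγ jl ij γijl) (Γ'.mulM (F.imγ kl jk γjkl) (Γ'.idm (F.obj ij))) := by
  have L := ((F.sq_lam kl jk ij).comp (F.sq_imγ_left s2 t2 kl)).comp (F.sq_imγ s1 t1)
  have R := (F.sq_imγ_right s4 t4 ij).comp (F.sq_imγ s3 t3)
  have c1 : Γ.src (Γ.mulM (Γ.idm kl) γijk) = Γ.tgt (Γ.lam kl jk ij) := by
    rw [Γ.src_mulM, Γ.src_idm, s2, Γ.tgt_lam]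
  have c2 : Γ.src γikl = Γ.tgt (Γ.comp (Γ.mulM (Γ.idm kl) γijk) (Γ.lam kl jk ij)) := by
    rw [Γ.tgt_comp _ _ c1, Γ.tgt_mulM, Γ.tgt_idm, t2, s1]
  have c3 : Γ.src γijl = Γ.tgt (Γ.mulM γjkl (Γ.idm ij)) := by
    rw [Γ.tgt_mulM, Γ.tgt_idm, t4, s3]
  rw [← F.mor_comp _ _ c1, ← F.mor_comp _ _ c2, h] at L
  rw [← F.mor_comp _ _ c3] at R
  exact L.unique R

theorem im_equivalence {jk ij ik jk' ij' ik' hi hj hk : Γ.Obj} {γ γ' εij εjk εik : Γ.Mor}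
    (s1 : Γ.src γ = Γ.mul jk ij) (t1 : Γ.tgt γ = ik)
    (s2 : Γ.src γ' = Γ.mul jk' ij') (t2 : Γ.tgt γ' = ik')
    (s3 : Γ.src εij = Γ.mul hj ij) (t3 : Γ.tgt εij = Γ.mul ij' hi)
    (s4 : Γ.src εjk = Γ.mul hk jk) (t4 : Γ.tgt εjk = Γ.mul jk' hj)
    (s5 : Γ.src εik = Γ.mul hk ik) (t5 : Γ.tgt εik = Γ.mul ik' hi)
    (h : Γ.comp (Γ.mulM γ' (Γ.idm hi)) (Γ.comp (Γ.minv (Γ.lam jk' ij' hi))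
        (Γ.comp (Γ.mulM (Γ.idm jk') εij) (Γ.comp (Γ.lam jk' hj ij)
          (Γ.mulM εjk (Γ.idm ij))))) =
      Γ.comp εik (Γ.comp (Γ.mulM (Γ.idm hk) γ) (Γ.lam hk jk ij))) :
    Γ'.comp (Γ'.mulM (F.imγ jk' ij' γ') (Γ'.idm (F.obj hi)))
      (Γ'.comp (Γ'.minv (Γ'.lam (F.obj jk') (F.obj ij') (F.obj hi)))
        (Γ'.comp (Γ'.mulM (Γ'.idm (F.obj jk')) (F.imε ij' hi hj ij εij))
          (Γ'.comp (Γ'.lam (F.obj jk') (F.obj hj) (F.obj ij))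
            (Γ'.mulM (F.imε jk' hj hk jk εjk) (Γ'.idm (F.obj ij)))))) =
      Γ'.comp (F.imε ik' hi hk ik εik)
        (Γ'.comp (Γ'.mulM (Γ'.idm (F.obj hk)) (F.imγ jk ij γ))
          (Γ'.lam (F.obj hk) (F.obj jk) (F.obj ij))) := by
  have L := ((((F.sq_imε_right s4 t4 ij).comp (F.sq_lam jk' hj ij)).comp
    (F.sq_imε_left s3 t3 jk')).comp (F.sq_lam jk' ij' hi).minv).comp (F.sq_imγ_right s2 t2 hi)
  have R := ((F.sq_lam hk jk ij).comp (F.sq_imγ_left s1 t1 hk)).comp (F.sq_imε s5 t5)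
  have c1 : Γ.src (Γ.lam jk' hj ij) = Γ.tgt (Γ.mulM εjk (Γ.idm ij)) := by
    rw [Γ.src_lam, Γ.tgt_mulM, t4, Γ.tgt_idm]
  have c2 : Γ.src (Γ.mulM (Γ.idm jk') εij) =
      Γ.tgt (Γ.comp (Γ.lam jk' hj ij) (Γ.mulM εjk (Γ.idm ij))) := by
    rw [Γ.tgt_comp _ _ c1, Γ.tgt_lam, Γ.src_mulM, Γ.src_idm, s3]
  have c3 : Γ.src (Γ.minv (Γ.lam jk' ij' hi)) = Γ.tgt (Γ.comp (Γ.mulM (Γ.idm jk') εij)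
      (Γ.comp (Γ.lam jk' hj ij) (Γ.mulM εjk (Γ.idm ij)))) := by
    rw [Γ.tgt_comp _ _ c2, Γ.tgt_mulM, Γ.tgt_idm, t3, Γ.src_minv, Γ.tgt_lam]
  have c4 : Γ.src (Γ.mulM γ' (Γ.idm hi)) = Γ.tgt (Γ.comp (Γ.minv (Γ.lam jk' ij' hi))
      (Γ.comp (Γ.mulM (Γ.idm jk') εij) (Γ.comp (Γ.lam jk' hj ij)
        (Γ.mulM εjk (Γ.idm ij))))) := by
    rw [Γ.tgt_comp _ _ c3, Γ.tgt_minv, Γ.src_lam, Γ.src_mulM, Γ.src_idm, s2]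
  have c5 : Γ.src (Γ.mulM (Γ.idm hk) γ) = Γ.tgt (Γ.lam hk jk ij) := by
    rw [Γ.src_mulM, Γ.src_idm, s1, Γ.tgt_lam]
  have c6 : Γ.src εik = Γ.tgt (Γ.comp (Γ.mulM (Γ.idm hk) γ) (Γ.lam hk jk ij)) := by
    rw [Γ.tgt_comp _ _ c5, Γ.tgt_mulM, Γ.tgt_idm, t1, s5]
  rw [← F.mor_minv, ← F.mor_comp _ _ c1, ← F.mor_comp _ _ c2, ← F.mor_comp _ _ c3,
    ← F.mor_comp _ _ c4, h] at L
  rw [← F.mor_comp _ _ c5, ← F.mor_comp _ _ c6] at R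
  exact L.unique R

end TwoHom

namespace Cocycle

variable {d : ℕ} {X : Type u} [TopologicalSpace X] [ChartedSpace (EuclideanSpace ℝ (Fin d)) X]
  {Γ Γ' : TwoGroup.{u}} {𝒰 𝒱 : OpenCover X}

/-- The image of a cocycle under a homomorphism:
`g i j` becomes `F (g i j)` and `γ i j k` becomes `F (γ i j k) ∘ χ(g j k, g i j)⁻¹`. -/
def map (F : TwoHom Γ Γ') (c : Cocycle d Γ 𝒰) : Cocycle d Γ' 𝒰 where
  g i j x := F.obj (c.g i j x)
  γ i j k x := F.imγ (c.g j k x) (c.g i j x) (c.γ i j k x)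
  smooth_g i j := F.smooth_obj d _ _ (c.smooth_g i j)
  smooth_γ i j k := by
    refine Γ'.smooth_comp d _ _ _ (F.smooth_mor d _ _ (c.smooth_γ i j k)) ?_ ?_
    · refine Γ'.smooth_minv d _ _ (F.smooth_χ d (fun x => (c.g j k x, c.g i j x)) _ ⟨?_, ?_⟩)
      · exact Γ.smObj.mono d (c.smooth_g j k) fun x hx => ⟨hx.1.2, hx.2⟩
      · exact Γ.smObj.mono d (c.smooth_g i j) fun x hx => hx.1
    · intro x hx
      exact F.im_cmp (c.src_γ i j k x hx)
  g_self i x hx := by rw [c.g_self i x hx, F.obj_one]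
  γ_left i j x hx := by rw [c.γ_left i j x hx, c.g_self i x hx.1, F.imγ_idm_right]
  γ_right i j x hx := by rw [c.γ_right i j x hx, c.g_self j x hx.2, F.imγ_idm_left]
  src_γ i j k x hx := by
    rw [(F.sq_imγ (c.src_γ i j k x hx) (c.tgt_γ i j k x hx)).1, F.tgt_χ]
  tgt_γ i j k x hx := by
    rw [(F.sq_imγ (c.src_γ i j k x hx) (c.tgt_γ i j k x hx)).tgt_eq, Γ'.tgt_idm]
  cocycle i j k l x hx := by
    have h1 : x ∈ 𝒰.U i ∩ 𝒰.U k ∩ 𝒰.U l := ⟨⟨hx.1.1.1, hx.1.2⟩, hx.2⟩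
    have h2 : x ∈ 𝒰.U i ∩ 𝒰.U j ∩ 𝒰.U l := ⟨hx.1.1, hx.2⟩
    have h3 : x ∈ 𝒰.U j ∩ 𝒰.U k ∩ 𝒰.U l := ⟨⟨hx.1.1.2, hx.1.2⟩, hx.2⟩
    exact F.imγ_cocycle (c.src_γ i k l x h1) (c.tgt_γ i k l x h1) (c.src_γ i j k x hx.1)
      (c.tgt_γ i j k x hx.1) (c.src_γ i j l x h2) (c.tgt_γ i j l x h2)
      (c.src_γ j k l x h3) (c.tgt_γ j k l x h3) (c.cocycle i j k l x hx)

theorem Equivalent.map (F : TwoHom Γ Γ') {c c' : Cocycle d Γ 𝒰} (e : c.Equivalent c') :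
    (c.map F).Equivalent (c'.map F) := by
  obtain ⟨h, ε, sh, sε, n, s, t, eq⟩ := e
  refine ⟨fun i x => F.obj (h i x),
    fun i j x => F.imε (c'.g i j x) (h i x) (h j x) (c.g i j x) (ε i j x), ?_, ?_, ?_, ?_, ?_, ?_⟩
  · exact fun i => F.smooth_obj d _ _ (sh i)
  · intro i j
    refine Γ'.smooth_comp d _ _ _ ?_ (Γ'.smooth_comp d _ _ _ (F.smooth_mor d _ _ (sε i j)) ?_ ?_)
      ?_
    · exact F.smooth_χ d (fun x => (c'.g i j x, h i x)) _
        ⟨c'.smooth_g i j, Γ.smObj.mono d (sh i) inter_subset_left⟩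
    · exact Γ'.smooth_minv d _ _ (F.smooth_χ d (fun x => (h j x, c.g i j x)) _
        ⟨Γ.smObj.mono d (sh j) inter_subset_right, c.smooth_g i j⟩)
    · exact fun x hx => F.im_cmp (s i j x hx)
    · exact fun x hx => F.imε_cmp (s i j x hx) (t i j x hx)
  · intro i x hx
    simp only
    rw [n i x hx, c.g_self i x hx, c'.g_self i x hx, F.imε_idm]
  · intro i j x hx
    simp only
    rw [(F.sq_imε (s i j x hx) (t i j x hx)).1, F.tgt_χ]
    rfl
  · intro i j x hx
    simp only
    rw [(F.sq_imε (s i j x hx) (t i j x hx)).tgt_eq, F.tgt_χ]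
    rfl
  · intro i j k x hx
    have h1 : x ∈ 𝒰.U i ∩ 𝒰.U k := ⟨hx.1.1, hx.2⟩
    have h2 : x ∈ 𝒰.U j ∩ 𝒰.U k := ⟨hx.1.2, hx.2⟩
    exact F.im_equivalence (c.src_γ i j k x hx) (c.tgt_γ i j k x hx) (c'.src_γ i j k x hx)
      (c'.tgt_γ i j k x hx) (s i j x hx.1) (t i j x hx.1) (s j k x h2) (t j k x h2)
      (s i k x h1) (t i k x h1) (eq i j k x hx)

end Cocycle

/-- Two cocycles on possibly different covers are identified if they become equivalent after
restriction to some common refinement. -/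
def CocycleRel (d : ℕ) (X : Type u) [TopologicalSpace X]
    [ChartedSpace (EuclideanSpace ℝ (Fin d)) X] (Γ : TwoGroup.{u})
    (a b : Σ 𝒰 : OpenCover X, Cocycle d Γ 𝒰) : Prop :=
  ∃ (𝒲 : OpenCover X) (r : 𝒲.ι → a.1.ι) (s : 𝒲.ι → b.1.ι) (hr : ∀ i, 𝒲.U i ⊆ a.1.U (r i))
    (hs : ∀ i, 𝒲.U i ⊆ b.1.U (s i)), (a.2.restrict r hr).Equivalent (b.2.restrict s hs)

/-- The non-abelian Čech cohomology `H¹(X, Γ)`. -/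
def H1 (d : ℕ) (X : Type u) [TopologicalSpace X] [ChartedSpace (EuclideanSpace ℝ (Fin d)) X]
    (Γ : TwoGroup.{u}) : Type (u + 1) :=
  Quot (CocycleRel d X Γ)

/-- The map `F_* : H¹(X, Γ) → H¹(X, Γ')` induced by a homomorphism `F : Γ → Γ'`. -/
def H1.map (d : ℕ) (X : Type u) [TopologicalSpace X]
    [ChartedSpace (EuclideanSpace ℝ (Fin d)) X] {Γ Γ' : TwoGroup.{u}} (F : TwoHom Γ Γ') :
    H1 d X Γ → H1 d X Γ' :=
  Quot.map (fun a => ⟨a.1, a.2.map F⟩) fun _ _ ⟨𝒲, r, s, hr, hs, e⟩ =>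
    ⟨𝒲, r, s, hr, hs, e.map F⟩

/-! ## Crossed modules with abelian groups, crossed intertwiners and strict actions -/

/-- A crossed module `t : H → G` of smooth groups, with an action `α` of `G` on `H`. Both groups
are abelian here and are written additively. -/
structure CrossedModule where
  G : Type
  H : Type
  [grpG : AddCommGroup G]
  [grpH : AddCommGroup H]
  smG : SmoothStructure.{u} G
  smH : SmoothStructure.{u} H
  t : H →+ G
  α : G → H →+ H
  α_zero : ∀ h, α 0 h = h
  α_add : ∀ g g' h, α (g + g') h = α g (α g' h)
  t_α : ∀ g h, t (α g h) = t h
  α_t : ∀ h h', α (t h) h' = h'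
  smooth_addG : (smG.prod smG).Smooth smG fun p => p.1 + p.2
  smooth_negG : smG.Smooth smG fun g => -g
  smooth_addH : (smH.prod smH).Smooth smH fun p => p.1 + p.2
  smooth_negH : smH.Smooth smH fun h => -h
  smooth_t : smH.Smooth smG t
  smooth_α : (smG.prod smH).Smooth smH fun p => α p.1 p.2

attribute [instance] CrossedModule.grpG CrossedModule.grpH

/-- Crossed intertwiners `(φ, f, η)` between crossed modules. -/
@[ext]
structure CrossedIntertwiner (M M' : CrossedModule.{u}) where
  φ : M.G →+ M'.G
  f : M.H →+ M'.H
  η : M.G → M.G → M'.H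
  t_η : ∀ g g', M'.t (η g g') = 0
  φ_t : ∀ h, φ (M.t h) = M'.t (f h)
  η_t : ∀ h h', η (M.t h) (M.t h') = 0
  η_α : ∀ g h, η g (M.t h - g) + f (M.α g h) =
    M'.α (φ g) (η (M.t h - g) g) + M'.α (φ g) (f h)
  η_cocycle : ∀ g g' g'', η g g' + η (g + g') g'' = M'.α (φ g) (η g' g'') + η g (g' + g'')
  smooth_φ : M.smG.Smooth M'.smG φ
  smooth_f : M.smH.Smooth M'.smH f
  smooth_η : (M.smG.prod M.smG).Smooth M'.smH fun p => η p.1 p.2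

namespace CrossedIntertwiner

variable {M M' M'' : CrossedModule.{u}} (F : CrossedIntertwiner M M')

theorem η_zero_zero : F.η 0 0 = 0 := by
  have := F.η_t 0 0
  rwa [map_zero] at this

theorem η_zero_left (g : M.G) : F.η 0 g = 0 := by
  have := F.η_cocycle 0 0 g
  rw [F.η_zero_zero, map_zero, M'.α_zero, zero_add, zero_add, zero_add] at this
  exact add_eq_left.1 this.symm

theorem η_zero_right (g : M.G) : F.η g 0 = 0 := by
  have := F.η_cocycle g 0 0
  rw [F.η_zero_zero, map_zero, add_zero, add_zero, zero_add] at this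
  exact add_eq_left.1 this

theorem α_φ_t (h : M.H) (h' : M'.H) : M'.α (F.φ (M.t h)) h' = h' := by
  rw [F.φ_t, M'.α_t]

theorem f_α (g : M.G) (h : M.H) :
    F.f (M.α g h) = M'.α (F.φ g) (F.f h) + F.η (M.t h) g - F.η g (M.t h) := by
  have h1 := F.η_α g h
  have h2 := F.η_cocycle g (M.t h - g) g
  rw [add_sub_cancel, sub_add_cancel] at h2
  grind

theorem f_α_of_t_eq_zero (g : M.G) {h : M.H} (hh : M.t h = 0) :
    F.f (M.α g h) = M'.α (F.φ g) (F.f h) := by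
  rw [F.f_α, hh, F.η_zero_left, F.η_zero_right, add_zero, sub_zero]

/-- The functor between the groupoids of the crossed modules sends a morphism `(h, g)` to
`(D h g, φ g)`. -/
def D (h : M.H) (g : M.G) : M'.H := F.f h - F.η (M.t h) g

theorem D_zero (g : M.G) : F.D 0 g = 0 := by
  rw [D, map_zero, map_zero, F.η_zero_left, sub_zero]

theorem D_of_t_eq_zero {h : M.H} (hh : M.t h = 0) (g : M.G) : F.D h g = F.f h := by
  rw [D, hh, F.η_zero_left, sub_zero]

theorem t_D (h : M.H) (g : M.G) : M'.t (F.D h g) = F.φ (M.t h) := by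
  rw [D, map_sub, F.t_η, F.φ_t, sub_zero]

theorem D_add (h h' : M.H) (g : M.G) : F.D (h' + h) g = F.D h' (M.t h + g) + F.D h g := by
  have := F.η_cocycle (M.t h') (M.t h) g
  rw [F.η_t, F.α_φ_t] at this
  simp only [D, map_add]
  grind

theorem D_mul (h h' : M.H) (g g' : M.G) :
    F.D (h + M.α g h') (g + g') + F.η (M.t h + g) (M.t h' + g') =
      F.D h g + M'.α (F.φ g) (F.D h' g') + F.η g g' := by
  have h1 := F.η_cocycle (M.t h) g (M.t h' + g')
  have h2 := F.η_cocycle g (M.t h') g'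
  have h3 := F.η_cocycle (M.t h') g g'
  have h4 := F.η_cocycle (M.t h) (M.t h') (g + g')
  rw [F.α_φ_t] at h1 h3 h4
  rw [F.η_t] at h4
  have e : M.t h' + (g + g') = g + (M.t h' + g') := by abel
  have e' : g + M.t h' = M.t h' + g := add_comm _ _
  rw [e] at h4
  rw [e'] at h2
  simp only [D, map_add, map_sub, M.t_α, F.f_α]
  grind

/-- The identity crossed intertwiner. -/
def id (M : CrossedModule.{u}) : CrossedIntertwiner M M where
  φ := AddMonoidHom.id _
  f := AddMonoidHom.id _
  η _ _ := 0
  t_η _ _ := map_zero _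
  φ_t _ := rfl
  η_t _ _ := rfl
  η_α _ _ := by simp
  η_cocycle _ _ _ := by simp
  smooth_φ _ _ _ _ _ _ h := h
  smooth_f _ _ _ _ _ _ h := h
  smooth_η d _ _ _ _ U _ := M.smH.const d 0 U

/-- The composition of crossed intertwiners. -/
def comp (K : CrossedIntertwiner M' M'') (F : CrossedIntertwiner M M') :
    CrossedIntertwiner M M'' where
  φ := K.φ.comp F.φ
  f := K.f.comp F.f
  η g g' := K.η (F.φ g) (F.φ g') + K.f (F.η g g')
  t_η g g' := by rw [map_add, K.t_η, ← K.φ_t, F.t_η, map_zero, add_zero]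
  φ_t h := by simp [F.φ_t, K.φ_t]
  η_t h h' := by rw [F.φ_t, F.φ_t, K.η_t, F.η_t, map_zero, add_zero]
  η_α g h := by
    have h1 := congrArg K.f (F.η_α g h)
    have h2 := K.η_α (F.φ g) (F.f h)
    have h3 := K.f_α_of_t_eq_zero (F.φ g) (F.t_η (M.t h - g) g)
    have h4 : F.φ (M.t h - g) = M'.t (F.f h) - F.φ g := by rw [map_sub, F.φ_t]
    have h5 := K.f_α (F.φ g) (F.f h)
    have h6 := K.η_cocycle (F.φ g) (M'.t (F.f h) - F.φ g) (F.φ g)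
    rw [add_sub_cancel, sub_add_cancel] at h6
    simp only [map_add, AddMonoidHom.comp_apply, h4] at h1 h2 ⊢
    rw [h3] at h1
    grind
  η_cocycle g g' g'' := by
    have h1 := K.η_cocycle (F.φ g) (F.φ g') (F.φ g'')
    have h2 := congrArg K.f (F.η_cocycle g g' g'')
    have h3 := K.f_α_of_t_eq_zero (F.φ g) (F.t_η g' g'')
    simp only [map_add, AddMonoidHom.comp_apply] at h1 h2 ⊢
    rw [h3] at h2
    grind
  smooth_φ d _ _ _ p U h := K.smooth_φ d _ U (F.smooth_φ d p U h)
  smooth_f d _ _ _ p U h := K.smooth_f d _ U (F.smooth_f d p U h)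
  smooth_η d _ _ _ p U h :=
    M''.smooth_addH d (fun x => (K.η (F.φ (p x).1) (F.φ (p x).2), K.f (F.η (p x).1 (p x).2))) U
      ⟨K.smooth_η d (fun x => (F.φ (p x).1, F.φ (p x).2)) U
        ⟨F.smooth_φ d _ U h.1, F.smooth_φ d _ U h.2⟩,
        K.smooth_f d _ U (F.smooth_η d p U h)⟩

theorem D_comp (K : CrossedIntertwiner M' M'') (F : CrossedIntertwiner M M') (h : M.H)
    (g : M.G) : (K.comp F).D h g = K.D (F.D h g) (F.φ g) := by
  simp only [D, comp, AddMonoidHom.comp_apply, map_sub, F.t_η, F.φ_t, sub_zero]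
  abel

end CrossedIntertwiner

/-- A strict action of a discrete abelian group `U` on a crossed module by crossed
intertwiners. -/
structure CrossedAction (U : Type) [AddCommGroup U] (M : CrossedModule.{u}) where
  act : U → CrossedIntertwiner M M
  act_zero : act 0 = CrossedIntertwiner.id M
  act_add : ∀ u v, act (u + v) = (act u).comp (act v)

namespace CrossedAction

variable {U : Type} [AddCommGroup U] {M : CrossedModule.{u}} (A : CrossedAction U M)

theorem φ_zero (g : M.G) : (A.act 0).φ g = g := by rw [A.act_zero]; rfl

theorem φ_add (u v : U) (g : M.G) : (A.act (u + v)).φ g = (A.act u).φ ((A.act v).φ g) := by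
  rw [A.act_add]; rfl

theorem η_zero (g g' : M.G) : (A.act 0).η g g' = 0 := by rw [A.act_zero]; rfl

theorem η_add (u v : U) (g g' : M.G) : (A.act (u + v)).η g g' =
    (A.act u).η ((A.act v).φ g) ((A.act v).φ g') + (A.act u).f ((A.act v).η g g') := by
  rw [A.act_add]; rfl

theorem D_zero (h : M.H) (g : M.G) : (A.act 0).D h g = h := by
  rw [CrossedIntertwiner.D, A.η_zero, sub_zero, A.act_zero]; rfl

theorem D_add (u v : U) (h : M.H) (g : M.G) :
    (A.act (u + v)).D h g = (A.act u).D ((A.act v).D h g) ((A.act v).φ g) := by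
  rw [A.act_add, CrossedIntertwiner.D_comp]

end CrossedAction

namespace CrossedModule

variable (M : CrossedModule.{u})

theorem smooth_add_H {d : ℕ} {X : Type u} [TopologicalSpace X]
    [ChartedSpace (EuclideanSpace ℝ (Fin d)) X] {p q : X → M.H} {V : Set X}
    (hp : M.smH.SmoothOn d p V) (hq : M.smH.SmoothOn d q V) :
    M.smH.SmoothOn d (fun x => p x + q x) V :=
  M.smooth_addH d (fun x => (p x, q x)) V ⟨hp, hq⟩

theorem smooth_add_G {d : ℕ} {X : Type u} [TopologicalSpace X]
    [ChartedSpace (EuclideanSpace ℝ (Fin d)) X] {p q : X → M.G} {V : Set X}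
    (hp : M.smG.SmoothOn d p V) (hq : M.smG.SmoothOn d q V) :
    M.smG.SmoothOn d (fun x => p x + q x) V :=
  M.smooth_addG d (fun x => (p x, q x)) V ⟨hp, hq⟩

theorem smooth_act {d : ℕ} {X : Type u} [TopologicalSpace X]
    [ChartedSpace (EuclideanSpace ℝ (Fin d)) X] {p : X → M.G} {q : X → M.H} {V : Set X}
    (hp : M.smG.SmoothOn d p V) (hq : M.smH.SmoothOn d q V) :
    M.smH.SmoothOn d (fun x => M.α (p x) (q x)) V :=
  M.smooth_α d (fun x => (p x, q x)) V ⟨hp, hq⟩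

end CrossedModule

theorem CrossedIntertwiner.smooth_D {M M' : CrossedModule.{u}} (F : CrossedIntertwiner M M') :
    (M.smH.prod M.smG).Smooth M'.smH fun p => F.D p.1 p.2 := by
  intro d X _ _ p V hp
  have h := M'.smooth_add_H (F.smooth_f d _ V hp.1) (M'.smooth_negH d _ V
    (F.smooth_η d (fun x => (M.t (p x).1, (p x).2)) V ⟨M.smooth_t d _ V hp.1, hp.2⟩))
  simpa only [CrossedIntertwiner.D, sub_eq_add_neg] using h

theorem smoothOn_discrete_map {S T : Type} (f : S → T) {d : ℕ} {X : Type u} [TopologicalSpace X]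
    [ChartedSpace (EuclideanSpace ℝ (Fin d)) X] {p : X → S} {V : Set X}
    (hp : (SmoothStructure.discrete.{u} S).SmoothOn d p V) :
    (SmoothStructure.discrete.{u} T).SmoothOn d (fun x => f (p x)) V := by
  intro x hx
  filter_upwards [hp x hx] with y hy
  rw [hy]

theorem smoothOn_discrete_map₂ {S S' T : Type} (f : S → S' → T) {d : ℕ} {X : Type u}
    [TopologicalSpace X] [ChartedSpace (EuclideanSpace ℝ (Fin d)) X] {p : X → S} {q : X → S'}
    {V : Set X} (hp : (SmoothStructure.discrete.{u} S).SmoothOn d p V)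
    (hq : (SmoothStructure.discrete.{u} S').SmoothOn d q V) :
    (SmoothStructure.discrete.{u} T).SmoothOn d (fun x => f (p x) (q x)) V := by
  intro x hx
  filter_upwards [hp x hx, hq x hx] with y hy hy'
  rw [hy, hy']

/-! ## Semi-direct products -/

section SemiDirect

variable {U : Type} [AddCommGroup U] {M : CrossedModule.{u}}

/-- The semi-direct product `M ⋊ U` of a crossed module with a discrete abelian group acting by
crossed intertwiners. A morphism `(h, g, u)` goes from `(g, u)` to `(t h + g, u)`; the
multiplication is `(g₂, u₂) (g₁, u₁) = (g₂ + u₂ • g₁, u₂ + u₁)`, extended to morphisms by the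
functor `(h, g) ↦ (D h g, φ g)` of the crossed intertwiner of `u₂`, and the associator comes from
the `η`-parts of the action. -/
def semiDirect (A : CrossedAction U M) : TwoGroup.{u} where
  Obj := M.G × U
  Mor := M.H × M.G × U
  smObj := M.smG.prod (SmoothStructure.discrete U)
  smMor := M.smH.prod (M.smG.prod (SmoothStructure.discrete U))
  src a := a.2
  tgt a := (M.t a.1 + a.2.1, a.2.2)
  idm a := (0, a)
  comp b a := (b.1 + a.1, a.2)
  minv a := (-a.1, M.t a.1 + a.2.1, a.2.2)
  mul b a := (b.1 + (A.act b.2).φ a.1, b.2 + a.2)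
  mulM b a := (b.1 + M.α b.2.1 ((A.act b.2.2).D a.1 a.2.1),
    b.2.1 + (A.act b.2.2).φ a.2.1, b.2.2 + a.2.2)
  one := (0, 0)
  inv a := ((A.act (-a.2)).φ (-a.1), -a.2)
  lam c b a := (-(M.α c.1 ((A.act c.2).η b.1 ((A.act b.2).φ a.1))),
    c.1 + (A.act c.2).φ b.1 + (A.act (c.2 + b.2)).φ a.1, c.2 + b.2 + a.2)
  src_idm _ := rfl
  tgt_idm a := by simp
  src_comp _ _ _ := rfl
  tgt_comp b a h := by
    rw [h, map_add]
    simp [add_assoc]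
  comp_assoc _ _ _ _ _ := by simp [add_assoc]
  idm_comp a := by simp
  comp_idm a := by simp
  src_minv _ := rfl
  tgt_minv a := by simp
  minv_comp a := by simp
  comp_minv a := by simp
  src_mulM _ _ := rfl
  tgt_mulM b a := by
    ext
    · simp only [map_add, M.t_α, CrossedIntertwiner.t_D]
      abel
    · rfl
  mulM_idm b a := by simp [CrossedIntertwiner.D_zero]
  mulM_comp b' b a' a hb ha := by
    simp only [hb, ha]
    ext
    · simp only [CrossedIntertwiner.D_add, map_add, M.α_add, M.α_t]
      abel
    · rfl
    · rfl
  mulM_one a := by simp [CrossedIntertwiner.D_zero]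
  one_mulM a := by simp [A.D_zero, A.φ_zero, M.α_zero]
  mul_inv a := by
    ext
    · simp only [← A.φ_add, add_neg_cancel, A.φ_zero]
    · simp
  inv_mul a := by
    ext
    · simp
    · simp
  src_lam c b a := rfl
  tgt_lam c b a := by
    ext
    · simp [M.t_α, CrossedIntertwiner.t_η, A.φ_add, add_assoc]
    · simp [add_assoc]
  mul_assoc c b a := by
    ext
    · simp [A.φ_add, add_assoc]
    · simp [add_assoc]
  lam_natural c b a := by
    obtain ⟨h3, g3, u3⟩ := c
    obtain ⟨h2, g2, u2⟩ := b
    obtain ⟨h1, g1, u1⟩ := a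
    have key := (A.act u3).D_mul h2 ((A.act u2).D h1 g1) g2 ((A.act u2).φ g1)
    rw [CrossedIntertwiner.t_D] at key
    have key' := congrArg (M.α g3) key
    simp only [map_add] at key'
    ext
    · simp only [M.α_add, M.α_t, A.D_add, map_add]
      grind
    · rfl
    · rfl
  pentagon d c b a := by
    obtain ⟨g4, u4⟩ := d
    obtain ⟨g3, u3⟩ := c
    obtain ⟨g2, u2⟩ := b
    obtain ⟨g1, u1⟩ := a
    have h0 : M.t (-(M.α g3 ((A.act u3).η g2 ((A.act u2).φ g1)))) = 0 := by
      rw [map_neg, M.t_α, CrossedIntertwiner.t_η, neg_zero]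
    have h1 := (A.act u4).f_α_of_t_eq_zero g3 ((A.act u3).t_η g2 ((A.act u2).φ g1))
    have key := (A.act u4).η_cocycle g3 ((A.act u3).φ g2) ((A.act u3).φ ((A.act u2).φ g1))
    have key' := congrArg (M.α g4) key
    simp only [map_add] at key'
    ext
    · simp only [CrossedIntertwiner.D_of_t_eq_zero _ h0, CrossedIntertwiner.D_zero, map_zero,
        add_zero, map_neg, h1, A.φ_add, A.η_add, map_add, M.α_add]
      grind
    · rfl
    · rfl
  lam_one b a := by
    ext
    · simp [CrossedIntertwiner.η_zero_left]
    · simp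
    · simp
  smooth_src d _ _ _ p V h := h.2
  smooth_tgt d _ _ _ p V h := ⟨M.smooth_add_G (M.smooth_t d _ V h.1) h.2.1, h.2.2⟩
  smooth_idm d _ _ _ p V h := ⟨M.smH.const d 0 V, h⟩
  smooth_comp d _ _ _ p q V hp hq _ := ⟨M.smooth_add_H hp.1 hq.1, hq.2⟩
  smooth_minv d _ _ _ p V h :=
    ⟨M.smooth_negH d _ V h.1, M.smooth_add_G (M.smooth_t d _ V h.1) h.2.1, h.2.2⟩
  smooth_mul d _ _ _ p V h :=
    ⟨M.smooth_add_G h.1.1 (SmoothStructure.smoothOn_param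
      (F := fun u g => (A.act u).φ g) (fun u => (A.act u).smooth_φ) d h.2.1 h.1.2),
      smoothOn_discrete_map₂ (fun u v : U => u + v) h.1.2 h.2.2⟩
  smooth_mulM d _ _ _ p V h :=
    ⟨M.smooth_add_H h.1.1 (M.smooth_act h.1.2.1 (SmoothStructure.smoothOn_param
      (F := fun u (q : M.H × M.G) => (A.act u).D q.1 q.2) (fun u => (A.act u).smooth_D) d
      (p := fun x => ((p x).2.1, (p x).2.2.1)) ⟨h.2.1, h.2.2.1⟩ h.1.2.2)),
      M.smooth_add_G h.1.2.1 (SmoothStructure.smoothOn_param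
        (F := fun u g => (A.act u).φ g) (fun u => (A.act u).smooth_φ) d h.2.2.1 h.1.2.2),
      smoothOn_discrete_map₂ (fun u v : U => u + v) h.1.2.2 h.2.2.2⟩
  smooth_inv d _ _ _ p V h :=
    ⟨SmoothStructure.smoothOn_param
      (F := fun u g => (A.act (-u)).φ g) (fun u => (A.act (-u)).smooth_φ) d
      (M.smooth_negG d _ V h.1) h.2, smoothOn_discrete_map (fun u : U => -u) h.2⟩
  smooth_lam d _ _ _ p V h := by
    obtain ⟨h3, h2, h1⟩ := h
    have e1 := SmoothStructure.smoothOn_param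
      (F := fun u g => (A.act u).φ g) (fun u => (A.act u).smooth_φ) d h1.1 h2.2
    have e2 := SmoothStructure.smoothOn_param
      (F := fun u g => (A.act u).φ g) (fun u => (A.act u).smooth_φ) d h2.1 h3.2
    have e3 := smoothOn_discrete_map₂ (fun u v : U => u + v) h3.2 h2.2
    have e4 := SmoothStructure.smoothOn_param
      (F := fun u g => (A.act u).φ g) (fun u => (A.act u).smooth_φ) d h1.1 e3
    refine ⟨M.smooth_negH d _ V (M.smooth_act h3.1 (SmoothStructure.smoothOn_param
      (F := fun u (q : M.G × M.G) => (A.act u).η q.1 q.2) (fun u => (A.act u).smooth_η) d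
      (p := fun x => ((p x).2.1.1, (A.act (p x).2.1.2).φ (p x).2.2.1)) ⟨h2.1, e1⟩ h3.2)),
      M.smooth_add_G (M.smooth_add_G h3.1 e2) e4,
      smoothOn_discrete_map₂ (fun u v : U => u + v) e3 h1.2⟩

/-- The homomorphism `M ⋊ U → M' ⋊ U` induced by a strictly `U`-equivariant crossed
intertwiner. -/
def semiDirectHom {M' : CrossedModule.{u}} (A : CrossedAction U M) (A' : CrossedAction U M')
    (F : CrossedIntertwiner M M') (hF : ∀ u, (A'.act u).comp F = F.comp (A.act u)) :
    TwoHom (semiDirect A) (semiDirect A') where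
  obj a := (F.φ a.1, a.2)
  mor a := (F.D a.1 a.2.1, F.φ a.2.1, a.2.2)
  χ b a := (F.η b.1 ((A.act b.2).φ a.1), F.φ (b.1 + (A.act b.2).φ a.1), b.2 + a.2)
  src_mor _ := rfl
  tgt_mor a := by
    change (M'.t (F.D a.1 a.2.1) + F.φ a.2.1, a.2.2) = (F.φ (M.t a.1 + a.2.1), a.2.2)
    rw [F.t_D, map_add]
  mor_idm a := by
    change (F.D 0 a.1, F.φ a.1, a.2) = (0, F.φ a.1, a.2)
    rw [F.D_zero]
  mor_comp b a h := by
    have h1 : b.2.1 = M.t a.1 + a.2.1 := congrArg Prod.fst h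
    change (F.D (b.1 + a.1) a.2.1, F.φ a.2.1, a.2.2) =
      (F.D b.1 b.2.1 + F.D a.1 a.2.1, F.φ a.2.1, a.2.2)
    rw [F.D_add, h1]
  src_χ _ _ := rfl
  tgt_χ b a := by
    have e : (A'.act b.2).φ (F.φ a.1) = F.φ ((A.act b.2).φ a.1) :=
      congrArg (fun K => K.φ a.1) (hF b.2)
    change (M'.t (F.η b.1 ((A.act b.2).φ a.1)) + F.φ (b.1 + (A.act b.2).φ a.1), b.2 + a.2) =
      (F.φ b.1 + (A'.act b.2).φ (F.φ a.1), b.2 + a.2)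
    rw [F.t_η, zero_add, map_add, e]
  obj_mul b a := by
    have e : (A'.act b.2).φ (F.φ a.1) = F.φ ((A.act b.2).φ a.1) :=
      congrArg (fun K => K.φ a.1) (hF b.2)
    change (F.φ (b.1 + (A.act b.2).φ a.1), b.2 + a.2) =
      (F.φ b.1 + (A'.act b.2).φ (F.φ a.1), b.2 + a.2)
    rw [map_add, e]
  χ_one := by
    change (F.η 0 ((A.act 0).φ 0), F.φ (0 + (A.act 0).φ 0), (0 : U) + 0) = (0, 0, 0)
    rw [F.η_zero_left, map_zero, add_zero, add_zero, map_zero]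
  χ_natural b a := by
    obtain ⟨h2, g2, u2⟩ := b
    obtain ⟨h1, g1, u1⟩ := a
    have e : (A'.act u2).D (F.D h1 g1) (F.φ g1) = F.D ((A.act u2).D h1 g1) ((A.act u2).φ g1) := by
      rw [← CrossedIntertwiner.D_comp, ← CrossedIntertwiner.D_comp, hF]
    have key := F.D_mul h2 ((A.act u2).D h1 g1) g2 ((A.act u2).φ g1)
    rw [CrossedIntertwiner.t_D] at key
    change (F.η (M.t h2 + g2) ((A.act u2).φ (M.t h1 + g1)) +
        F.D (h2 + M.α g2 ((A.act u2).D h1 g1)) (g2 + (A.act u2).φ g1),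
        F.φ (g2 + (A.act u2).φ g1), u2 + u1) =
      (F.D h2 g2 + M'.α (F.φ g2) ((A'.act u2).D (F.D h1 g1) (F.φ g1)) +
        F.η g2 ((A.act u2).φ g1), F.φ (g2 + (A.act u2).φ g1), u2 + u1)
    rw [e, ← key, map_add, add_comm]
  χ_coherent c b a := by
    obtain ⟨g3, u3⟩ := c
    obtain ⟨g2, u2⟩ := b
    obtain ⟨g1, u1⟩ := a
    have e1 : (A'.act u2).φ (F.φ g1) = F.φ ((A.act u2).φ g1) :=
      congrArg (fun K => K.φ g1) (hF u2)
    have e2 : (A'.act u3).η (F.φ g2) (F.φ ((A.act u2).φ g1)) +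
        (A'.act u3).f (F.η g2 ((A.act u2).φ g1)) =
        F.η ((A.act u3).φ g2) ((A.act u3).φ ((A.act u2).φ g1)) +
        F.f ((A.act u3).η g2 ((A.act u2).φ g1)) :=
      congrArg (fun K => K.η g2 ((A.act u2).φ g1)) (hF u3)
    have e3 := congrArg (M'.α (F.φ g3)) e2
    have e4 := F.f_α_of_t_eq_zero g3 ((A.act u3).t_η g2 ((A.act u2).φ g1))
    have e5 := F.η_cocycle g3 ((A.act u3).φ g2) ((A.act u3).φ ((A.act u2).φ g1))
    have e6 : M.t (-(M.α g3 ((A.act u3).η g2 ((A.act u2).φ g1)))) = 0 := by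
      rw [map_neg, M.t_α, CrossedIntertwiner.t_η, neg_zero]
    have e7 := (A'.act u3).D_of_t_eq_zero (F.t_η g2 ((A.act u2).φ g1))
      (F.φ (g2 + (A.act u2).φ g1))
    have e8 := F.D_of_t_eq_zero e6 (g3 + (A.act u3).φ g2 + (A.act (u3 + u2)).φ g1)
    simp only [map_add] at e3
    refine Prod.ext ?_ rfl
    · change -(M'.α (F.φ g3) ((A'.act u3).η (F.φ g2) ((A'.act u2).φ (F.φ g1)))) +
          ((F.η g3 ((A.act u3).φ g2) + M'.α (F.φ (g3 + (A.act u3).φ g2))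
            ((A'.act (u3 + u2)).D 0 (F.φ g1))) +
            F.η (g3 + (A.act u3).φ g2) ((A.act (u3 + u2)).φ g1)) =
        ((0 + M'.α (F.φ g3) ((A'.act u3).D (F.η g2 ((A.act u2).φ g1))
            (F.φ (g2 + (A.act u2).φ g1)))) +
            F.η g3 ((A.act u3).φ (g2 + (A.act u2).φ g1))) +
          F.D (-(M.α g3 ((A.act u3).η g2 ((A.act u2).φ g1))))
            (g3 + (A.act u3).φ g2 + (A.act (u3 + u2)).φ g1)
      rw [e7, e8, CrossedIntertwiner.D_zero, map_neg, e4, e1, A.φ_add, map_zero, map_add]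
      grind
  smooth_obj d _ _ _ p V h := ⟨F.smooth_φ d _ V h.1, h.2⟩
  smooth_mor d _ _ _ p V h :=
    ⟨F.smooth_D d (fun x => ((p x).1, (p x).2.1)) V ⟨h.1, h.2.1⟩, F.smooth_φ d _ V h.2.1, h.2.2⟩
  smooth_χ d _ _ _ p V h := by
    have e1 := SmoothStructure.smoothOn_param
      (F := fun u g => (A.act u).φ g) (fun u => (A.act u).smooth_φ) d h.2.1 h.1.2
    exact ⟨F.smooth_η d (fun x => ((p x).1.1, (A.act (p x).1.2).φ (p x).2.1)) V ⟨h.1.1, e1⟩,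
      F.smooth_φ d _ V (M.smooth_add_G h.1.1 e1),
      smoothOn_discrete_map₂ (fun u v : U => u + v) h.1.2 h.2.2⟩

end SemiDirect

/-! ## Smooth maps into vector spaces, into `U(1)`, and into `C^∞(𝕋ⁿ, U(1))` -/

namespace SmoothStructure

theorem smooth_ofNormed {V W : Type} [NormedAddCommGroup V] [NormedSpace ℝ V]
    [NormedAddCommGroup W] [NormedSpace ℝ W] {f : V → W} (hf : ContDiff ℝ ∞ f) :
    (ofNormed.{u} V).Smooth (ofNormed W) f :=
  fun _ _ _ _ _ _ h => hf.contMDiff.comp_contMDiffOn h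

theorem smooth_ofNormed₂ {V V' W : Type} [NormedAddCommGroup V] [NormedSpace ℝ V]
    [NormedAddCommGroup V'] [NormedSpace ℝ V'] [NormedAddCommGroup W] [NormedSpace ℝ W]
    {f : V × V' → W} (hf : ContDiff ℝ ∞ f) :
    ((ofNormed.{u} V).prod (ofNormed V')).Smooth (ofNormed W) f :=
  fun _ _ _ _ _ _ h => hf.contMDiff.comp_contMDiffOn (h.1.prodMk_space h.2)

theorem smooth_of_discrete {S T : Type} (B : SmoothStructure.{u} T) (f : S → T) :
    (discrete.{u} S).Smooth B f := by
  intro d X _ _ p U h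
  refine B.of_local d fun x hx => ?_
  obtain ⟨V, hV, hxV, h⟩ := mem_nhdsWithin.1 (h x hx)
  refine ⟨V, hV, hxV, B.congr d (B.const d (f (p x)) _) ?_⟩
  intro y hy
  have e : p y = p x := h ⟨hy.2, hy.1⟩
  simp only [e]

theorem contMDiff_toCircle_coe :
    ContMDiff 𝓘(ℝ, ℝ) (𝓡 1) ∞ fun s : ℝ => AddCircle.toCircle (s : UnitAddCircle) := by
  simp only [AddCircle.toCircle_apply_mk]
  exact contMDiff_circleExp.comp (contDiff_const.mul contDiff_id).contMDiff

theorem smooth_coe : (ofNormed.{u} ℝ).Smooth circle fun s : ℝ => (s : UnitAddCircle) :=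
  fun _ _ _ _ _ _ h => contMDiff_toCircle_coe.comp_contMDiffOn h

theorem smooth_circle_add : (circle.{u}.prod circle).Smooth circle fun p => p.1 + p.2 := by
  intro d X _ _ p U h
  simp only [circle, AddCircle.toCircle_add]
  exact ContMDiffOn.mul h.1 h.2

theorem smooth_circle_neg : circle.{u}.Smooth circle fun p => -p := by
  intro d X _ _ p U h
  simp only [circle, AddCircle.toCircle_neg]
  exact ContMDiffOn.inv h

theorem smooth_discrete_add (D : Type) [Add D] :
    ((discrete.{u} D).prod (discrete D)).Smooth (discrete D) fun p => p.1 + p.2 :=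
  fun _ _ _ _ _ _ h => smoothOn_discrete_map₂ (fun a b : D => a + b) h.1 h.2

theorem smooth_discrete_neg (D : Type) [Neg D] :
    (discrete.{u} D).Smooth (discrete D) fun p => -p :=
  fun _ _ _ _ _ _ h => smoothOn_discrete_map (fun a : D => -a) h

theorem prod_add {S T : Type} [Add S] [Add T] {A : SmoothStructure.{u} S}
    {B : SmoothStructure.{u} T} (hA : (A.prod A).Smooth A fun p => p.1 + p.2)
    (hB : (B.prod B).Smooth B fun p => p.1 + p.2) :
    ((A.prod B).prod (A.prod B)).Smooth (A.prod B) fun p => p.1 + p.2 :=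
  fun d _ _ _ p U h => ⟨hA d (fun x => ((p x).1.1, (p x).2.1)) U ⟨h.1.1, h.2.1⟩,
    hB d (fun x => ((p x).1.2, (p x).2.2)) U ⟨h.1.2, h.2.2⟩⟩

theorem prod_neg {S T : Type} [Neg S] [Neg T] {A : SmoothStructure.{u} S}
    {B : SmoothStructure.{u} T} (hA : A.Smooth A fun p => -p) (hB : B.Smooth B fun p => -p) :
    (A.prod B).Smooth (A.prod B) fun p => -p :=
  fun d _ _ _ _ U h => ⟨hA d _ U h.1, hB d _ U h.2⟩

end SmoothStructure

/-- The projection `ℝⁿ → 𝕋ⁿ = (ℝ / ℤ)ⁿ`. -/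
def toTorus {n : ℕ} (v : Fin n → ℝ) : Fin n → UnitAddCircle := fun i => (v i : UnitAddCircle)

/-- The group `C^∞(𝕋ⁿ, U(1))`, under pointwise addition; smoothness is tested on `ℝⁿ`. -/
def TorusMap (n : ℕ) : AddSubgroup ((Fin n → UnitAddCircle) → UnitAddCircle) where
  carrier := {τ | ContMDiff 𝓘(ℝ, Fin n → ℝ) (𝓡 1) ∞ fun v => (τ (toTorus v)).toCircle}
  add_mem' {a b} ha hb := by
    simp only [mem_ofPred_eq, Pi.add_apply, AddCircle.toCircle_add] at ha hb ⊢
    exact ContMDiff.mul ha hb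
  zero_mem' := contMDiff_const
  neg_mem' {a} ha := by
    simp only [mem_ofPred_eq, Pi.neg_apply, AddCircle.toCircle_neg] at ha ⊢
    exact ContMDiff.inv ha

namespace TorusMap

variable {n : ℕ}

/-- The Fréchet manifold structure of `C^∞(𝕋ⁿ, U(1))`, through the exponential law: a family
`p : X → C^∞(𝕋ⁿ, U(1))` is smooth iff `(x, c) ↦ p x c` is smooth. -/
def smooth (n : ℕ) : SmoothStructure.{u} (TorusMap n) where
  SmoothOn d X _ _ p U := ContMDiffOn ((𝓡 d).prod 𝓘(ℝ, Fin n → ℝ)) (𝓡 1) ∞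
    (fun q : X × (Fin n → ℝ) => ((p q.1).1 (toTorus q.2)).toCircle) (U ×ˢ univ)
  mono _ _ _ _ _ _ _ h hV := ContMDiffOn.mono h fun _ hq => ⟨hV hq.1, hq.2⟩
  congr _ _ _ _ _ _ _ h hq := h.congr fun x hx => by rw [hq x.1 hx.1]
  of_local _ _ _ _ _ U h := by
    refine contMDiffOn_of_locally_contMDiffOn fun x hx => ?_
    obtain ⟨V, hV, hxV, hp⟩ := h x.1 hx.1
    refine ⟨V ×ˢ univ, hV.prod isOpen_univ, ⟨hxV, trivial⟩, hp.mono ?_⟩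
    rintro y ⟨h1, h2⟩
    exact ⟨⟨h1.1, h2.1⟩, trivial⟩
  const _ _ _ _ s _ := (s.2.comp contMDiff_snd).contMDiffOn

theorem smooth_add : ((smooth.{u} n).prod (smooth n)).Smooth (smooth n) fun p => p.1 + p.2 := by
  intro d X _ _ p U h
  have := ContMDiffOn.mul h.1 h.2
  refine this.congr fun x _ => ?_
  exact AddCircle.toCircle_add _ _

theorem smooth_neg : (smooth.{u} n).Smooth (smooth n) fun p => -p := by
  intro d X _ _ p U h
  have := ContMDiffOn.inv h
  refine this.congr fun x _ => ?_
  exact AddCircle.toCircle_neg _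

theorem toTorus_sub (v w : Fin n → ℝ) : toTorus (v - w) = toTorus v - toTorus w := rfl

theorem toTorus_add (v w : Fin n → ℝ) : toTorus (v + w) = toTorus v + toTorus w := rfl

/-- The translation action of `ℝⁿ`: `(a, τ) ↦ τ(· - a)`. -/
def translate (a : Fin n → ℝ) : TorusMap n →+ TorusMap n where
  toFun τ := ⟨fun c => τ.1 (c - toTorus a), by
    have h : ContMDiff 𝓘(ℝ, Fin n → ℝ) 𝓘(ℝ, Fin n → ℝ) ∞ fun v : Fin n → ℝ => v - a :=
      (contDiff_id.sub contDiff_const).contMDiff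
    have h' : ContMDiff 𝓘(ℝ, Fin n → ℝ) (𝓡 1) ∞ fun v => (τ.1 (toTorus v)).toCircle := τ.2
    exact h'.comp h⟩
  map_zero' := rfl
  map_add' _ _ := rfl

theorem smooth_translate :
    ((SmoothStructure.ofNormed.{u} (Fin n → ℝ)).prod (smooth n)).Smooth (smooth n)
      fun p => translate p.1 p.2 := by
  intro d X _ _ p U h
  have h1 : ContMDiffOn ((𝓡 d).prod 𝓘(ℝ, Fin n → ℝ)) 𝓘(ℝ, Fin n → ℝ) ∞
      (fun q : X × (Fin n → ℝ) => (p q.1).1) (U ×ˢ univ) :=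
    ContMDiffOn.comp (g := fun x => (p x).1) h.1 contMDiffOn_fst fun q hq => hq.1
  have h2 : ContMDiffOn ((𝓡 d).prod 𝓘(ℝ, Fin n → ℝ)) 𝓘(ℝ, Fin n → ℝ) ∞
      (fun q : X × (Fin n → ℝ) => q.2 - (p q.1).1) (U ×ˢ univ) := contMDiffOn_snd.sub h1
  exact ContMDiffOn.comp
    (g := fun q : X × (Fin n → ℝ) => ((p q.1).2.1 (toTorus q.2)).toCircle) h.2 (contMDiffOn_fst.prodMk h2) fun q hq => ⟨hq.1, trivial⟩

/-- The constant maps. -/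
def const (n : ℕ) : UnitAddCircle →+ TorusMap n where
  toFun t := ⟨fun _ => t, contMDiff_const⟩
  map_zero' := rfl
  map_add' _ _ := rfl

theorem smooth_const : SmoothStructure.circle.{u}.Smooth (smooth n) (const n) := by
  intro d X _ _ p U h
  exact ContMDiffOn.comp (g := fun x => (p x).toCircle) h contMDiffOn_fst fun q hq => hq.1

theorem translate_const (a : Fin n → ℝ) (t : UnitAddCircle) :
    translate a (const n t) = const n t := rfl

end TorusMap

/-- The inclusion `ℤⁿ → ℝⁿ`. -/
def intVec (n : ℕ) : (Fin n → ℤ) →+ (Fin n → ℝ) where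
  toFun m i := m i
  map_zero' := by ext; simp
  map_add' _ _ := by ext; simp

theorem toTorus_intVec {n : ℕ} (m : Fin n → ℤ) : toTorus (intVec n m) = 0 := by
  funext i
  exact (AddCircle.coe_eq_zero_iff _).2 ⟨m i, by simp [intVec]⟩

namespace TorusMap

variable {n : ℕ}

theorem coe_dot (m : Fin n → ℤ) (v : Fin n → ℝ) :
    ((intVec n m ⬝ᵥ v : ℝ) : UnitAddCircle) = ∑ j, m j • toTorus v j := by
  have : (intVec n m ⬝ᵥ v) = ∑ j, m j • v j := by
    simp [dotProduct, intVec]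
  rw [this]
  simp only [toTorus, ← AddCircle.coe_zsmul]
  exact map_sum (QuotientAddGroup.mk' (AddSubgroup.zmultiples (1 : ℝ))) _ _

/-- The linear maps `c ↦ m · c` with integral coefficients. -/
def linear (n : ℕ) : (Fin n → ℤ) →+ TorusMap n where
  toFun m := ⟨fun c => ∑ j, m j • c j, by
    simp only [TorusMap, AddSubgroup.mem_mk]
    change ContMDiff 𝓘(ℝ, Fin n → ℝ) (𝓡 1) ∞
      fun v : Fin n → ℝ => (∑ j, m j • toTorus v j).toCircle
    simp only [← coe_dot]
    refine SmoothStructure.contMDiff_toCircle_coe.comp (ContDiff.contMDiff ?_)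
    unfold dotProduct
    fun_prop⟩
  map_zero' := by
    apply Subtype.ext
    funext c
    simp
  map_add' m m' := by
    apply Subtype.ext
    funext c
    simp [add_smul, Finset.sum_add_distrib]

theorem translate_linear (a : Fin n → ℝ) (m : Fin n → ℤ) :
    translate a (linear n m) = linear n m - const n ((intVec n m ⬝ᵥ a : ℝ) : UnitAddCircle) := by
  apply Subtype.ext
  funext c
  rw [coe_dot]
  change ∑ j, m j • (c j - toTorus a j) = ∑ j, m j • c j - ∑ j, m j • toTorus a j
  simp only [smul_sub, Finset.sum_sub_distrib]

end TorusMap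

/-! ## The concrete 2-groups -/

/-- The group `𝔰𝔬(n, ℤ)` of skew-symmetric integral matrices. -/
abbrev so (n : ℕ) : Type := LieAlgebra.Orthogonal.so (Fin n) ℤ

/-- `⟨v|A|w⟩ = ∑ᵢⱼ Aᵢⱼ vᵢ wⱼ`. -/
def braket {n : ℕ} (A : Matrix (Fin n) (Fin n) ℤ) (v w : Fin n → ℝ) : ℝ :=
  ∑ i, ∑ j, (A i j : ℝ) * v i * w j

/-- The strictly lower triangular part of a matrix. -/
def low {n : ℕ} (B : Matrix (Fin n) (Fin n) ℤ) : Matrix (Fin n) (Fin n) ℤ :=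
  Matrix.of fun i j => if j < i then B i j else 0

/-- `⟨v|B_low|w⟩`, as an element of `U(1) = ℝ / ℤ`. -/
def lowU {n : ℕ} (B : Matrix (Fin n) (Fin n) ℤ) (v w : Fin n → ℝ) : UnitAddCircle :=
  (braket (low B) v w : ℝ)

/-- The scalar product of two vectors, as an element of `U(1) = ℝ / ℤ`. -/
def dotU {n : ℕ} (v w : Fin n → ℝ) : UnitAddCircle := (v ⬝ᵥ w : ℝ)

section Forms

variable {n : ℕ}

theorem dotU_add_left (v v' w : Fin n → ℝ) : dotU (v + v') w = dotU v w + dotU v' w := by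
  rw [dotU, add_dotProduct, AddCircle.coe_add]; rfl

theorem dotU_add_right (v w w' : Fin n → ℝ) : dotU v (w + w') = dotU v w + dotU v w' := by
  rw [dotU, dotProduct_add, AddCircle.coe_add]; rfl

theorem dotU_zero_left (w : Fin n → ℝ) : dotU 0 w = 0 := by
  rw [dotU, zero_dotProduct, AddCircle.coe_zero]

theorem dotU_zero_right (w : Fin n → ℝ) : dotU w 0 = 0 := by
  rw [dotU, dotProduct_zero, AddCircle.coe_zero]

theorem dotU_neg_right (v w : Fin n → ℝ) : dotU v (-w) = -dotU v w := by
  rw [dotU, dotProduct_neg, AddCircle.coe_neg]; rfl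

theorem dotU_sub_right (v w w' : Fin n → ℝ) : dotU v (w - w') = dotU v w - dotU v w' := by
  rw [sub_eq_add_neg, dotU_add_right, dotU_neg_right, ← sub_eq_add_neg]

theorem dotU_comm (v w : Fin n → ℝ) : dotU v w = dotU w v := by
  rw [dotU, dotProduct_comm]; rfl

theorem dotU_int (m m' : Fin n → ℤ) : dotU (intVec n m) (intVec n m') = 0 := by
  refine (AddCircle.coe_eq_zero_iff _).2 ⟨m ⬝ᵥ m', ?_⟩
  simp [dotProduct, intVec]

theorem lowU_add_left (B : Matrix (Fin n) (Fin n) ℤ) (v v' w : Fin n → ℝ) :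
    lowU B (v + v') w = lowU B v w + lowU B v' w := by
  simp only [lowU, ← AddCircle.coe_add, braket, Pi.add_apply, mul_add, add_mul,
    Finset.sum_add_distrib]

theorem lowU_add_right (B : Matrix (Fin n) (Fin n) ℤ) (v w w' : Fin n → ℝ) :
    lowU B v (w + w') = lowU B v w + lowU B v w' := by
  simp only [lowU, ← AddCircle.coe_add, braket, Pi.add_apply, mul_add, Finset.sum_add_distrib]

theorem lowU_add (B B' : Matrix (Fin n) (Fin n) ℤ) (v w : Fin n → ℝ) :
    lowU (B + B') v w = lowU B v w + lowU B' v w := by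
  have h : ∀ i j, (low (B + B') i j : ℝ) = low B i j + low B' i j := by
    intro i j
    by_cases hij : j < i <;> simp [low, hij]
  simp only [lowU, ← AddCircle.coe_add, braket, h, add_mul, Finset.sum_add_distrib]

theorem lowU_zero (v w : Fin n → ℝ) : lowU (0 : Matrix (Fin n) (Fin n) ℤ) v w = 0 := by
  have h : ∀ i j, (low (0 : Matrix (Fin n) (Fin n) ℤ) i j : ℝ) = 0 := by
    intro i j
    simp [low]
  simp [lowU, braket, h]

theorem lowU_int (B : Matrix (Fin n) (Fin n) ℤ) (m m' : Fin n → ℤ) :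
    lowU B (intVec n m) (intVec n m') = 0 := by
  refine (AddCircle.coe_eq_zero_iff _).2 ⟨∑ i, ∑ j, low B i j * m i * m' j, ?_⟩
  simp [braket, intVec]

theorem lowU_sub_self (B : Matrix (Fin n) (Fin n) ℤ) (v w : Fin n → ℝ) :
    lowU B (v - w) w = lowU B v w - lowU B w w := by
  have := lowU_add_left B (v - w) w w
  rw [sub_add_cancel] at this
  rw [this, add_sub_cancel_right]

theorem lowU_self_sub (B : Matrix (Fin n) (Fin n) ℤ) (v w : Fin n → ℝ) :
    lowU B w (v - w) = lowU B w v - lowU B w w := by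
  have := lowU_add_right B w (v - w) w
  rw [sub_add_cancel] at this
  rw [this, add_sub_cancel_right]

/-- The real linear map given by an integral matrix. -/
def realMul (B : Matrix (Fin n) (Fin n) ℤ) : (Fin n → ℝ) →+ (Fin n → ℝ) where
  toFun v := B.map (fun k : ℤ => (k : ℝ)) *ᵥ v
  map_zero' := Matrix.mulVec_zero _
  map_add' v w := Matrix.mulVec_add _ v w

theorem realMul_int (B : Matrix (Fin n) (Fin n) ℤ) (m : Fin n → ℤ) :
    realMul B (intVec n m) = intVec n (B *ᵥ m) := by
  funext i
  simp [realMul, intVec, Matrix.mulVec, dotProduct]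

theorem skew (B : so n) (i j : Fin n) : B.1 j i = -B.1 i j := by
  have h := (LieAlgebra.Orthogonal.mem_so (Fin n) ℤ B.1).1 B.2
  exact congrFun (congrFun h i) j

theorem realMul_dot (B : so n) (v w : Fin n → ℝ) :
    dotU (realMul B.1 v) w = lowU B.1 w v - lowU B.1 v w := by
  rw [dotU, lowU, lowU, ← AddCircle.coe_sub]
  congr 1
  have e : braket (low B.1) v w = ∑ i, ∑ j, (low B.1 j i : ℝ) * v j * w i := by
    rw [braket, Finset.sum_comm]
  rw [e, braket, ← Finset.sum_sub_distrib]
  simp only [← Finset.sum_sub_distrib]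
  simp only [dotProduct, realMul, AddMonoidHom.coe_mk, ZeroHom.coe_mk, Matrix.mulVec,
    Finset.sum_mul, Matrix.map_apply]
  refine Finset.sum_congr rfl fun i _ => Finset.sum_congr rfl fun j _ => ?_
  have hs := skew B i j
  simp only [low, Matrix.of_apply]
  rcases lt_trichotomy i j with h | h | h
  · rw [if_neg (not_lt.2 h.le), if_pos h, hs]
    push_cast
    ring
  · subst h
    have : B.1 i i = 0 := by omega
    simp [this]
  · rw [if_pos h, if_neg (not_lt.2 h.le)]
    push_cast
    ring

theorem smooth_dotU : ((SmoothStructure.ofNormed.{u} (Fin n → ℝ)).prod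
    (SmoothStructure.ofNormed (Fin n → ℝ))).Smooth SmoothStructure.circle
      fun p => dotU p.1 p.2 := by
  intro d X _ _ p U h
  refine SmoothStructure.smooth_coe d _ U (SmoothStructure.smooth_ofNormed₂
    (f := fun q : (Fin n → ℝ) × (Fin n → ℝ) => q.1 ⬝ᵥ q.2) ?_ d p U h)
  unfold dotProduct
  fun_prop

theorem smooth_lowU (B : Matrix (Fin n) (Fin n) ℤ) :
    ((SmoothStructure.ofNormed.{u} (Fin n → ℝ)).prod
    (SmoothStructure.ofNormed (Fin n → ℝ))).Smooth SmoothStructure.circle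
      fun p => lowU B p.1 p.2 := by
  intro d X _ _ p U h
  refine SmoothStructure.smooth_coe d _ U (SmoothStructure.smooth_ofNormed₂
    (f := fun q : (Fin n → ℝ) × (Fin n → ℝ) => braket (low B) q.1 q.2) ?_ d p U h)
  unfold braket
  fun_prop

theorem smooth_realMul (B : Matrix (Fin n) (Fin n) ℤ) :
    (SmoothStructure.ofNormed.{u} (Fin n → ℝ)).Smooth
      (SmoothStructure.ofNormed (Fin n → ℝ)) (realMul B) := by
  refine SmoothStructure.smooth_ofNormed ?_
  simp only [realMul, AddMonoidHom.coe_mk, ZeroHom.coe_mk]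
  unfold Matrix.mulVec dotProduct
  fun_prop

theorem smooth_vec_add : ((SmoothStructure.ofNormed.{u} (Fin n → ℝ)).prod
    (SmoothStructure.ofNormed (Fin n → ℝ))).Smooth (SmoothStructure.ofNormed (Fin n → ℝ))
      fun p => p.1 + p.2 :=
  SmoothStructure.smooth_ofNormed₂ (contDiff_fst.add contDiff_snd)

theorem smooth_vec_neg : (SmoothStructure.ofNormed.{u} (Fin n → ℝ)).Smooth
    (SmoothStructure.ofNormed (Fin n → ℝ)) fun p => -p :=
  SmoothStructure.smooth_ofNormed contDiff_id.neg

end Forms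

/-- The crossed module of the T-duality 2-group `𝕋𝔻ₙ`: `G = ℝⁿ ⊕ ℝⁿ`, `H = (ℤⁿ ⊕ ℤⁿ) × U(1)`,
`t (m ⊕ m', t) = m ⊕ m'`, and `a ⊕ a'` acts by `(m ⊕ m', t) ↦ (m ⊕ m', t - a' · m)`. -/
noncomputable def TD (n : ℕ) : CrossedModule.{u} where
  G := (Fin n → ℝ) × (Fin n → ℝ)
  H := ((Fin n → ℤ) × (Fin n → ℤ)) × UnitAddCircle
  smG := (SmoothStructure.ofNormed (Fin n → ℝ)).prod (SmoothStructure.ofNormed (Fin n → ℝ))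
  smH := (SmoothStructure.discrete ((Fin n → ℤ) × (Fin n → ℤ))).prod SmoothStructure.circle
  t := ((intVec n).prodMap (intVec n)).comp (AddMonoidHom.fst _ _)
  α g :=
    { toFun := fun h => (h.1, h.2 - dotU g.2 (intVec n h.1.1))
      map_zero' := by
        refine Prod.ext rfl ?_
        simp [dotU_zero_right]
      map_add' := fun h h' => by
        refine Prod.ext rfl ?_
        simp only [Prod.fst_add, Prod.snd_add, map_add, dotU_add_right]
        abel }
  α_zero h := by
    refine Prod.ext rfl ?_
    simp [dotU_zero_left]
  α_add g g' h := by
    refine Prod.ext rfl ?_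
    simp only [Prod.snd_add, dotU_add_left, AddMonoidHom.coe_mk, ZeroHom.coe_mk]
    abel
  t_α _ _ := rfl
  α_t h h' := by
    refine Prod.ext rfl ?_
    change h'.2 - dotU (intVec n h.1.2) (intVec n h'.1.1) = h'.2
    rw [dotU_int, sub_zero]
  smooth_addG := SmoothStructure.prod_add smooth_vec_add smooth_vec_add
  smooth_negG := SmoothStructure.prod_neg smooth_vec_neg smooth_vec_neg
  smooth_addH := SmoothStructure.prod_add (SmoothStructure.smooth_discrete_add _)
    SmoothStructure.smooth_circle_add
  smooth_negH := SmoothStructure.prod_neg (SmoothStructure.smooth_discrete_neg _)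
    SmoothStructure.smooth_circle_neg
  smooth_t d _ _ _ _ U h := SmoothStructure.smooth_of_discrete _
    (fun m : (Fin n → ℤ) × (Fin n → ℤ) => (intVec n m.1, intVec n m.2)) d _ U h.1
  smooth_α d _ _ _ p U h := by
    refine ⟨h.2.1, ?_⟩
    have h1 := SmoothStructure.smooth_of_discrete (SmoothStructure.ofNormed (Fin n → ℝ))
      (fun m : (Fin n → ℤ) × (Fin n → ℤ) => intVec n m.1) d _ U h.2.1
    have h2 := smooth_dotU d (fun x => ((p x).1.2, intVec n (p x).2.1.1)) U ⟨h.1.2, h1⟩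
    have h3 := SmoothStructure.smooth_circle_add d
      (fun x => ((p x).2.2, -dotU (p x).1.2 (intVec n (p x).2.1.1))) U
      ⟨h.2.2, SmoothStructure.smooth_circle_neg d _ U h2⟩
    exact SmoothStructure.circle.congr d h3 fun x _ => sub_eq_add_neg _ _

/-- The homomorphism `a ⊕ a' ↦ a ⊕ (B a + a')` of `ℝⁿ ⊕ ℝⁿ`. -/
def shearReal {n : ℕ} (B : so n) :
    (Fin n → ℝ) × (Fin n → ℝ) →+ (Fin n → ℝ) × (Fin n → ℝ) where
  toFun g := (g.1, realMul B.1 g.1 + g.2)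
  map_zero' := by
    refine Prod.ext rfl ?_
    simp
  map_add' g g' := by
    refine Prod.ext rfl ?_
    simp only [Prod.fst_add, Prod.snd_add, map_add]
    abel

/-- The homomorphism `(m ⊕ m', t) ↦ (m ⊕ (B m + m'), t)` of `(ℤⁿ ⊕ ℤⁿ) × U(1)`. -/
def shearInt {n : ℕ} (B : so n) :
    ((Fin n → ℤ) × (Fin n → ℤ)) × UnitAddCircle →+
      ((Fin n → ℤ) × (Fin n → ℤ)) × UnitAddCircle where
  toFun h := ((h.1.1, B.1 *ᵥ h.1.1 + h.1.2), h.2)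
  map_zero' := by
    refine Prod.ext (Prod.ext rfl ?_) rfl
    simp
  map_add' h h' := by
    refine Prod.ext (Prod.ext rfl ?_) rfl
    simp only [Prod.fst_add, Prod.snd_add, Matrix.mulVec_add]
    abel

/-- The action of `B ∈ 𝔰𝔬(n, ℤ)` on `𝕋𝔻ₙ`: `φ (a ⊕ a') = a ⊕ (B a + a')`,
`f (m ⊕ m', t) = (m ⊕ (B m + m'), t)` and `η (a ⊕ a', b ⊕ b') = ⟨a|B_low|b⟩`. -/
noncomputable def actTD (n : ℕ) (B : so n) : CrossedIntertwiner.{u} (TD n) (TD n) where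
  φ := shearReal B
  f := shearInt B
  η g g' := (0, lowU B.1 g.1 g'.1)
  t_η _ _ := by
    change ((intVec n 0, intVec n 0) : (Fin n → ℝ) × (Fin n → ℝ)) = 0
    rw [map_zero]
    rfl
  φ_t h := by
    refine Prod.ext rfl ?_
    change realMul B.1 (intVec n h.1.1) + intVec n h.1.2 = intVec n (B.1 *ᵥ h.1.1 + h.1.2)
    rw [realMul_int, map_add]
  η_t h h' := by
    refine Prod.ext rfl ?_
    exact lowU_int _ _ _
  η_α g h := by
    obtain ⟨a, b⟩ := g
    obtain ⟨⟨m, k⟩, t⟩ := h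
    refine Prod.ext ?_ ?_
    · change (0 : (Fin n → ℤ) × (Fin n → ℤ)) + (m, B.1 *ᵥ m + k) = 0 + (m, B.1 *ᵥ m + k)
      rfl
    · change lowU B.1 a (intVec n m - a) + (t - dotU b (intVec n m)) =
        lowU B.1 (intVec n m - a) a - dotU (realMul B.1 a + b) (intVec n 0) +
          (t - dotU (realMul B.1 a + b) (intVec n m))
      rw [map_zero, dotU_zero_right, dotU_add_left, realMul_dot, lowU_sub_self, lowU_self_sub]
      abel
  η_cocycle g g' g'' := by
    refine Prod.ext rfl ?_
    change lowU B.1 g.1 g'.1 + lowU B.1 (g.1 + g'.1) g''.1 =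
      lowU B.1 g'.1 g''.1 - dotU (realMul B.1 g.1 + g.2) (intVec n 0) +
        lowU B.1 g.1 (g'.1 + g''.1)
    rw [map_zero, dotU_zero_right, lowU_add_left, lowU_add_right]
    abel
  smooth_φ d _ _ _ p U h := ⟨h.1, smooth_vec_add d
    (fun x => (realMul B.1 (p x).1, (p x).2)) U ⟨smooth_realMul B.1 d _ U h.1, h.2⟩⟩
  smooth_f _ _ _ _ _ _ h := ⟨smoothOn_discrete_map
    (fun m : (Fin n → ℤ) × (Fin n → ℤ) => (m.1, B.1 *ᵥ m.1 + m.2)) h.1, h.2⟩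
  smooth_η d _ _ _ p U h := ⟨SmoothStructure.const _ d 0 U,
    smooth_lowU B.1 d (fun x => ((p x).1.1, (p x).2.1)) U ⟨h.1.1, h.2.1⟩⟩

/-- The action of `𝔰𝔬(n, ℤ)` on `𝕋𝔻ₙ`. -/
noncomputable def actionTD (n : ℕ) : CrossedAction.{u} (so n) (TD n) where
  act := actTD n
  act_zero := by
    apply CrossedIntertwiner.ext
    · refine AddMonoidHom.ext fun g => Prod.ext rfl ?_
      change ((0 : so n).1.map (fun k : ℤ => (k : ℝ))) *ᵥ g.1 + g.2 = g.2
      simp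
    · refine AddMonoidHom.ext fun h => Prod.ext (Prod.ext rfl ?_) rfl
      change (0 : Matrix (Fin n) (Fin n) ℤ) *ᵥ h.1.1 + h.1.2 = h.1.2
      simp
    · funext g g'
      exact Prod.ext rfl (lowU_zero _ _)
  act_add B C := by
    apply CrossedIntertwiner.ext
    · refine AddMonoidHom.ext fun g => Prod.ext rfl ?_
      change realMul (B.1 + C.1) g.1 + g.2 = realMul B.1 g.1 + (realMul C.1 g.1 + g.2)
      rw [← add_assoc]
      congr 1
      funext i
      simp [realMul, Matrix.mulVec, dotProduct, add_mul, Finset.sum_add_distrib]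
    · refine AddMonoidHom.ext fun h => Prod.ext (Prod.ext rfl ?_) rfl
      change (B.1 + C.1) *ᵥ h.1.1 + h.1.2 = B.1 *ᵥ h.1.1 + (C.1 *ᵥ h.1.1 + h.1.2)
      rw [Matrix.add_mulVec, add_assoc]
    · funext g g'
      refine Prod.ext ?_ ?_
      · change (0 : (Fin n → ℤ) × (Fin n → ℤ)) = 0 + (0, B.1 *ᵥ 0 + 0)
        rw [Matrix.mulVec_zero, add_zero, zero_add]
        rfl
      · exact lowU_add _ _ _ _

/-- The half-geometric T-duality 2-group `𝕋𝔻ₙ ⋊ 𝔰𝔬(n, ℤ)`. Its cocycles are the half-geometric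
T-duality correspondences. -/
noncomputable def TFgeo (n : ℕ) : TwoGroup.{u} := semiDirect (actionTD n)

/-- The crossed module representing `F₂` T-backgrounds: `G = ℝⁿ`, `H = C^∞(𝕋ⁿ, U(1)) × ℤⁿ`,
`t (τ, m) = m`, and `a` acts by `(τ, m) ↦ (τ(· - a), m)`. -/
noncomputable def TBFF (n : ℕ) : CrossedModule.{u} where
  G := Fin n → ℝ
  H := TorusMap n × (Fin n → ℤ)
  smG := SmoothStructure.ofNormed (Fin n → ℝ)
  smH := (TorusMap.smooth n).prod (SmoothStructure.discrete (Fin n → ℤ))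
  t := (intVec n).comp (AddMonoidHom.snd _ _)
  α g := (TorusMap.translate g).prodMap (AddMonoidHom.id _)
  α_zero h := by
    refine Prod.ext (Subtype.ext (funext fun c => ?_)) rfl
    change h.1.1 (c - toTorus 0) = h.1.1 c
    have : toTorus (0 : Fin n → ℝ) = 0 := rfl
    rw [this, sub_zero]
  α_add g g' h := by
    refine Prod.ext (Subtype.ext (funext fun c => ?_)) rfl
    change h.1.1 (c - toTorus (g + g')) = h.1.1 (c - toTorus g - toTorus g')
    rw [TorusMap.toTorus_add, sub_sub]
  t_α _ _ := rfl
  α_t h h' := by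
    refine Prod.ext (Subtype.ext (funext fun c => ?_)) rfl
    change h'.1.1 (c - toTorus (intVec n h.2)) = h'.1.1 c
    rw [toTorus_intVec, sub_zero]
  smooth_addG := smooth_vec_add
  smooth_negG := smooth_vec_neg
  smooth_addH := SmoothStructure.prod_add TorusMap.smooth_add
    (SmoothStructure.smooth_discrete_add _)
  smooth_negH := SmoothStructure.prod_neg TorusMap.smooth_neg
    (SmoothStructure.smooth_discrete_neg _)
  smooth_t d _ _ _ _ U h := SmoothStructure.smooth_of_discrete _
    (fun m : Fin n → ℤ => intVec n m) d _ U h.2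
  smooth_α d _ _ _ p U h :=
    ⟨TorusMap.smooth_translate d (fun x => ((p x).1, (p x).2.1)) U ⟨h.1, h.2.1⟩, h.2.2⟩

/-- The homomorphism `(τ, m) ↦ (τ - ⟨m|B, m)` of `C^∞(𝕋ⁿ, U(1)) × ℤⁿ`, where `⟨m|B` is the map
`c ↦ ⟨m|B|c⟩`. -/
def subBra {n : ℕ} (B : so n) : TorusMap n × (Fin n → ℤ) →+ TorusMap n × (Fin n → ℤ) where
  toFun h := (h.1 - TorusMap.linear n (h.2 ᵥ* B.1), h.2)
  map_zero' := by
    refine Prod.ext ?_ rfl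
    simp
  map_add' h h' := by
    refine Prod.ext ?_ rfl
    simp only [Prod.fst_add, Prod.snd_add, Matrix.add_vecMul, map_add]
    abel

/-- The action of `B ∈ 𝔰𝔬(n, ℤ)` on `TBFF n`: `φ = id`, `f (τ, m) = (τ - ⟨m|B, m)` with
`⟨m|B` the map `c ↦ ⟨m|B|c⟩`, and `η (a, a') = ⟨a'|B_low|a⟩`, a constant map. -/
noncomputable def actTBFF (n : ℕ) (B : so n) : CrossedIntertwiner.{u} (TBFF n) (TBFF n) where
  φ := AddMonoidHom.id _
  f := subBra B
  η a a' := (TorusMap.const n (lowU B.1 a' a), 0)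
  t_η _ _ := map_zero (intVec n)
  φ_t _ := rfl
  η_t h h' := by
    refine Prod.ext ?_ rfl
    change TorusMap.const n (lowU B.1 (intVec n h'.2) (intVec n h.2)) = 0
    rw [lowU_int, map_zero]
  η_α := by
    intro (a : Fin n → ℝ) ⟨τ, m⟩
    refine Prod.ext ?_ rfl
    change TorusMap.const n (lowU B.1 (intVec n m - a) a) +
        (TorusMap.translate a τ - TorusMap.linear n (m ᵥ* B.1)) =
      TorusMap.translate a (TorusMap.const n (lowU B.1 a (intVec n m - a))) +
        TorusMap.translate a (τ - TorusMap.linear n (m ᵥ* B.1))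
    have e : m ᵥ* B.1 = -(B.1 *ᵥ m) := by
      funext j
      simp only [Matrix.vecMul, Matrix.mulVec, dotProduct, Pi.neg_apply,
        ← Finset.sum_neg_distrib]
      refine Finset.sum_congr rfl fun i _ => ?_
      rw [skew B j i]
      ring
    have k := realMul_dot B (intVec n m) a
    rw [realMul_int, dotU] at k
    rw [TorusMap.translate_const, map_sub, e, map_neg, map_neg, TorusMap.translate_linear, k,
      lowU_sub_self, lowU_self_sub]
    simp only [map_sub]
    abel
  η_cocycle := by
    intro (a : Fin n → ℝ) (a' : Fin n → ℝ) (a'' : Fin n → ℝ)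
    refine Prod.ext ?_ rfl
    change TorusMap.const n (lowU B.1 a' a) + TorusMap.const n (lowU B.1 a'' (a + a')) =
      TorusMap.translate a (TorusMap.const n (lowU B.1 a'' a')) +
        TorusMap.const n (lowU B.1 (a' + a'') a)
    rw [TorusMap.translate_const, lowU_add_left, lowU_add_right, map_add, map_add]
    abel
  smooth_φ _ _ _ _ _ _ h := h
  smooth_f d _ _ _ p U h := by
    refine ⟨?_, h.2⟩
    have h1 := SmoothStructure.smooth_of_discrete (TorusMap.smooth n)
      (fun m : Fin n → ℤ => TorusMap.linear n (m ᵥ* B.1)) d _ U h.2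
    have h2 := TorusMap.smooth_add d
      (fun x => ((p x).1, -TorusMap.linear n ((p x).2 ᵥ* B.1))) U
      ⟨h.1, TorusMap.smooth_neg d _ U h1⟩
    exact (TorusMap.smooth n).congr d h2 fun x _ => sub_eq_add_neg _ _
  smooth_η d _ _ _ p U h := ⟨TorusMap.smooth_const d _ U
    (smooth_lowU B.1 d (fun x => ((p x).2, (p x).1)) U ⟨h.2, h.1⟩),
    SmoothStructure.const _ d 0 U⟩

/-- The action of `𝔰𝔬(n, ℤ)` on `TBFF n`. -/
noncomputable def actionTBFF (n : ℕ) : CrossedAction.{u} (so n) (TBFF n) where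
  act := actTBFF n
  act_zero := by
    apply CrossedIntertwiner.ext
    · rfl
    · refine AddMonoidHom.ext fun h => Prod.ext ?_ rfl
      change h.1 - TorusMap.linear n (h.2 ᵥ* (0 : Matrix (Fin n) (Fin n) ℤ)) = h.1
      rw [Matrix.vecMul_zero, map_zero, sub_zero]
    · refine funext fun (a : Fin n → ℝ) => funext fun (a' : Fin n → ℝ) => ?_
      refine Prod.ext ?_ rfl
      change TorusMap.const n (lowU (0 : Matrix (Fin n) (Fin n) ℤ) a' a) = 0
      rw [lowU_zero, map_zero]
  act_add B C := by
    apply CrossedIntertwiner.ext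
    · rfl
    · refine AddMonoidHom.ext fun h => Prod.ext ?_ rfl
      change h.1 - TorusMap.linear n (h.2 ᵥ* (B.1 + C.1)) =
        h.1 - TorusMap.linear n (h.2 ᵥ* C.1) - TorusMap.linear n (h.2 ᵥ* B.1)
      rw [Matrix.vecMul_add, map_add]
      abel
    · refine funext fun (a : Fin n → ℝ) => funext fun (a' : Fin n → ℝ) => ?_
      refine Prod.ext ?_ rfl
      change TorusMap.const n (lowU (B.1 + C.1) a' a) = TorusMap.const n (lowU B.1 a' a) +
        (TorusMap.const n (lowU C.1 a' a) - TorusMap.linear n (0 ᵥ* B.1))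
      rw [lowU_add, Matrix.zero_vecMul, map_zero, sub_zero, map_add]

/-- The 2-group `TBFF n ⋊ 𝔰𝔬(n, ℤ)`, which represents `F₁` T-backgrounds with torus fibres of
dimension `n`. -/
noncomputable def TBF (n : ℕ) : TwoGroup.{u} := semiDirect (actionTBFF n)

/-- The homomorphism `(m ⊕ m', t) ↦ (c ↦ t + m' · c, m)`. -/
def legMap (n : ℕ) :
    ((Fin n → ℤ) × (Fin n → ℤ)) × UnitAddCircle →+ TorusMap n × (Fin n → ℤ) where
  toFun h := (TorusMap.const n h.2 + TorusMap.linear n h.1.2, h.1.1)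
  map_zero' := by
    refine Prod.ext ?_ rfl
    simp
  map_add' h h' := by
    refine Prod.ext ?_ rfl
    simp only [Prod.fst_add, Prod.snd_add, map_add]
    abel

/-- The left leg `𝕋𝔻ₙ → TBFF n`: `φ (a ⊕ a') = a`, `f (m ⊕ m', t) = (c ↦ t + m' · c, m)` and
`η (a ⊕ a', b ⊕ b') = a' · b`, a constant map. -/
noncomputable def leftLegR (n : ℕ) : CrossedIntertwiner.{u} (TD n) (TBFF n) where
  φ := AddMonoidHom.fst (Fin n → ℝ) (Fin n → ℝ)
  f := legMap n
  η g g' := (TorusMap.const n (dotU g.2 g'.1), 0)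
  t_η _ _ := map_zero (intVec n)
  φ_t _ := rfl
  η_t h h' := by
    refine Prod.ext ?_ rfl
    change TorusMap.const n (dotU (intVec n h.1.2) (intVec n h'.1.1)) = 0
    rw [dotU_int, map_zero]
  η_α g h := by
    obtain ⟨a, b⟩ := g
    obtain ⟨⟨m, k⟩, t⟩ := h
    refine Prod.ext ?_ rfl
    change TorusMap.const n (dotU b (intVec n m - a)) +
        (TorusMap.const n (t - dotU b (intVec n m)) + TorusMap.linear n k) =
      TorusMap.translate a (TorusMap.const n (dotU (intVec n k - b) a)) +
        TorusMap.translate a (TorusMap.const n t + TorusMap.linear n k)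
    have e : ((intVec n k ⬝ᵥ a : ℝ) : UnitAddCircle) = dotU a (intVec n k) := dotU_comm _ _
    rw [map_add (TorusMap.translate a), TorusMap.translate_const, TorusMap.translate_const,
      TorusMap.translate_linear, e, dotU_comm (intVec n k - b) a, dotU_sub_right,
      dotU_sub_right, dotU_comm b a]
    simp only [map_sub]
    abel
  η_cocycle g g' g'' := by
    refine Prod.ext ?_ rfl
    change TorusMap.const n (dotU g.2 g'.1) + TorusMap.const n (dotU (g.2 + g'.2) g''.1) =
      TorusMap.translate g.1 (TorusMap.const n (dotU g'.2 g''.1)) +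
        TorusMap.const n (dotU g.2 (g'.1 + g''.1))
    rw [TorusMap.translate_const, dotU_add_left, dotU_add_right, map_add, map_add]
    abel
  smooth_φ _ _ _ _ _ _ h := h.1
  smooth_f d _ _ _ p U h := by
    refine ⟨?_, smoothOn_discrete_map (fun m : (Fin n → ℤ) × (Fin n → ℤ) => m.1) h.1⟩
    have h1 := SmoothStructure.smooth_of_discrete (TorusMap.smooth n)
      (fun m : (Fin n → ℤ) × (Fin n → ℤ) => TorusMap.linear n m.2) d _ U h.1
    exact TorusMap.smooth_add d
      (fun x => (TorusMap.const n (p x).2, TorusMap.linear n (p x).1.2)) U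
      ⟨TorusMap.smooth_const d _ U h.2, h1⟩
  smooth_η d _ _ _ p U h := ⟨TorusMap.smooth_const d _ U
    (smooth_dotU d (fun x => ((p x).1.2, (p x).2.1)) U ⟨h.1.2, h.2.1⟩),
    SmoothStructure.const _ d 0 U⟩

theorem leftLegR_equivariant (n : ℕ) (B : so n) :
    ((actionTBFF.{u} n).act B).comp (leftLegR n) =
      (leftLegR n).comp ((actionTD n).act B) := by
  have e : ∀ m : Fin n → ℤ, m ᵥ* B.1 = -(B.1 *ᵥ m) := by
    intro m
    funext j
    simp only [Matrix.vecMul, Matrix.mulVec, dotProduct, Pi.neg_apply, ← Finset.sum_neg_distrib]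
    refine Finset.sum_congr rfl fun i _ => ?_
    rw [skew B j i]
    ring
  apply CrossedIntertwiner.ext
  · rfl
  · refine AddMonoidHom.ext fun h => Prod.ext ?_ rfl
    change TorusMap.const n h.2 + TorusMap.linear n h.1.2 - TorusMap.linear n (h.1.1 ᵥ* B.1) =
      TorusMap.const n h.2 + TorusMap.linear n (B.1 *ᵥ h.1.1 + h.1.2)
    rw [e, map_neg, map_add]
    abel
  · funext g g'
    refine Prod.ext ?_ rfl
    change TorusMap.const n (lowU B.1 g'.1 g.1) +
        (TorusMap.const n (dotU g.2 g'.1) - TorusMap.linear n (0 ᵥ* B.1)) =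
      TorusMap.const n (dotU (realMul B.1 g.1 + g.2) g'.1) +
        (TorusMap.const n (lowU B.1 g.1 g'.1) + TorusMap.linear n 0)
    rw [Matrix.zero_vecMul, map_zero, sub_zero, add_zero, dotU_add_left, realMul_dot]
    simp only [map_sub, map_add]
    abel

/-- The left leg projection `𝕋𝔻ₙ ⋊ 𝔰𝔬(n, ℤ) → TBFF n ⋊ 𝔰𝔬(n, ℤ)`. -/
noncomputable def leftLeg (n : ℕ) : TwoHom.{u} (TFgeo n) (TBF n) :=
  semiDirectHom (actionTD n) (actionTBFF n) (leftLegR n) (leftLegR_equivariant n)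

end HalfGeo

/-!
The left leg induces a bijection because the group `C^∞(𝕋ⁿ, U(1))` is, up to a real vector
space of functions, the group of affine maps `c ↦ s + k · c` with `s ∈ U(1)` and `k ∈ ℤⁿ`.

Every smooth map `τ : 𝕋ⁿ → U(1)` can be written in exactly one way as `c ↦ s + k · c + r c`, where
`r : 𝕋ⁿ → ℝ` is smooth with vanishing integral (`TorusMap.exists_family`,
`TorusMap.IsDecomp.unique`).
Here `k` is the degree, `s` the mean and `r` the oscillation of `τ`; all three depend smoothly on
parameters (`TorusMap.smoothOn_components`). The three parts are compatible with translations up to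
a shift of `s`, and with all the structure maps of `TBF n`, so that discarding the oscillation
(`affineMor`) preserves all identities between morphisms. The left leg takes values in morphisms
without oscillation; it is faithful (`faithful_leftLeg`), and every such morphism lifts to `TFgeo n`
once a lift of its source is chosen (`liftMor`).

A cocycle `a` of `TFgeo n` is said to lift a cocycle `c` of `TBF n` if the left leg of `a` is the
affine part of `c` (`Lifts a c`). Three facts about this relation give the theorem.

* If `a` lifts `c`, then `c` is equivalent to the left leg of `a` (`Lifts.equivalent_map`). The
  oscillations of `c` form a Čech cocycle with values in real functions, twisted by translations,
  and a smooth partition of unity makes it a coboundary.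
* Every `c` has a lift (`exists_lifts`). On objects, the missing data are functions `â i j` with
  `â i k - â j k - â i j = deg γ i j k + B j k (a i j)`. The right hand side is a Čech cocycle of real
  functions, hence again a coboundary.
* If `a` lifts `c`, `a'` lifts `c'`, and `c` and `c'` are equivalent, then `a` and `a'` are equivalent
  (`Lifts.equivalent`). The obstruction to lifting an equivalence is an additive `ℝⁿ`-valued Čech
  cocycle, which vanishes for the same reason.

The identities for lifted cocycles and equivalences are not computed: they hold since the left leg
is faithful and the images of both sides are the affine parts of known identities
(`TwoHom.Faithful.cocycle`, `TwoHom.Faithful.equivalence`).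

Sending `c` to the class of a lift is therefore well defined on cohomology, and it is inverse to the
map induced by the left leg.
-/

open MeasureTheory

namespace HalfGeo

/-! ### Lifting circle-valued functions to real-valued ones -/

/-- Continuous real functions on a connected space which agree modulo `ℤ`, and agree at one point,
are equal. -/
theorem eq_of_coe_eq_coe {A : Type*} [TopologicalSpace A] [PreconnectedSpace A] {f g : A → ℝ}
    (hf : Continuous f) (hg : Continuous g)
    (h : ∀ a, (f a : UnitAddCircle) = (g a : UnitAddCircle)) {a₀ : A} (h₀ : f a₀ = g a₀) (a : A) :
    f a = g a :=
  congrFun ((AddCircle.isCoveringMap_coe (1 : ℝ)).eq_of_comp_eq hf hg (funext h) a₀ h₀) a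

/-- Families of circle-valued functions on a vector space which vanish at the origin lift
continuously to real-valued functions vanishing at the origin: contract along rays and apply the
homotopy lifting property of `ℝ → ℝ / ℤ`. -/
theorem exists_continuous_lift {A V : Type*} [TopologicalSpace A] [NormedAddCommGroup V]
    [NormedSpace ℝ V] {F : A × V → UnitAddCircle} (hF : Continuous F) (h0 : ∀ a, F (a, 0) = 0) :
    ∃ g : A × V → ℝ, Continuous g ∧ (∀ a, g (a, 0) = 0) ∧
      ∀ q, (g q : UnitAddCircle) = F q := by
  let H : C(unitInterval × (A × V), UnitAddCircle) :=
    ⟨fun p => F (p.2.1, (p.1 : ℝ) • p.2.2), by fun_prop⟩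
  let f : C(A × V, ℝ) := ContinuousMap.const _ 0
  have H0 : ∀ a, H (0, a) = ((f a : ℝ) : UnitAddCircle) := by
    intro a
    change F (a.1, ((0 : unitInterval) : ℝ) • a.2) = ((0 : ℝ) : UnitAddCircle)
    simp [h0]
  have cov := AddCircle.isCoveringMap_coe (1 : ℝ)
  have hl := cov.liftHomotopy_lifts (H := H) (f := f) H0
  refine ⟨fun q => cov.liftHomotopy H f H0 (1, q), by fun_prop, ?_, ?_⟩
  · intro a
    have hz : Continuous fun s : unitInterval => cov.liftHomotopy H f H0 (s, (a, 0)) := by fun_prop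
    have hz0 : cov.liftHomotopy H f H0 (0, (a, 0)) = 0 :=
      cov.liftHomotopy_zero (H := H) (f := f) (H_0 := H0) (a, 0)
    refine eq_of_coe_eq_coe hz continuous_const (a₀ := 0) (fun s => ?_) hz0 1
    have := congrFun hl (s, (a, 0))
    simp only [Function.comp_apply] at this
    rw [this]
    change F (a, (s : ℝ) • (0 : V)) = _
    simp [h0]
  · intro q
    have := congrFun hl (1, q)
    simp only [Function.comp_apply] at this
    rw [this]
    change F (q.1, ((1 : unitInterval) : ℝ) • q.2) = _
    simp

/-- A continuous real function is smooth as soon as it is smooth as a map to `ℝ / ℤ`. -/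
theorem contMDiffOn_of_coe {E H M : Type*} [NormedAddCommGroup E] [NormedSpace ℝ E]
    [TopologicalSpace H] {I : ModelWithCorners ℝ E H} [TopologicalSpace M] [ChartedSpace H M]
    {f : M → ℝ} {W : Set M} (hf : ContinuousOn f W)
    (hs : ContMDiffOn I (𝓡 1) ∞ (fun x => AddCircle.toCircle (f x : UnitAddCircle)) W) :
    ContMDiffOn I 𝓘(ℝ, ℝ) ∞ f W := by
  intro x hx
  have hc : ContMDiffWithinAt I 𝓘(ℝ, ℂ) ∞
      (fun y => ((AddCircle.toCircle (f y : UnitAddCircle) : Circle) : ℂ)) W x := by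
    have := Fact.mk Complex.finrank_real_complex
    exact (contMDiff_coe_sphere (E := ℂ) (n := 1) (m := ∞)).contMDiffAt.comp_contMDiffWithinAt x
      (hs x hx)
  -- near `x`, the function `f` is recovered by the principal branch of the logarithm
  let G : ℂ → ℝ := fun z => f x + (2 * Real.pi)⁻¹ *
    (Complex.log (z * Complex.exp (-(2 * Real.pi * f x * Complex.I)))).im
  have hexp : ∀ y, ((AddCircle.toCircle (f y : UnitAddCircle) : Circle) : ℂ) =
      Complex.exp (2 * Real.pi * f y * Complex.I) := by
    intro y
    rw [AddCircle.toCircle_apply_mk, Circle.coe_exp]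
    simp
  have hG : ContDiffAt ℝ ∞ G ((AddCircle.toCircle (f x : UnitAddCircle) : Circle) : ℂ) := by
    have h1 : ContDiffAt ℝ ∞ (fun z : ℂ => z * Complex.exp (-(2 * Real.pi * f x * Complex.I)))
        ((AddCircle.toCircle (f x : UnitAddCircle) : Circle) : ℂ) := by fun_prop
    have h2 : ContDiffAt ℝ ∞ Complex.log
        (((AddCircle.toCircle (f x : UnitAddCircle) : Circle) : ℂ) *
          Complex.exp (-(2 * Real.pi * f x * Complex.I))) := by
      rw [hexp, ← Complex.exp_add, add_neg_cancel, Complex.exp_zero]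
      exact (Complex.contDiffAt_log (by simp)).restrict_scalars ℝ
    have h3 : ContDiffAt ℝ ∞ (fun z : ℂ => (Complex.log
        (z * Complex.exp (-(2 * Real.pi * f x * Complex.I)))).im)
        ((AddCircle.toCircle (f x : UnitAddCircle) : Circle) : ℂ) :=
      Complex.imCLM.contDiff.contDiffAt.comp _ (ContDiffAt.comp (g := Complex.log)
        (f := fun z : ℂ => z * Complex.exp (-(2 * Real.pi * f x * Complex.I))) _ h2 h1)
    exact contDiffAt_const.add (contDiffAt_const.mul h3)
  have key := hG.contMDiffAt.comp_contMDiffWithinAt x hc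
  have hG' : ∀ y, |f y - f x| < 1 / 2 →
      G ((AddCircle.toCircle (f y : UnitAddCircle) : Circle) : ℂ) = f y := by
    intro y hy
    have hpi := Real.pi_pos
    obtain ⟨h1, h2⟩ := abs_lt.1 hy
    have e : Complex.exp (2 * Real.pi * f y * Complex.I) *
        Complex.exp (-(2 * Real.pi * f x * Complex.I)) =
        Complex.exp (((2 * Real.pi * (f y - f x) : ℝ) : ℂ) * Complex.I) := by
      rw [← Complex.exp_add]
      congr 1
      push_cast
      ring
    simp only [G]
    rw [hexp, e, Complex.log_exp]
    · simp
      field_simp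
      ring
    · simp
      nlinarith
    · simp
      nlinarith
  refine key.congr_of_eventuallyEq ?_ (hG' x (by simp)).symm
  have := (hf x hx).eventually (Metric.ball_mem_nhds (f x) (by norm_num : (0 : ℝ) < 1 / 2))
  filter_upwards [this] with y hy
  exact (hG' y (by simpa [Real.dist_eq] using hy)).symm

/-! ### Integration over the torus -/

section TorusIntegral

variable {n : ℕ}

theorem continuous_toTorus : Continuous (toTorus (n := n)) :=
  continuous_pi fun i => (AddCircle.continuous_mk' 1).comp (continuous_apply i)

theorem isOpenQuotientMap_toTorus : IsOpenQuotientMap (toTorus (n := n)) :=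
  IsOpenQuotientMap.piMap (f := fun (_ : Fin n) (x : ℝ) => (x : UnitAddCircle))
    fun _ => QuotientAddGroup.isOpenQuotientMap_mk

theorem toTorus_surjective : Function.Surjective (toTorus (n := n)) :=
  isOpenQuotientMap_toTorus.surjective

theorem exists_intVec_of_toTorus_eq {v w : Fin n → ℝ} (h : toTorus v = toTorus w) :
    ∃ l : Fin n → ℤ, v = w + intVec n l := by
  have h' : ∀ i, ∃ l : ℤ, v i = w i + l := by
    intro i
    have e : ((v i - w i : ℝ) : UnitAddCircle) = 0 := by
      rw [AddCircle.coe_sub, sub_eq_zero]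
      exact congrFun h i
    obtain ⟨l, hl⟩ := (AddCircle.coe_eq_zero_iff _).1 e
    refine ⟨l, ?_⟩
    simp at hl
    linarith
  choose l hl using h'
  exact ⟨l, funext hl⟩

/-- The Haar probability measure of the torus `(ℝ / ℤ)ⁿ`. -/
noncomputable def torusHaar (n : ℕ) : Measure (Fin n → UnitAddCircle) :=
  Measure.pi fun _ => AddCircle.haarAddCircle

instance : IsProbabilityMeasure (torusHaar n) := by unfold torusHaar; infer_instance

instance : (torusHaar n).IsAddRightInvariant := by unfold torusHaar; infer_instance

theorem integrable_torusHaar {r : (Fin n → UnitAddCircle) → ℝ} (hr : Continuous r) :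
    Integrable r (torusHaar n) :=
  hr.integrable_of_hasCompactSupport (HasCompactSupport.of_compactSpace r)

/-- The half-open unit cube, a fundamental domain of `ℤⁿ` in `ℝⁿ`. -/
def unitCube (n : ℕ) : Set (Fin n → ℝ) := {v | ∀ i, v i ∈ Ioc (0 : ℝ) (0 + 1)}

theorem integral_torusHaar (r : (Fin n → UnitAddCircle) → ℝ) :
    ∫ c, r c ∂torusHaar n = ∫ v in unitCube n, r (toTorus v) :=
  UnitAddTorus.integral_preimage r (fun _ => 0)

theorem norm_le_one_of_mem_unitCube {v : Fin n → ℝ} (hv : v ∈ unitCube n) : ‖v‖ ≤ 1 := by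
  refine (pi_norm_le_iff_of_nonneg zero_le_one).2 fun i => ?_
  have h := hv i
  rw [Real.norm_eq_abs, abs_of_pos h.1]
  linarith [h.2]

/-- Differentiation under the integral sign, for integrals over the torus. The integral over the
unit cube is a convolution with the indicator function of the cube, evaluated at the origin. -/
theorem contDiffOn_integral_torus {P : Type*} [NormedAddCommGroup P] [NormedSpace ℝ P]
    {r : P → (Fin n → UnitAddCircle) → ℝ} {W : Set P} (hW : IsOpen W)
    (h : ContDiffOn ℝ ∞ (fun q : P × (Fin n → ℝ) => r q.1 (toTorus q.2)) (W ×ˢ univ)) :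
    ContDiffOn ℝ ∞ (fun x => ∫ c, r x c ∂torusHaar n) W := by
  -- The bump function `b` equals `1` on `-unitCube n` and makes the second factor of the
  -- convolution compactly supported, uniformly in the parameter.
  let b : ContDiffBump (0 : Fin n → ℝ) := ⟨2, 3, by norm_num, by norm_num⟩
  let f : (Fin n → ℝ) → ℝ := (unitCube n).indicator fun _ => 1
  let g : P → (Fin n → ℝ) → ℝ := fun p y => b y * r p (toTorus (-y))
  have hQ : MeasurableSet (unitCube n) := MeasurableSet.univ_pi' fun i => measurableSet_Ioc
  have hQ' : unitCube n ⊆ Metric.closedBall 0 1 := fun v hv => by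
    simpa using norm_le_one_of_mem_unitCube hv
  have hf : LocallyIntegrable f := by
    refine (IntegrableOn.integrable_indicator ?_ hQ).locallyIntegrable
    refine integrableOn_const ?_
    exact ((measure_mono hQ').trans_lt (isCompact_closedBall _ _).measure_lt_top).ne
  have hg : ContDiffOn ℝ ∞ ↿g (W ×ˢ univ) := by
    have h1 : ContDiffOn ℝ ∞ (fun q : P × (Fin n → ℝ) => r q.1 (toTorus (-q.2)))
        (W ×ˢ univ) :=
      h.comp (f := fun q : P × (Fin n → ℝ) => (q.1, -q.2))
        (contDiff_fst.prodMk contDiff_snd.neg).contDiffOn fun q hq => ⟨hq.1, trivial⟩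
    exact (b.contDiff.comp contDiff_snd).contDiffOn.mul h1
  have key := contDiffOn_convolution_right_with_param (μ := volume)
    (ContinuousLinearMap.mul ℝ ℝ) (n := ⊤) hW (isCompact_closedBall (0 : Fin n → ℝ) 3)
    (g := g) (fun p x _ hx => by
      have : b x = 0 := b.zero_of_le_dist (by
        simp only [Metric.mem_closedBall, not_le] at hx
        exact hx.le)
      simp [g, this]) hf hg
  have key' := key.comp (f := fun x : P => (x, (0 : Fin n → ℝ)))
    (contDiff_id.prodMk contDiff_const).contDiffOn fun x hx => ⟨hx, trivial⟩
  refine key'.congr fun x hx => ?_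
  simp only [Function.comp_apply, convolution_def, integral_torusHaar]
  rw [← integral_indicator hQ]
  refine integral_congr_ae (Filter.Eventually.of_forall fun v => ?_)
  by_cases hv : v ∈ unitCube n
  · have : b (-v) = 1 := b.one_of_mem_closedBall (by
      have := norm_le_one_of_mem_unitCube hv
      have h2 : b.rIn = 2 := rfl
      simp [h2]
      linarith)
    simp [f, g, hv, this]
  · simp [f, hv]

theorem contMDiffOn_integral_torus {d : ℕ} {X : Type*} [TopologicalSpace X]
    [ChartedSpace (EuclideanSpace ℝ (Fin d)) X] [IsManifold (𝓡 d) ∞ X]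
    {r : X → (Fin n → UnitAddCircle) → ℝ} {U : Set X} (hU : IsOpen U)
    (h : ContMDiffOn ((𝓡 d).prod 𝓘(ℝ, Fin n → ℝ)) 𝓘(ℝ, ℝ) ∞
      (fun q : X × (Fin n → ℝ) => r q.1 (toTorus q.2)) (U ×ˢ univ)) :
    ContMDiffOn (𝓡 d) 𝓘(ℝ, ℝ) ∞ (fun x => ∫ c, r x c ∂torusHaar n) U := by
  intro x₀ hx₀
  let e := chartAt (EuclideanSpace ℝ (Fin d)) x₀
  have hW : IsOpen (e.target ∩ e.symm ⁻¹' U) := e.symm.isOpen_inter_preimage hU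
  have h0 : ContMDiffOn ((𝓡 d).prod 𝓘(ℝ, Fin n → ℝ)) 𝓘(ℝ, ℝ) ∞
      (fun q : EuclideanSpace ℝ (Fin d) × (Fin n → ℝ) => r (e.symm q.1) (toTorus q.2))
      ((e.target ∩ e.symm ⁻¹' U) ×ˢ univ) := by
    refine ContMDiffOn.comp (g := fun q : X × (Fin n → ℝ) => r q.1 (toTorus q.2))
      (f := fun q : EuclideanSpace ℝ (Fin d) × (Fin n → ℝ) => (e.symm q.1, q.2)) h ?_
      fun q hq => ⟨hq.1.2, trivial⟩
    refine ContMDiffOn.prodMk ?_ contMDiffOn_snd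
    exact (contMDiffOn_chart_symm (x := x₀)).comp contMDiffOn_fst fun q hq => hq.1.1
  have h1 : ContDiffOn ℝ ∞ (fun q : EuclideanSpace ℝ (Fin d) × (Fin n → ℝ) =>
      r (e.symm q.1) (toTorus q.2)) ((e.target ∩ e.symm ⁻¹' U) ×ˢ univ) := by
    rw [← contMDiffOn_iff_contDiffOn, modelWithCornersSelf_prod, ← chartedSpaceSelf_prod]
    exact h0
  have h2 := (contDiffOn_integral_torus (r := fun y => r (e.symm y)) hW h1).contMDiffOn
  have h3 : ContMDiffOn (𝓡 d) 𝓘(ℝ, ℝ) ∞ (fun x => ∫ c, r (e.symm (e x)) c ∂torusHaar n)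
      (U ∩ e.source) := by
    refine ContMDiffOn.comp (g := fun y => ∫ c, r (e.symm y) c ∂torusHaar n) h2
      ((contMDiffOn_chart (x := x₀)).mono inter_subset_right) ?_
    intro y hy
    refine ⟨e.map_source hy.2, ?_⟩
    rw [mem_preimage, e.left_inv hy.2]
    exact hy.1
  have h4 : ContMDiffOn (𝓡 d) 𝓘(ℝ, ℝ) ∞ (fun x => ∫ c, r x c ∂torusHaar n)
      (U ∩ e.source) := h3.congr fun y hy => by rw [e.left_inv hy.2]
  have h5 := h4.contMDiffAt ((hU.inter e.open_source).mem_nhds ⟨hx₀, mem_chart_source _ x₀⟩)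
  exact h5.contMDiffWithinAt

end TorusIntegral

/-! ### The affine part and the oscillation of a circle-valued function on the torus -/

namespace TorusMap

variable {n : ℕ}

/-- The decomposition `τ = s + k · c + r c` of a map `𝕋ⁿ → U(1)` into a constant, a linear map and
a real-valued function of mean zero. -/
structure IsDecomp (τ : TorusMap n) (k : Fin n → ℤ) (s : UnitAddCircle)
    (r : (Fin n → UnitAddCircle) → ℝ) : Prop where
  cont : Continuous r
  integral : ∫ c, r c ∂torusHaar n = 0
  eq : ∀ c, τ.1 c = s + (linear n k).1 c + (r c : UnitAddCircle)

theorem linear_toTorus (m : Fin n → ℤ) (v : Fin n → ℝ) :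
    (linear n m).1 (toTorus v) = ((intVec n m ⬝ᵥ v : ℝ) : UnitAddCircle) := (coe_dot m v).symm

theorem IsDecomp.sub {τ τ' : TorusMap n} {k k' s s' r r'} (h : IsDecomp τ k s r)
    (h' : IsDecomp τ' k' s' r') : IsDecomp (τ - τ') (k - k') (s - s') (r - r') where
  cont := h.cont.sub h'.cont
  integral := by
    simp only [Pi.sub_apply]
    rw [integral_sub (integrable_torusHaar h.cont) (integrable_torusHaar h'.cont), h.integral,
      h'.integral, sub_zero]
  eq c := by
    change τ.1 c - τ'.1 c = _
    rw [h.eq, h'.eq, map_sub, Pi.sub_apply, AddCircle.coe_sub]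
    change _ = s - s' + ((linear n k).1 c - (linear n k').1 c) + _
    abel

theorem IsDecomp.add {τ τ' : TorusMap n} {k k' s s' r r'} (h : IsDecomp τ k s r)
    (h' : IsDecomp τ' k' s' r') : IsDecomp (τ + τ') (k + k') (s + s') (r + r') where
  cont := h.cont.add h'.cont
  integral := by
    simp only [Pi.add_apply]
    rw [integral_add (integrable_torusHaar h.cont) (integrable_torusHaar h'.cont), h.integral,
      h'.integral, add_zero]
  eq c := by
    change τ.1 c + τ'.1 c = _
    rw [h.eq, h'.eq, map_add, Pi.add_apply, AddCircle.coe_add]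
    change _ = s + s' + ((linear n k).1 c + (linear n k').1 c) + _
    abel

theorem isDecomp_const (s : UnitAddCircle) : IsDecomp (const n s) 0 s 0 where
  cont := continuous_const
  integral := by simp
  eq c := by simp [const]

theorem isDecomp_linear (k : Fin n → ℤ) : IsDecomp (linear n k) k 0 0 where
  cont := continuous_const
  integral := by simp
  eq c := by simp

theorem IsDecomp.translate {τ : TorusMap n} {k s r} (h : IsDecomp τ k s r) (a : Fin n → ℝ) :
    IsDecomp (translate a τ) k (s - dotU (intVec n k) a) (fun c => r (c - toTorus a)) where
  cont := h.cont.comp (continuous_id.sub continuous_const)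
  integral := (integral_sub_right_eq_self r (toTorus a)).trans h.integral
  eq c := by
    have e : (TorusMap.translate a (linear n k)).1 c =
        (linear n k).1 c - dotU (intVec n k) a := by rw [translate_linear]; rfl
    change τ.1 (c - toTorus a) = _
    rw [h.eq]
    change s + (TorusMap.translate a (linear n k)).1 c + _ = _
    rw [e]
    abel

theorem IsDecomp.eq_zero {k : Fin n → ℤ} {s r} (h : IsDecomp 0 k s r) :
    k = 0 ∧ s = 0 ∧ r = 0 := by
  have hc : Continuous fun v : Fin n → ℝ => intVec n k ⬝ᵥ v + r (toTorus v) := by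
    refine Continuous.add ?_ (h.cont.comp continuous_toTorus)
    unfold dotProduct
    fun_prop
  have h1 : ∀ v : Fin n → ℝ, intVec n k ⬝ᵥ v + r (toTorus v) = r 0 := by
    refine eq_of_coe_eq_coe (a₀ := 0) hc continuous_const (fun v => ?_) ?_
    · have e := h.eq (toTorus v)
      have e' := h.eq (toTorus 0)
      rw [linear_toTorus] at e e'
      rw [dotProduct_zero, AddCircle.coe_zero, add_zero] at e'
      rw [AddCircle.coe_add]
      have : toTorus (0 : Fin n → ℝ) = 0 := rfl
      rw [this] at e'
      have e0 : ∀ c, (0 : TorusMap n).1 c = 0 := fun _ => rfl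
      rw [e0, add_assoc] at e
      rw [e0] at e'
      exact add_left_cancel (e.symm.trans e')
    · simp [show toTorus (0 : Fin n → ℝ) = 0 from rfl]
  have hk : k = 0 := by
    funext j
    have e := h1 (intVec n (Pi.single j 1))
    rw [toTorus_intVec] at e
    have e2 : intVec n k ⬝ᵥ intVec n (Pi.single j 1) = 0 := by linarith
    have e3 : intVec n (Pi.single j 1) = Pi.single j (1 : ℝ) := by
      funext i
      by_cases hi : i = j
      · subst hi; simp [intVec]
      · simp [intVec, hi]
    rw [e3, dotProduct_single_one] at e2
    exact Int.cast_eq_zero.1 (show ((k j : ℤ) : ℝ) = 0 from e2)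
  subst hk
  have hr : ∀ c, r c = r 0 := by
    intro c
    obtain ⟨v, rfl⟩ := toTorus_surjective c
    have := h1 v
    rwa [map_zero, zero_dotProduct, zero_add] at this
  have hr0 : r 0 = 0 := by
    have := h.integral
    simp_rw [hr] at this
    simpa using this
  have hr' : r = 0 := funext fun c => (hr c).trans hr0
  subst hr'
  refine ⟨rfl, ?_, rfl⟩
  have := h.eq 0
  simpa using this.symm

theorem IsDecomp.unique {τ : TorusMap n} {k k' s s' r r'} (h : IsDecomp τ k s r)
    (h' : IsDecomp τ k' s' r') : k = k' ∧ s = s' ∧ r = r' := by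
  have := h.sub h'
  rw [sub_self] at this
  obtain ⟨h1, h2, h3⟩ := this.eq_zero
  exact ⟨sub_eq_zero.1 h1, sub_eq_zero.1 h2, sub_eq_zero.1 h3⟩

/-- Decomposition of a continuous family of maps `𝕋ⁿ → U(1)`, normalised at the origin instead of
by the mean. -/
theorem exists_family {A : Type*} [TopologicalSpace A] {p : A → TorusMap n}
    (hp : Continuous fun q : A × (Fin n → ℝ) => (p q.1).1 (toTorus q.2)) :
    ∃ (k : A → Fin n → ℤ) (r : A → (Fin n → UnitAddCircle) → ℝ),
      (∀ a, ∀ᶠ b in 𝓝 a, k b = k a) ∧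
      (Continuous fun q : A × (Fin n → ℝ) => r q.1 (toTorus q.2)) ∧
      ∀ a c, (p a).1 c = (p a).1 0 + (linear n (k a)).1 c + (r a c : UnitAddCircle) := by
  have h00 : toTorus (0 : Fin n → ℝ) = 0 := rfl
  have hp0 : Continuous fun q : A × (Fin n → ℝ) => (p q.1).1 0 :=
    hp.comp (f := fun q : A × (Fin n → ℝ) => (q.1, 0)) (by fun_prop)
  obtain ⟨g, hg, hg0, hgF⟩ := exists_continuous_lift
    (F := fun q => (p q.1).1 (toTorus q.2) - (p q.1).1 0) (hp.sub hp0)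
    (fun a => by simp only [h00, sub_self])
  have hcoe : ∀ a (l : Fin n → ℤ), ((g (a, intVec n l) : ℝ) : UnitAddCircle) = 0 := by
    intro a l
    rw [hgF, toTorus_intVec, sub_self]
  -- Both sides are continuous lifts of the same function of `v`, and they agree at the origin.
  have hper : ∀ a (l : Fin n → ℤ) v, g (a, v + intVec n l) = g (a, v) + g (a, intVec n l) := by
    intro a l
    refine eq_of_coe_eq_coe (a₀ := 0) (by fun_prop) (by fun_prop) (fun v => ?_)
      (by rw [zero_add, hg0, zero_add])
    rw [AddCircle.coe_add, hcoe, add_zero, hgF, hgF, toTorus_add, toTorus_intVec, add_zero]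
  have hk : ∀ a (j : Fin n), ∃ k : ℤ, g (a, intVec n (Pi.single j 1)) = k := by
    intro a j
    obtain ⟨k, hk⟩ := (AddCircle.coe_eq_zero_iff _).1 (hcoe a (Pi.single j 1))
    exact ⟨k, by simpa using hk.symm⟩
  choose k hk using hk
  let G : A → (Fin n → ℤ) →+ ℝ := fun a =>
    { toFun := fun l => g (a, intVec n l)
      map_zero' := by rw [map_zero, hg0]
      map_add' := fun l l' => by rw [map_add, hper] }
  have hG : ∀ a l, g (a, intVec n l) = intVec n (k a) ⬝ᵥ intVec n l := by
    intro a l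
    change G a l = _
    conv_lhs => rw [← Finset.univ_sum_single l, map_sum]
    rw [dotProduct]
    refine Finset.sum_congr rfl fun j _ => ?_
    have e : Pi.single j (l j) = l j • (Pi.single j 1 : Fin n → ℤ) := by
      rw [← Pi.single_smul, smul_eq_mul, _root_.mul_one]
    rw [e, map_zsmul, show G a (Pi.single j 1) = k a j from hk a j, zsmul_eq_mul, _root_.mul_comm]
    rfl
  -- `g (a, v) - k a · v` is periodic in `v`, so that it descends along any section of `toTorus`.
  let rep : (Fin n → UnitAddCircle) → Fin n → ℝ := Function.surjInv toTorus_surjective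
  have hr : ∀ a v, g (a, rep (toTorus v)) - intVec n (k a) ⬝ᵥ rep (toTorus v) =
      g (a, v) - intVec n (k a) ⬝ᵥ v := by
    intro a v
    obtain ⟨l, hl⟩ := exists_intVec_of_toTorus_eq
      (Function.surjInv_eq toTorus_surjective (toTorus v))
    change rep (toTorus v) = _ at hl
    rw [hl, hper, hG, dotProduct_add]
    ring
  -- `k a` is integral and depends continuously on `a`, hence is locally constant.
  have hkc : ∀ a, ∀ᶠ b in 𝓝 a, k b = k a := by
    intro a
    have : ∀ᶠ b in 𝓝 a, ∀ j, k b j = k a j := by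
      rw [Filter.eventually_all]
      intro j
      have hc : Continuous fun b => g (b, intVec n (Pi.single j 1)) := by fun_prop
      filter_upwards [hc.continuousAt (Metric.ball_mem_nhds _ zero_lt_one)] with b hb
      simp only [mem_preimage, hk, Metric.mem_ball, Real.dist_eq] at hb
      have : |k b j - k a j| < 1 := by exact_mod_cast hb
      have := Int.abs_lt_one_iff.1 this
      omega
    filter_upwards [this] with b hb using funext hb
  refine ⟨k, fun a c => g (a, rep c) - intVec n (k a) ⬝ᵥ rep c, hkc, ?_, ?_⟩
  · simp only [hr]
    refine hg.sub ?_
    have hkc' : ∀ j, Continuous fun q : A × (Fin n → ℝ) => (k q.1 j : ℝ) := fun j => by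
      simp only [← hk]
      fun_prop
    simp only [dotProduct]
    exact continuous_finsetSum _ fun j _ => (hkc' j).mul (by fun_prop)
  · intro a c
    obtain ⟨v, rfl⟩ := toTorus_surjective c
    simp only [hr]
    rw [AddCircle.coe_sub, hgF, linear_toTorus]
    abel

theorem IsDecomp.of_origin {τ : TorusMap n} {k : Fin n → ℤ} {s : UnitAddCircle}
    {r : (Fin n → UnitAddCircle) → ℝ} (hr : Continuous r)
    (h : ∀ c, τ.1 c = s + (linear n k).1 c + (r c : UnitAddCircle)) :
    IsDecomp τ k (s + ((∫ c, r c ∂torusHaar n : ℝ) : UnitAddCircle))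
      (fun c => r c - ∫ c, r c ∂torusHaar n) where
  cont := hr.sub continuous_const
  integral := by
    rw [integral_sub (integrable_torusHaar hr) (integrable_const _)]
    simp
  eq c := by
    rw [h, AddCircle.coe_sub]
    abel

theorem continuous_iff_toTorus {Y : Type*} [TopologicalSpace Y] {r : (Fin n → UnitAddCircle) → Y} :
    Continuous r ↔ Continuous fun v => r (toTorus v) :=
  isOpenQuotientMap_toTorus.isQuotientMap.continuous_iff

end TorusMap

namespace TorusMap

variable {n : ℕ}

theorem continuous_apply_toTorus (τ : TorusMap n) : Continuous fun v => τ.1 (toTorus v) := by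
  have h : Continuous fun v => (τ.1 (toTorus v)).toCircle := ContMDiff.continuous τ.2
  exact (AddCircle.homeomorphCircle one_ne_zero).isInducing.continuous_iff.2 (by
    refine h.congr fun v => ?_
    simp [AddCircle.homeomorphCircle_apply])

theorem exists_isDecomp (τ : TorusMap n) : ∃ k s r, IsDecomp τ k s r := by
  obtain ⟨k, r, -, hr, h⟩ := exists_family (A := Unit) (p := fun _ => τ)
    ((continuous_apply_toTorus τ).comp continuous_snd)
  have hr' : Continuous (r ()) := continuous_iff_toTorus.2
    (hr.comp (f := fun v : Fin n → ℝ => ((), v)) (by fun_prop))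
  exact ⟨_, _, _, IsDecomp.of_origin hr' (h ())⟩

/-- The oscillation of `τ : 𝕋ⁿ → U(1)`: its real-valued component of mean zero. -/
noncomputable def osc (τ : TorusMap n) : (Fin n → UnitAddCircle) → ℝ :=
  (exists_isDecomp τ).choose_spec.choose_spec.choose

theorem isDecomp_choose (τ : TorusMap n) :
    IsDecomp τ (exists_isDecomp τ).choose (exists_isDecomp τ).choose_spec.choose (osc τ) :=
  (exists_isDecomp τ).choose_spec.choose_spec.choose_spec

/-- The degree of a map `𝕋ⁿ → U(1)`: the coefficients of its linear component. -/
noncomputable def deg (n : ℕ) : TorusMap n →+ (Fin n → ℤ) where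
  toFun τ := (exists_isDecomp τ).choose
  map_zero' := ((isDecomp_choose (0 : TorusMap n)).eq_zero).1
  map_add' τ τ' := ((isDecomp_choose (τ + τ')).unique
    ((isDecomp_choose τ).add (isDecomp_choose τ'))).1

/-- The mean of a map `𝕋ⁿ → U(1)`: its constant component. -/
noncomputable def mean (n : ℕ) : TorusMap n →+ UnitAddCircle where
  toFun τ := (exists_isDecomp τ).choose_spec.choose
  map_zero' := ((isDecomp_choose (0 : TorusMap n)).eq_zero).2.1
  map_add' τ τ' := ((isDecomp_choose (τ + τ')).unique
    ((isDecomp_choose τ).add (isDecomp_choose τ'))).2.1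

theorem isDecomp (τ : TorusMap n) : IsDecomp τ (deg n τ) (mean n τ) (osc τ) :=
  isDecomp_choose τ

theorem osc_add (τ τ' : TorusMap n) : osc (τ + τ') = osc τ + osc τ' :=
  ((isDecomp (τ + τ')).unique ((isDecomp τ).add (isDecomp τ'))).2.2

theorem osc_sub (τ τ' : TorusMap n) : osc (τ - τ') = osc τ - osc τ' :=
  ((isDecomp (τ - τ')).unique ((isDecomp τ).sub (isDecomp τ'))).2.2

theorem osc_zero : osc (0 : TorusMap n) = 0 := (isDecomp (0 : TorusMap n)).eq_zero.2.2

@[simp] theorem deg_const (s : UnitAddCircle) : deg n (const n s) = 0 :=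
  ((isDecomp (const n s)).unique (isDecomp_const s)).1

@[simp] theorem mean_const (s : UnitAddCircle) : mean n (const n s) = s :=
  ((isDecomp (const n s)).unique (isDecomp_const s)).2.1

@[simp] theorem osc_const (s : UnitAddCircle) : osc (const n s) = 0 :=
  ((isDecomp (const n s)).unique (isDecomp_const s)).2.2

@[simp] theorem deg_linear (k : Fin n → ℤ) : deg n (linear n k) = k :=
  ((isDecomp (linear n k)).unique (isDecomp_linear k)).1

@[simp] theorem mean_linear (k : Fin n → ℤ) : mean n (linear n k) = 0 :=
  ((isDecomp (linear n k)).unique (isDecomp_linear k)).2.1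

@[simp] theorem osc_linear (k : Fin n → ℤ) : osc (linear n k) = 0 :=
  ((isDecomp (linear n k)).unique (isDecomp_linear k)).2.2

@[simp] theorem deg_translate (a : Fin n → ℝ) (τ : TorusMap n) :
    deg n (translate a τ) = deg n τ :=
  ((isDecomp (translate a τ)).unique ((isDecomp τ).translate a)).1

@[simp] theorem mean_translate (a : Fin n → ℝ) (τ : TorusMap n) :
    mean n (translate a τ) = mean n τ - dotU (intVec n (deg n τ)) a :=
  ((isDecomp (translate a τ)).unique ((isDecomp τ).translate a)).2.1

@[simp] theorem osc_translate (a : Fin n → ℝ) (τ : TorusMap n) :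
    osc (translate a τ) = fun c => osc τ (c - toTorus a) :=
  ((isDecomp (translate a τ)).unique ((isDecomp τ).translate a)).2.2

/-- The affine part of a map `𝕋ⁿ → U(1)`: what remains after discarding its oscillation. -/
noncomputable def affine (n : ℕ) : TorusMap n →+ TorusMap n :=
  (const n).comp (mean n) + (linear n).comp (deg n)

theorem affine_apply (τ : TorusMap n) : affine n τ = const n (mean n τ) + linear n (deg n τ) := rfl

@[simp] theorem affine_const (s : UnitAddCircle) : affine n (const n s) = const n s := by
  simp [affine_apply]

@[simp] theorem affine_linear (k : Fin n → ℤ) : affine n (linear n k) = linear n k := by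
  simp [affine_apply]

theorem affine_translate (a : Fin n → ℝ) (τ : TorusMap n) :
    affine n (translate a τ) = translate a (affine n τ) := by
  rw [affine_apply, affine_apply, map_add, translate_const, translate_linear, deg_translate,
    mean_translate, map_sub, dotU]
  abel

/-- The value of `τ` is that of its affine part plus the oscillation. -/
theorem apply_eq_affine_add_osc (τ : TorusMap n) (c : Fin n → UnitAddCircle) :
    τ.1 c = (affine n τ).1 c + (osc τ c : UnitAddCircle) :=
  (isDecomp τ).eq c

/-! ### Smooth families of functions on the torus -/

section Families

variable {d : ℕ} {X : Type u} [TopologicalSpace X] [ChartedSpace (EuclideanSpace ℝ (Fin d)) X]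

theorem smooth_linear_of_discrete {k : X → Fin n → ℤ} {U : Set X}
    (hk : (SmoothStructure.discrete.{u} (Fin n → ℤ)).SmoothOn d k U) :
    (smooth n).SmoothOn d (fun x => linear n (k x)) U :=
  SmoothStructure.smooth_of_discrete _ (fun m => linear n m) d k U hk

theorem smooth_sub {p q : X → TorusMap n} {U : Set X} (hp : (smooth n).SmoothOn d p U)
    (hq : (smooth n).SmoothOn d q U) : (smooth n).SmoothOn d (fun x => p x - q x) U := by
  have := smooth_add d (fun x => (p x, -q x)) U ⟨hp, smooth_neg d q U hq⟩
  exact (smooth n).congr d this fun x _ => sub_eq_add_neg _ _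

open Classical in
/-- The map `𝕋ⁿ → U(1)` given by a smooth real-valued function on the torus (and zero if the
function is not smooth). -/
noncomputable def ofReal (r : (Fin n → UnitAddCircle) → ℝ) : TorusMap n :=
  if h : ContMDiff 𝓘(ℝ, Fin n → ℝ) 𝓘(ℝ, ℝ) ∞ (fun v : Fin n → ℝ => r (toTorus v)) then
    ⟨fun c => (r c : UnitAddCircle), SmoothStructure.contMDiff_toCircle_coe.comp h⟩
  else 0

theorem ofReal_apply {r : (Fin n → UnitAddCircle) → ℝ}
    (h : ContMDiff 𝓘(ℝ, Fin n → ℝ) 𝓘(ℝ, ℝ) ∞ (fun v : Fin n → ℝ => r (toTorus v)))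
    (c : Fin n → UnitAddCircle) : (ofReal r).1 c = (r c : UnitAddCircle) := by
  rw [ofReal, dif_pos h]

theorem ofReal_apply_of_family {r : X → (Fin n → UnitAddCircle) → ℝ} {U : Set X}
    (h : ContMDiffOn ((𝓡 d).prod 𝓘(ℝ, Fin n → ℝ)) 𝓘(ℝ, ℝ) ∞
      (fun q : X × (Fin n → ℝ) => r q.1 (toTorus q.2)) (U ×ˢ univ)) {x : X} (hx : x ∈ U)
    (c : Fin n → UnitAddCircle) : (ofReal (r x)).1 c = (r x c : UnitAddCircle) := by
  refine ofReal_apply ?_ c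
  rw [← contMDiffOn_univ]
  exact ContMDiffOn.comp (g := fun q : X × (Fin n → ℝ) => r q.1 (toTorus q.2))
    (f := fun v : Fin n → ℝ => (x, v)) h (contMDiffOn_const.prodMk contMDiffOn_id)
    fun v _ => ⟨hx, trivial⟩

theorem smoothOn_ofReal {r : X → (Fin n → UnitAddCircle) → ℝ} {U : Set X}
    (h : ContMDiffOn ((𝓡 d).prod 𝓘(ℝ, Fin n → ℝ)) 𝓘(ℝ, ℝ) ∞
      (fun q : X × (Fin n → ℝ) => r q.1 (toTorus q.2)) (U ×ˢ univ)) :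
    (smooth n).SmoothOn d (fun x => ofReal (r x)) U := by
  refine (SmoothStructure.contMDiff_toCircle_coe.comp_contMDiffOn h).congr fun q hq => ?_
  simp only [Function.comp_apply]
  rw [ofReal_apply_of_family h hq.1]

variable [IsManifold (𝓡 d) ∞ X]

/-- The components of a smooth family of maps `𝕋ⁿ → U(1)` depend smoothly on the parameter. -/
theorem smoothOn_components {p : X → TorusMap n} {U : Set X} (hU : IsOpen U)
    (hp : (smooth n).SmoothOn d p U) :
    (SmoothStructure.discrete.{u} (Fin n → ℤ)).SmoothOn d (fun x => deg n (p x)) U ∧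
    SmoothStructure.circle.SmoothOn d (fun x => mean n (p x)) U ∧
    ContMDiffOn ((𝓡 d).prod 𝓘(ℝ, Fin n → ℝ)) 𝓘(ℝ, ℝ) ∞
      (fun q : X × (Fin n → ℝ) => osc (p q.1) (toTorus q.2)) (U ×ˢ univ) := by
  have hcont : Continuous fun q : U × (Fin n → ℝ) => (p q.1.1).1 (toTorus q.2) := by
    have h1 : ContinuousOn (fun q : X × (Fin n → ℝ) => ((p q.1).1 (toTorus q.2)).toCircle)
      (U ×ˢ univ) := ContMDiffOn.continuousOn hp
    have h2 : Continuous fun q : U × (Fin n → ℝ) => ((p q.1.1).1 (toTorus q.2)).toCircle :=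
      h1.comp_continuous (f := fun q : U × (Fin n → ℝ) => (q.1.1, q.2)) (by fun_prop)
        fun q => ⟨q.1.2, trivial⟩
    exact (AddCircle.homeomorphCircle one_ne_zero).isInducing.continuous_iff.2
      (h2.congr fun v => by simp [AddCircle.homeomorphCircle_apply])
  obtain ⟨k', r', hk', hr', h'⟩ := exists_family (p := fun x : U => p x) hcont
  classical
  let k : X → Fin n → ℤ := fun x => if h : x ∈ U then k' ⟨x, h⟩ else 0
  let r : X → (Fin n → UnitAddCircle) → ℝ := fun x => if h : x ∈ U then r' ⟨x, h⟩ else 0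
  have ek : ∀ x : U, k x = k' x := fun x => by simp [k]
  have er : ∀ x : U, r x = r' x := fun x => by simp [r]
  have hk : (SmoothStructure.discrete.{u} (Fin n → ℤ)).SmoothOn d k U := by
    intro x hx
    rw [nhdsWithin_eq_map_subtype_coe hx, Filter.eventually_map]
    filter_upwards [hk' ⟨x, hx⟩] with y hy
    rw [ek, hy, ← ek]
  have hr : ContinuousOn (fun q : X × (Fin n → ℝ) => r q.1 (toTorus q.2)) (U ×ˢ univ) := by
    rw [continuousOn_iff_continuous_domRestrict]
    refine (hr'.comp (f := fun q : (U ×ˢ univ : Set (X × (Fin n → ℝ))) =>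
      ((⟨q.1.1, q.2.1⟩ : U), q.1.2)) (by fun_prop)).congr fun q => ?_
    simp only [Function.comp_apply, Set.domRestrict_apply]
    rw [← er]
  have hdec : ∀ x ∈ U, ∀ c, (p x).1 c = (p x).1 0 + (linear n (k x)).1 c + (r x c : UnitAddCircle) :=
    fun x hx c => by
      have := h' ⟨x, hx⟩ c
      rwa [← ek, ← er] at this
  have hp0 : SmoothStructure.circle.SmoothOn d (fun x => (p x).1 0) U := by
    refine ContMDiffOn.comp (g := fun q : X × (Fin n → ℝ) => ((p q.1).1 (toTorus q.2)).toCircle)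
      (f := fun x : X => (x, (0 : Fin n → ℝ))) hp ?_ fun x hx => ⟨hx, trivial⟩
    exact contMDiffOn_id.prodMk contMDiffOn_const
  have hrs : ContMDiffOn ((𝓡 d).prod 𝓘(ℝ, Fin n → ℝ)) 𝓘(ℝ, ℝ) ∞
      (fun q : X × (Fin n → ℝ) => r q.1 (toTorus q.2)) (U ×ˢ univ) := by
    refine contMDiffOn_of_coe hr ?_
    have h1 := smooth_sub (smooth_sub hp (smooth_const d _ U hp0)) (smooth_linear_of_discrete hk)
    refine ContMDiffOn.congr h1 fun q hq => ?_
    congr 1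
    have := hdec q.1 hq.1 (toTorus q.2)
    change _ = (p q.1).1 (toTorus q.2) - (p q.1).1 0 - (linear n (k q.1)).1 (toTorus q.2)
    rw [this]
    abel
  have hI := contMDiffOn_integral_torus hU hrs
  have hD : ∀ x ∈ U, IsDecomp (p x) (k x) ((p x).1 0 +
      ((∫ c, r x c ∂torusHaar n : ℝ) : UnitAddCircle)) (fun c => r x c - ∫ c, r x c ∂torusHaar n) := by
    intro x hx
    refine IsDecomp.of_origin (continuous_iff_toTorus.2 ?_) (hdec x hx)
    exact hr.comp_continuous (f := fun v : Fin n → ℝ => (x, v)) (by fun_prop)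
      fun v => ⟨hx, trivial⟩
  have hu := fun x hx => (isDecomp (p x)).unique (hD x hx)
  refine ⟨?_, ?_, ?_⟩
  · exact SmoothStructure.congr _ d hk fun x hx => (hu x hx).1
  · refine SmoothStructure.congr _ d (SmoothStructure.smooth_circle_add d (fun x => ((p x).1 0,
      ((∫ c, r x c ∂torusHaar n : ℝ) : UnitAddCircle))) U
      ⟨hp0, SmoothStructure.smooth_coe d _ U hI⟩) fun x hx => (hu x hx).2.1
  · refine (hrs.sub (ContMDiffOn.comp (g := fun x => ∫ c, r x c ∂torusHaar n) hI
      contMDiffOn_fst fun q hq => hq.1)).congr fun q hq => ?_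
    rw [(hu q.1 hq.1).2.2]
    rfl

end Families

end TorusMap

/-! ### Averages with respect to a partition of unity -/

section Average

variable {d : ℕ} {X : Type u} [TopologicalSpace X] [ChartedSpace (EuclideanSpace ℝ (Fin d)) X]
  {ι : Type u} {F : Type*} [NormedAddCommGroup F] [NormedSpace ℝ F]

/-- The average of a family `f p` at the point `x`, with the weights `ψ p x`. -/
noncomputable def average (ψ : SmoothPartitionOfUnity ι (𝓡 d) X univ) (x : X) (f : ι → F) : F :=
  ∑ᶠ p, ψ p x • f p

variable (ψ : SmoothPartitionOfUnity ι (𝓡 d) X univ)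

theorem average_eq_sum (x : X) (f : ι → F) :
    average ψ x f = ∑ p ∈ ψ.finsupport x, ψ p x • f p :=
  (ψ.sum_finsupport_smul_eq_finsum (x₀ := x) fun p _ => f p).symm

theorem average_add (x : X) (f g : ι → F) :
    average ψ x (fun p => f p + g p) = average ψ x f + average ψ x g := by
  simp only [average_eq_sum, smul_add, Finset.sum_add_distrib]

theorem average_const (x : X) (y : F) : average ψ x (fun _ => y) = y := by
  rw [average_eq_sum, ← Finset.sum_smul, ψ.sum_finsupport x (mem_univ x), one_smul]

theorem average_congr {U : ι → Set X} (hψ : ψ.IsSubordinate U) {x : X} {f g : ι → F}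
    (h : ∀ p, x ∈ U p → f p = g p) : average ψ x f = average ψ x g := by
  rw [average_eq_sum, average_eq_sum]
  refine Finset.sum_congr rfl fun p hp => ?_
  rw [h p (hψ p (subset_tsupport _ ((ψ.mem_finsupport x).1 hp)))]

theorem contMDiffOn_average {U : ι → Set X} (hU : ∀ p, IsOpen (U p)) (hψ : ψ.IsSubordinate U)
    {W : Set X} (hW : IsOpen W) {K : ι → X → F}
    (hK : ∀ p, ContMDiffOn (𝓡 d) 𝓘(ℝ, F) ∞ (K p) (U p ∩ W)) :
    ContMDiffOn (𝓡 d) 𝓘(ℝ, F) ∞ (fun x => average ψ x fun p => K p x) W := by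
  intro x hx
  refine (ψ.contMDiffAt_finsum fun p hp => ?_).contMDiffWithinAt
  exact (hK p).contMDiffAt (((hU p).inter hW).mem_nhds ⟨hψ p hp, hx⟩)

theorem contMDiffOn_average_family {V : Type*} [NormedAddCommGroup V] [NormedSpace ℝ V]
    {U : ι → Set X} (hU : ∀ p, IsOpen (U p)) (hψ : ψ.IsSubordinate U)
    {W : Set X} (hW : IsOpen W) {K : ι → X → V → F}
    (hK : ∀ p, ContMDiffOn ((𝓡 d).prod 𝓘(ℝ, V)) 𝓘(ℝ, F) ∞ (fun q : X × V => K p q.1 q.2)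
      ((U p ∩ W) ×ˢ univ)) :
    ContMDiffOn ((𝓡 d).prod 𝓘(ℝ, V)) 𝓘(ℝ, F) ∞
      (fun q : X × V => average ψ q.1 fun p => K p q.1 q.2) (W ×ˢ univ) := by
  intro q hq
  have hlf : LocallyFinite fun p => Function.support fun q : X × V => ψ p q.1 • K p q.1 q.2 :=
    (ψ.locallyFinite.preimage_continuous continuous_fst).subset fun p q hq => by
      simp only [Function.mem_support, mem_preimage] at hq ⊢
      exact fun h => hq (by rw [h, zero_smul])
  refine (contMDiffAt_finsum hlf fun p => ?_).contMDiffWithinAt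
  by_cases hp : q.1 ∈ tsupport (ψ p)
  · refine ContMDiffAt.smul (I := 𝓘(ℝ, ℝ)) ?_ ((hK p).contMDiffAt ((((hU p).inter hW).prod
      isOpen_univ).mem_nhds ⟨⟨hψ p hp, hq.1⟩, trivial⟩))
    exact (ψ p).contMDiff.contMDiffAt.comp q contMDiffAt_fst
  · have h0 := (notMem_tsupport_iff_eventuallyEq.1 hp)
    refine contMDiffAt_const (c := (0 : F)) |>.congr_of_eventuallyEq ?_
    filter_upwards [continuous_fst.continuousAt.eventually h0] with y hy
    rw [hy, Pi.zero_apply, zero_smul]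

end Average

/-! ### Reflecting identities along faithful homomorphisms -/

namespace TwoGroup

variable {Γ : TwoGroup.{u}}

theorem comp_left_cancel {A B Q : Γ.Mor} (hA : Γ.src Q = Γ.tgt A) (hB : Γ.src Q = Γ.tgt B)
    (h : Γ.comp Q A = Γ.comp Q B) : A = B := by
  have : Γ.comp (Γ.minv Q) (Γ.comp Q A) = Γ.comp (Γ.minv Q) (Γ.comp Q B) := by rw [h]
  rwa [← Γ.comp_assoc _ _ _ (Γ.src_minv Q) hA, ← Γ.comp_assoc _ _ _ (Γ.src_minv Q) hB,
    Γ.minv_comp, hA, Γ.idm_comp, ← hA, hB, Γ.idm_comp] at this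

theorem comp_minv_cancel {A P : Γ.Mor} (h : Γ.src A = Γ.tgt P) :
    Γ.comp (Γ.comp A P) (Γ.minv P) = A := by
  rw [Γ.comp_assoc _ _ _ h (Γ.tgt_minv P).symm, Γ.comp_minv, ← h, Γ.comp_idm]

theorem comp_minv_comp_cancel {A P : Γ.Mor} (h : Γ.tgt A = Γ.tgt P) :
    Γ.comp P (Γ.comp (Γ.minv P) A) = A := by
  rw [← Γ.comp_assoc _ _ _ (Γ.tgt_minv P).symm (by rw [Γ.src_minv, h]), Γ.comp_minv, ← h,
    Γ.idm_comp]

theorem idm_comp_idm (a : Γ.Obj) : Γ.comp (Γ.idm a) (Γ.idm a) = Γ.idm a := by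
  have := Γ.comp_idm (Γ.idm a)
  rwa [Γ.src_idm] at this

end TwoGroup

namespace TwoHom

open TwoGroup

variable {Γ Γ' : TwoGroup.{u}} (F : TwoHom Γ Γ')

/-- A homomorphism is faithful if a morphism is determined by its source and its image. -/
def Faithful : Prop := ∀ ⦃α β : Γ.Mor⦄, Γ.src α = Γ.src β → F.mor α = F.mor β → α = β

variable {F}

/-- A faithful homomorphism reflects the cocycle identity: both sides become equal after applying
`F` and composing with the same iterated multiplicator. -/
theorem Faithful.cocycle (hF : F.Faithful)
    {kl jk ij ik jl il : Γ.Obj} {γikl γijk γijl γjkl : Γ.Mor}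
    (s1 : Γ.src γikl = Γ.mul kl ik) (t1 : Γ.tgt γikl = il)
    (s2 : Γ.src γijk = Γ.mul jk ij) (t2 : Γ.tgt γijk = ik)
    (s3 : Γ.src γijl = Γ.mul jl ij) (t3 : Γ.tgt γijl = il)
    (s4 : Γ.src γjkl = Γ.mul kl jk) (t4 : Γ.tgt γjkl = jl)
    (h : Γ'.comp (F.imγ kl ik γikl)
        (Γ'.comp (Γ'.mulM (Γ'.idm (F.obj kl)) (F.imγ jk ij γijk))
          (Γ'.lam (F.obj kl) (F.obj jk) (F.obj ij))) =
      Γ'.comp (F.imγ jl ij γijl) (Γ'.mulM (F.imγ kl jk γjkl) (Γ'.idm (F.obj ij)))) :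
    Γ.comp γikl (Γ.comp (Γ.mulM (Γ.idm kl) γijk) (Γ.lam kl jk ij)) =
      Γ.comp γijl (Γ.mulM γjkl (Γ.idm ij)) := by
  have L := ((F.sq_lam kl jk ij).comp (F.sq_imγ_left s2 t2 kl)).comp (F.sq_imγ s1 t1)
  have R := (F.sq_imγ_right s4 t4 ij).comp (F.sq_imγ s3 t3)
  have c1 : Γ.src (Γ.mulM (Γ.idm kl) γijk) = Γ.tgt (Γ.lam kl jk ij) := by
    rw [Γ.src_mulM, Γ.src_idm, s2, Γ.tgt_lam]
  have c2 : Γ.src γikl = Γ.tgt (Γ.comp (Γ.mulM (Γ.idm kl) γijk) (Γ.lam kl jk ij)) := by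
    rw [Γ.tgt_comp _ _ c1, Γ.tgt_mulM, Γ.tgt_idm, t2, s1]
  have c3 : Γ.src γijl = Γ.tgt (Γ.mulM γjkl (Γ.idm ij)) := by
    rw [Γ.tgt_mulM, Γ.tgt_idm, t4, s3]
  rw [← F.mor_comp _ _ c1, ← F.mor_comp _ _ c2, h] at L
  rw [← F.mor_comp _ _ c3] at R
  refine hF ?_ (comp_left_cancel L.2.1 R.2.1 (L.2.2.symm.trans R.2.2))
  rw [Γ.src_comp _ _ c2, Γ.src_comp _ _ c1, Γ.src_comp _ _ c3, Γ.src_lam, Γ.src_mulM, s4,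
    Γ.src_idm]

/-- A faithful homomorphism reflects the compatibility condition for equivalences of cocycles. -/
theorem Faithful.equivalence (hF : F.Faithful)
    {jk ij ik jk' ij' ik' hi hj hk : Γ.Obj} {γ γ' εij εjk εik : Γ.Mor}
    (s1 : Γ.src γ = Γ.mul jk ij) (t1 : Γ.tgt γ = ik)
    (s2 : Γ.src γ' = Γ.mul jk' ij') (t2 : Γ.tgt γ' = ik')
    (s3 : Γ.src εij = Γ.mul hj ij) (t3 : Γ.tgt εij = Γ.mul ij' hi)
    (s4 : Γ.src εjk = Γ.mul hk jk) (t4 : Γ.tgt εjk = Γ.mul jk' hj)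
    (s5 : Γ.src εik = Γ.mul hk ik) (t5 : Γ.tgt εik = Γ.mul ik' hi)
    (h : Γ'.comp (Γ'.mulM (F.imγ jk' ij' γ') (Γ'.idm (F.obj hi)))
      (Γ'.comp (Γ'.minv (Γ'.lam (F.obj jk') (F.obj ij') (F.obj hi)))
        (Γ'.comp (Γ'.mulM (Γ'.idm (F.obj jk')) (F.imε ij' hi hj ij εij))
          (Γ'.comp (Γ'.lam (F.obj jk') (F.obj hj) (F.obj ij))
            (Γ'.mulM (F.imε jk' hj hk jk εjk) (Γ'.idm (F.obj ij)))))) =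
      Γ'.comp (F.imε ik' hi hk ik εik)
        (Γ'.comp (Γ'.mulM (Γ'.idm (F.obj hk)) (F.imγ jk ij γ))
          (Γ'.lam (F.obj hk) (F.obj jk) (F.obj ij)))) :
    Γ.comp (Γ.mulM γ' (Γ.idm hi)) (Γ.comp (Γ.minv (Γ.lam jk' ij' hi))
        (Γ.comp (Γ.mulM (Γ.idm jk') εij) (Γ.comp (Γ.lam jk' hj ij)
          (Γ.mulM εjk (Γ.idm ij))))) =
      Γ.comp εik (Γ.comp (Γ.mulM (Γ.idm hk) γ) (Γ.lam hk jk ij)) := by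
  have L := ((((F.sq_imε_right s4 t4 ij).comp (F.sq_lam jk' hj ij)).comp
    (F.sq_imε_left s3 t3 jk')).comp (F.sq_lam jk' ij' hi).minv).comp (F.sq_imγ_right s2 t2 hi)
  have R := ((F.sq_lam hk jk ij).comp (F.sq_imγ_left s1 t1 hk)).comp (F.sq_imε s5 t5)
  have c1 : Γ.src (Γ.lam jk' hj ij) = Γ.tgt (Γ.mulM εjk (Γ.idm ij)) := by
    rw [Γ.src_lam, Γ.tgt_mulM, t4, Γ.tgt_idm]
  have c2 : Γ.src (Γ.mulM (Γ.idm jk') εij) =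
      Γ.tgt (Γ.comp (Γ.lam jk' hj ij) (Γ.mulM εjk (Γ.idm ij))) := by
    rw [Γ.tgt_comp _ _ c1, Γ.tgt_lam, Γ.src_mulM, Γ.src_idm, s3]
  have c3 : Γ.src (Γ.minv (Γ.lam jk' ij' hi)) = Γ.tgt (Γ.comp (Γ.mulM (Γ.idm jk') εij)
      (Γ.comp (Γ.lam jk' hj ij) (Γ.mulM εjk (Γ.idm ij)))) := by
    rw [Γ.tgt_comp _ _ c2, Γ.tgt_mulM, Γ.tgt_idm, t3, Γ.src_minv, Γ.tgt_lam]
  have c4 : Γ.src (Γ.mulM γ' (Γ.idm hi)) = Γ.tgt (Γ.comp (Γ.minv (Γ.lam jk' ij' hi))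
      (Γ.comp (Γ.mulM (Γ.idm jk') εij) (Γ.comp (Γ.lam jk' hj ij)
        (Γ.mulM εjk (Γ.idm ij))))) := by
    rw [Γ.tgt_comp _ _ c3, Γ.tgt_minv, Γ.src_lam, Γ.src_mulM, Γ.src_idm, s2]
  have c5 : Γ.src (Γ.mulM (Γ.idm hk) γ) = Γ.tgt (Γ.lam hk jk ij) := by
    rw [Γ.src_mulM, Γ.src_idm, s1, Γ.tgt_lam]
  have c6 : Γ.src εik = Γ.tgt (Γ.comp (Γ.mulM (Γ.idm hk) γ) (Γ.lam hk jk ij)) := by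
    rw [Γ.tgt_comp _ _ c5, Γ.tgt_mulM, Γ.tgt_idm, t1, s5]
  rw [← F.mor_minv, ← F.mor_comp _ _ c1, ← F.mor_comp _ _ c2, ← F.mor_comp _ _ c3,
    ← F.mor_comp _ _ c4, h] at L
  rw [← F.mor_comp _ _ c5, ← F.mor_comp _ _ c6] at R
  refine hF ?_ (comp_left_cancel L.2.1 R.2.1 (L.2.2.symm.trans R.2.2))
  rw [Γ.src_comp _ _ c4, Γ.src_comp _ _ c3, Γ.src_comp _ _ c2, Γ.src_comp _ _ c1,
    Γ.src_comp _ _ c6, Γ.src_comp _ _ c5, Γ.src_lam, Γ.src_mulM, s4, Γ.src_idm]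

end TwoHom

/-! ### Affine parts of morphisms, and their lifts along the left leg -/

section Affine

variable {n : ℕ}

/-- The underlying type of the objects of `TFgeo n`. -/
abbrev TFObj (n : ℕ) : Type := ((Fin n → ℝ) × (Fin n → ℝ)) × so n

/-- The underlying type of the morphisms of `TFgeo n`. -/
abbrev TFMor (n : ℕ) : Type := (((Fin n → ℤ) × (Fin n → ℤ)) × UnitAddCircle) × TFObj n

/-- The underlying type of the objects of `TBF n`. -/
abbrev TBObj (n : ℕ) : Type := (Fin n → ℝ) × so n

/-- The underlying type of the morphisms of `TBF n`. -/
abbrev TBMor (n : ℕ) : Type := (TorusMap n × (Fin n → ℤ)) × TBObj n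

theorem TBF_mulM_fst_fst (β α : TBMor n) : (((TBF.{u} n).mulM β α : TBMor n)).1.1 =
    β.1.1 + TorusMap.translate β.2.1 (α.1.1 - TorusMap.linear n (α.1.2 ᵥ* β.2.2.1) -
      TorusMap.const n (lowU β.2.2.1 α.2.1 (intVec n α.1.2))) := rfl

theorem TBF_lam_fst_fst (c b a : TBObj n) : (((TBF.{u} n).lam c b a : TBMor n)).1.1 =
    -TorusMap.const n (lowU c.2.1 a.1 b.1) := rfl

theorem leftLeg_χ_fst_fst (b a : TFObj n) : (((leftLeg.{u} n).χ b a : TBMor n)).1.1 =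
    TorusMap.const n (dotU b.1.2 a.1.1) := rfl

theorem leftLeg_mor_fst_fst (α : TFMor n) : (((leftLeg.{u} n).mor α : TBMor n)).1.1 =
    TorusMap.const n α.1.2 + TorusMap.linear n α.1.1.2 -
      TorusMap.const n (dotU (intVec n α.1.1.2) α.2.1.1) := rfl

theorem leftLeg_mor_fst_snd (α : TFMor n) : (((leftLeg.{u} n).mor α : TBMor n)).1.2 =
    α.1.1.1 := by
  change α.1.1.1 - 0 = _
  rw [sub_zero]

/-- The affine part of a morphism of `TBF n`, which discards the oscillation of its
`C^∞(𝕋ⁿ, U(1))`-component. -/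
noncomputable def affineMor (β : (TBF.{u} n).Mor) : (TBF.{u} n).Mor :=
  (((TorusMap.affine n (β : TBMor n).1.1, (β : TBMor n).1.2), (β : TBMor n).2) : TBMor n)

theorem affineMor_comp (β α : (TBF.{u} n).Mor) : affineMor ((TBF.{u} n).comp β α) =
    (TBF.{u} n).comp (affineMor β) (affineMor α) :=
  Prod.ext (Prod.ext (map_add (TorusMap.affine n) β.1.1 α.1.1) rfl) rfl

theorem affineMor_idm (a : (TBF.{u} n).Obj) : affineMor ((TBF.{u} n).idm a) = (TBF.{u} n).idm a :=
  Prod.ext (Prod.ext (map_zero (TorusMap.affine n)) rfl) rfl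

theorem affineMor_minv (β : (TBF.{u} n).Mor) : affineMor ((TBF.{u} n).minv β) =
    (TBF.{u} n).minv (affineMor β) :=
  Prod.ext (Prod.ext (map_neg (TorusMap.affine n) β.1.1) rfl) rfl

theorem affineMor_mulM (β α : (TBF.{u} n).Mor) : affineMor ((TBF.{u} n).mulM β α) =
    (TBF.{u} n).mulM (affineMor β) (affineMor α) := by
  refine Prod.ext (Prod.ext ?_ rfl) rfl
  refine (congrArg (TorusMap.affine n) (TBF_mulM_fst_fst.{u} β α)).trans ?_
  rw [map_add, TorusMap.affine_translate, map_sub (TorusMap.affine n), map_sub (TorusMap.affine n),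
    TorusMap.affine_linear, TorusMap.affine_const]
  rfl

theorem affineMor_lam (c b a : (TBF.{u} n).Obj) : affineMor ((TBF.{u} n).lam c b a) =
    (TBF.{u} n).lam c b a := by
  refine Prod.ext (Prod.ext ?_ rfl) rfl
  refine (congrArg (TorusMap.affine n) (TBF_lam_fst_fst.{u} c b a)).trans ?_
  rw [map_neg, TorusMap.affine_const]
  rfl

theorem affineMor_χ (b a : (TFgeo.{u} n).Obj) : affineMor ((leftLeg.{u} n).χ b a) =
    (leftLeg.{u} n).χ b a := by
  refine Prod.ext (Prod.ext ?_ rfl) rfl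
  refine (congrArg (TorusMap.affine n) (leftLeg_χ_fst_fst.{u} b a)).trans ?_
  rw [TorusMap.affine_const]
  rfl

/-- A morphism of `TFgeo n` is recovered from its image: its dual integral component is the degree,
and its `U(1)`-component is the mean up to a term which depends on the source. -/
theorem faithful_leftLeg (n : ℕ) : (leftLeg.{u} n).Faithful := by
  intro (α : TFMor n) (β : TFMor n) (hs : α.2 = β.2) h
  have h1 := congrArg (fun x : TBMor n => x.1.1) h
  have h2 := congrArg (fun x : TBMor n => x.1.2) h
  simp only [leftLeg_mor_fst_fst, leftLeg_mor_fst_snd] at h1 h2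
  have h3 := congrArg (TorusMap.deg n) h1
  have h4 := congrArg (TorusMap.mean n) h1
  simp only [map_sub, map_add, TorusMap.deg_const, TorusMap.deg_linear, TorusMap.mean_const,
    TorusMap.mean_linear, zero_add, sub_zero, add_zero] at h3 h4
  rw [h3, hs] at h4
  exact Prod.ext (Prod.ext (Prod.ext h2 h3) (sub_left_injective h4)) hs

/-- The morphism of `TFgeo n` with source `X` whose image is the affine part of `β`. -/
noncomputable def liftMor (X : (TFgeo.{u} n).Obj) (β : (TBF.{u} n).Mor) : (TFgeo.{u} n).Mor :=
  let b : TBMor n := β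
  (((b.1.2, TorusMap.deg n b.1.1),
    TorusMap.mean n b.1.1 + dotU (intVec n (TorusMap.deg n b.1.1)) (X : TFObj n).1.1), X)

theorem leftLeg_liftMor {X : (TFgeo.{u} n).Obj} {β : (TBF.{u} n).Mor}
    (h : (TBF.{u} n).src β = (leftLeg.{u} n).obj X) :
    (leftLeg.{u} n).mor (liftMor X β) = affineMor β := by
  refine Prod.ext (Prod.ext ?_ (leftLeg_mor_fst_snd _)) h.symm
  refine (leftLeg_mor_fst_fst (liftMor X β)).trans ?_
  have e : ∀ (s s' : UnitAddCircle) (k : TorusMap n), TorusMap.const n (s + s') + k -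
      TorusMap.const n s' = TorusMap.const n s + k := by
    intro s s' k
    rw [map_add]
    abel
  exact e _ _ _

/-- The lift of the affine part of `β : L c L b ⟶ y`, where `L` is the left leg, to a morphism
with source `c b`. -/
noncomputable def liftγ (c b : (TFgeo.{u} n).Obj) (β : (TBF.{u} n).Mor) : (TFgeo.{u} n).Mor :=
  liftMor ((TFgeo.{u} n).mul c b) ((TBF.{u} n).comp β ((leftLeg.{u} n).χ c b))

theorem imγ_liftγ {c b : (TFgeo.{u} n).Obj} {β : (TBF.{u} n).Mor} (h : (TBF.{u} n).src β =
    (TBF.{u} n).mul ((leftLeg.{u} n).obj c) ((leftLeg.{u} n).obj b)) :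
    (leftLeg.{u} n).imγ c b (liftγ.{u} c b β) = affineMor β := by
  have h1 : (TBF.{u} n).src β = (TBF.{u} n).tgt ((leftLeg.{u} n).χ c b) := by
    rw [h, TwoHom.tgt_χ]
  rw [TwoHom.imγ, liftγ, leftLeg_liftMor, affineMor_comp, affineMor_χ]
  · exact TwoGroup.comp_minv_cancel (Γ := TBF.{u} n) (A := affineMor β) h1
  · rw [(TBF.{u} n).src_comp _ _ h1, TwoHom.src_χ]

/-- The lift of the affine part of `β : L c L b ⟶ L c' L b'`, where `L` is the left leg, to a
morphism with source `c b`. -/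
noncomputable def liftε (c' b' c b : (TFgeo.{u} n).Obj) (β : (TBF.{u} n).Mor) :
    (TFgeo.{u} n).Mor :=
  liftMor ((TFgeo.{u} n).mul c b) ((TBF.{u} n).comp
    ((TBF.{u} n).minv ((leftLeg.{u} n).χ c' b'))
    ((TBF.{u} n).comp β ((leftLeg.{u} n).χ c b)))

theorem imε_liftε {c' b' c b : (TFgeo.{u} n).Obj} {β : (TBF.{u} n).Mor}
    (h : (TBF.{u} n).src β =
      (TBF.{u} n).mul ((leftLeg.{u} n).obj c) ((leftLeg.{u} n).obj b))
    (h' : (TBF.{u} n).tgt β =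
      (TBF.{u} n).mul ((leftLeg.{u} n).obj c') ((leftLeg.{u} n).obj b')) :
    (leftLeg.{u} n).imε c' b' c b (liftε.{u} c' b' c b β) = affineMor β := by
  have h1 : (TBF.{u} n).src β = (TBF.{u} n).tgt ((leftLeg.{u} n).χ c b) := by
    rw [h, TwoHom.tgt_χ]
  have h2 : (TBF.{u} n).tgt β = (TBF.{u} n).tgt ((leftLeg.{u} n).χ c' b') := by
    rw [h', TwoHom.tgt_χ]
  have h3 : (TBF.{u} n).src ((TBF.{u} n).minv ((leftLeg.{u} n).χ c' b')) =
      (TBF.{u} n).tgt ((TBF.{u} n).comp β ((leftLeg.{u} n).χ c b)) := by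
    rw [(TBF.{u} n).src_minv, (TBF.{u} n).tgt_comp _ _ h1, h2]
  rw [TwoHom.imε, liftε, leftLeg_liftMor, affineMor_comp, affineMor_minv, affineMor_comp,
    affineMor_χ, affineMor_χ]
  · have h4 : (TBF.{u} n).src ((TBF.{u} n).minv ((leftLeg.{u} n).χ c' b')) =
        (TBF.{u} n).tgt ((TBF.{u} n).comp (affineMor β) ((leftLeg.{u} n).χ c b)) :=
      h3
    rw [(TBF.{u} n).comp_assoc _ _ _ h4, TwoGroup.comp_minv_comp_cancel,
      TwoGroup.comp_minv_cancel (Γ := TBF.{u} n) (A := affineMor β) h1]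
    · rw [TwoGroup.comp_minv_cancel (Γ := TBF.{u} n) (A := affineMor β) h1]
      exact h2
    · rw [(TBF.{u} n).src_comp _ _ (show (TBF.{u} n).src (affineMor β) = _ from h1),
        (TBF.{u} n).tgt_minv]
  · rw [(TBF.{u} n).src_comp _ _ h3, (TBF.{u} n).src_comp _ _ h1, TwoHom.src_χ]

theorem deg_imγ (c b : TFObj n) (δ : TFMor n) :
    TorusMap.deg n ((leftLeg.{u} n).imγ c b δ : TBMor n).1.1 = δ.1.1.2 := by
  change TorusMap.deg n (((leftLeg.{u} n).mor δ : TBMor n).1.1 +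
    -((leftLeg.{u} n).χ c b : TBMor n).1.1) = _
  rw [leftLeg_mor_fst_fst, leftLeg_χ_fst_fst]
  simp

theorem deg_affineMor (β : TBMor n) : TorusMap.deg n (affineMor β).1.1 =
    TorusMap.deg n β.1.1 := by
  simp [affineMor, TorusMap.affine_apply]

/-- The target of a lift, in components. -/
theorem tgt_liftγ (c b : TFObj n) (β : TBMor n) : (TFgeo.{u} n).tgt (liftγ.{u} c b β) =
    ((intVec n β.1.2 + (c.1.1 + b.1.1), intVec n (TorusMap.deg n β.1.1) +
      (c.1.2 + (realMul c.2.1 b.1.1 + b.1.2))), c.2 + b.2) := by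
  have e : TorusMap.deg n (((TBF.{u} n).comp β ((leftLeg.{u} n).χ c b) : TBMor n)).1.1 =
      TorusMap.deg n β.1.1 := by
    change TorusMap.deg n (β.1.1 + ((leftLeg.{u} n).χ c b : TBMor n).1.1) = _
    rw [leftLeg_χ_fst_fst]
    simp
  have e' : (((TBF.{u} n).comp β ((leftLeg.{u} n).χ c b) : TBMor n)).1.2 = β.1.2 :=
    add_zero β.1.2
  change ((intVec n (((TBF.{u} n).comp β ((leftLeg.{u} n).χ c b) : TBMor n)).1.2 +
    (c.1.1 + b.1.1), intVec n (TorusMap.deg n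
      (((TBF.{u} n).comp β ((leftLeg.{u} n).χ c b) : TBMor n)).1.1) +
    (c.1.2 + (realMul c.2.1 b.1.1 + b.1.2))), c.2 + b.2) = _
  rw [e, e']

theorem tgt_liftε (c' b' c b : TFObj n) (β : TBMor n) :
    (TFgeo.{u} n).tgt (liftε.{u} c' b' c b β) =
    ((intVec n β.1.2 + (c.1.1 + b.1.1), intVec n (TorusMap.deg n β.1.1) +
      (c.1.2 + (realMul c.2.1 b.1.1 + b.1.2))), c.2 + b.2) := by
  have e : TorusMap.deg n (((TBF.{u} n).comp ((TBF.{u} n).minv ((leftLeg.{u} n).χ c' b'))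
      ((TBF.{u} n).comp β ((leftLeg.{u} n).χ c b)) : TBMor n)).1.1 = TorusMap.deg n β.1.1 := by
    change TorusMap.deg n (-((leftLeg.{u} n).χ c' b' : TBMor n).1.1 +
      (β.1.1 + ((leftLeg.{u} n).χ c b : TBMor n).1.1)) = _
    rw [leftLeg_χ_fst_fst, leftLeg_χ_fst_fst]
    simp
  have e' : (((TBF.{u} n).comp ((TBF.{u} n).minv ((leftLeg.{u} n).χ c' b'))
      ((TBF.{u} n).comp β ((leftLeg.{u} n).χ c b)) : TBMor n)).1.2 = β.1.2 := by
    change -(0 : Fin n → ℤ) + (β.1.2 + 0) = _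
    simp
  change ((intVec n (((TBF.{u} n).comp ((TBF.{u} n).minv ((leftLeg.{u} n).χ c' b'))
      ((TBF.{u} n).comp β ((leftLeg.{u} n).χ c b)) : TBMor n)).1.2 +
    (c.1.1 + b.1.1), intVec n (TorusMap.deg n
      (((TBF.{u} n).comp ((TBF.{u} n).minv ((leftLeg.{u} n).χ c' b'))
      ((TBF.{u} n).comp β ((leftLeg.{u} n).χ c b)) : TBMor n)).1.1) +
    (c.1.2 + (realMul c.2.1 b.1.1 + b.1.2))), c.2 + b.2) = _
  rw [e, e']

/-- Lifts of smooth families of morphisms are smooth. -/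
theorem smoothOn_liftMor {d : ℕ} {X : Type u} [TopologicalSpace X]
    [ChartedSpace (EuclideanSpace ℝ (Fin d)) X] [IsManifold (𝓡 d) ∞ X] {p : X → TFObj n}
    {q : X → TBMor n} {U : Set X} (hU : IsOpen U) (hp : (TFgeo.{u} n).smObj.SmoothOn d p U)
    (hq : (TBF.{u} n).smMor.SmoothOn d q U) :
    (TFgeo.{u} n).smMor.SmoothOn d (fun x => liftMor (p x) (q x)) U := by
  obtain ⟨h1, h2, -⟩ := TorusMap.smoothOn_components hU hq.1.1
  refine ⟨⟨smoothOn_discrete_map₂ (fun a b => (a, b)) hq.1.2 h1, ?_⟩, hp⟩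
  exact SmoothStructure.smooth_circle_add d (fun x => (TorusMap.mean n (q x).1.1,
    dotU (intVec n (TorusMap.deg n (q x).1.1)) (p x).1.1)) U ⟨h2, smooth_dotU d
    (fun x => (intVec n (TorusMap.deg n (q x).1.1), (p x).1.1)) U
    ⟨SmoothStructure.smooth_of_discrete _ (fun m : Fin n → ℤ => intVec n m) d _ U h1, hp.1.1⟩⟩

end Affine

/-! ### Components of cocycles -/

section Coordinates

variable {n : ℕ}

/-- The `ℝⁿ`-component of an object of `TBF n`. -/
def vec (x : (TBF.{u} n).Obj) : Fin n → ℝ := (x : TBObj n).1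

/-- The `𝔰𝔬(n, ℤ)`-component of an object of `TBF n`. -/
def mat (x : (TBF.{u} n).Obj) : so n := (x : TBObj n).2

/-- The `C^∞(𝕋ⁿ, U(1))`-component of a morphism of `TBF n`. -/
def torusFn (β : (TBF.{u} n).Mor) : TorusMap n := (β : TBMor n).1.1

/-- The `ℤⁿ`-component of a morphism of `TBF n`. -/
def shift (β : (TBF.{u} n).Mor) : Fin n → ℤ := (β : TBMor n).1.2

/-- The second `ℝⁿ`-component of an object of `TFgeo n`. -/
def dualVec (x : (TFgeo.{u} n).Obj) : Fin n → ℝ := (x : TFObj n).1.2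

/-- The endomorphism of the object `a` given by `τ`. -/
def torusMor (τ : TorusMap n) (a : (TBF.{u} n).Obj) : (TBF.{u} n).Mor :=
  (((τ, 0), (a : TBObj n)) : TBMor n)

theorem torusFn_torusMor (τ : TorusMap n) (a : (TBF.{u} n).Obj) :
    torusFn (torusMor τ a) = τ := rfl

theorem shift_torusMor (τ : TorusMap n) (a : (TBF.{u} n).Obj) : shift (torusMor τ a) = 0 := rfl

theorem lowU_intVec_zero (B : Matrix (Fin n) (Fin n) ℤ) (v : Fin n → ℝ) :
    lowU B v (intVec n 0) = 0 := by
  have := lowU_add_right B v 0 0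
  rw [map_zero]
  rw [add_zero] at this
  exact left_eq_add.1 this

theorem shift_idm (a : (TBF.{u} n).Obj) : shift ((TBF.{u} n).idm a) = 0 := rfl

theorem shift_mulM (β α : (TBF.{u} n).Mor) :
    shift ((TBF.{u} n).mulM β α) = shift β + shift α := by
  change shift β + (shift α - 0) = _
  rw [sub_zero]

theorem torusFn_mulM_idm (β : (TBF.{u} n).Mor) (a : (TBF.{u} n).Obj) :
    torusFn ((TBF.{u} n).mulM β ((TBF.{u} n).idm a)) = torusFn β := by
  refine (TBF_mulM_fst_fst.{u} β ((TBF.{u} n).idm a)).trans ?_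
  change torusFn β + TorusMap.translate _ (0 - TorusMap.linear n (0 ᵥ* _) -
    TorusMap.const n (lowU _ _ (intVec n 0))) = _
  rw [lowU_intVec_zero, Matrix.zero_vecMul, map_zero (TorusMap.linear n),
    map_zero (TorusMap.const n), sub_zero, sub_zero, map_zero, add_zero]

theorem torusFn_idm_mulM (b : (TBF.{u} n).Obj) (α : (TBF.{u} n).Mor) :
    torusFn ((TBF.{u} n).mulM ((TBF.{u} n).idm b) α) = TorusMap.translate (vec b)
      (torusFn α - TorusMap.linear n (shift α ᵥ* (mat b).1) -
        TorusMap.const n (lowU (mat b).1 (vec ((TBF.{u} n).src α)) (intVec n (shift α)))) :=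
  zero_add _

/-- The degree of the `C^∞(𝕋ⁿ, U(1))`-component of a morphism of `TBF n`, as a real vector. -/
noncomputable def degVec (β : (TBF.{u} n).Mor) : Fin n → ℝ :=
  intVec n (TorusMap.deg n (torusFn β))

theorem intVec_vecMul (m : Fin n → ℤ) (B : so n) :
    intVec n (m ᵥ* B.1) = -realMul B.1 (intVec n m) := by
  rw [realMul_int, ← map_neg]
  congr 1
  funext j
  simp only [Matrix.vecMul, Matrix.mulVec, dotProduct, Pi.neg_apply, ← Finset.sum_neg_distrib]
  refine Finset.sum_congr rfl fun i _ => ?_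
  rw [skew B j i]
  ring

theorem degVec_comp (β α : (TBF.{u} n).Mor) :
    degVec ((TBF.{u} n).comp β α) = degVec β + degVec α := by
  change intVec n (TorusMap.deg n (torusFn β + torusFn α)) = _
  rw [map_add, map_add]
  rfl

theorem degVec_minv (β : (TBF.{u} n).Mor) : degVec ((TBF.{u} n).minv β) = -degVec β := by
  change intVec n (TorusMap.deg n (-torusFn β)) = _
  rw [map_neg, map_neg]
  rfl

theorem degVec_idm (a : (TBF.{u} n).Obj) : degVec ((TBF.{u} n).idm a) = 0 := by
  change intVec n (TorusMap.deg n 0) = _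
  rw [map_zero, map_zero]

theorem degVec_lam (c b a : (TBF.{u} n).Obj) : degVec ((TBF.{u} n).lam c b a) = 0 := by
  have h : torusFn ((TBF.{u} n).lam c b a) = -TorusMap.const n (lowU (mat c).1 (vec a) (vec b)) :=
    TBF_lam_fst_fst.{u} c b a
  rw [degVec, h, map_neg, TorusMap.deg_const, neg_zero, map_zero]

theorem degVec_mulM_idm (β : (TBF.{u} n).Mor) (a : (TBF.{u} n).Obj) :
    degVec ((TBF.{u} n).mulM β ((TBF.{u} n).idm a)) = degVec β := by
  rw [degVec, torusFn_mulM_idm, degVec]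

theorem degVec_idm_mulM (b : (TBF.{u} n).Obj) (α : (TBF.{u} n).Mor) :
    degVec ((TBF.{u} n).mulM ((TBF.{u} n).idm b) α) =
      degVec α + realMul (mat b).1 (intVec n (shift α)) := by
  rw [degVec, torusFn_idm_mulM, TorusMap.deg_translate, map_sub (TorusMap.deg n),
    map_sub (TorusMap.deg n), TorusMap.deg_const, TorusMap.deg_linear, sub_zero, map_sub,
    intVec_vecMul, sub_neg_eq_add, degVec]

end Coordinates

theorem realMul_add_left {n : ℕ} (B C : so n) (v : Fin n → ℝ) :
    realMul (B + C).1 v = realMul B.1 v + realMul C.1 v := by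
  change realMul (B.1 + C.1) v = _
  funext i
  simp [realMul, Matrix.mulVec, dotProduct, add_mul, Finset.sum_add_distrib]

theorem realMul_zero_left {n : ℕ} (v : Fin n → ℝ) :
    realMul (0 : Matrix (Fin n) (Fin n) ℤ) v = 0 := by
  funext i
  simp [realMul]

section Components

variable {n d : ℕ} {X : Type u} [TopologicalSpace X] [ChartedSpace (EuclideanSpace ℝ (Fin d)) X]
  {𝒰 : OpenCover X}

/-- The first component of the target condition for `γ i j k`. -/
theorem tgt_fst (c : Cocycle d (TBF.{u} n) 𝒰) {i j k : 𝒰.ι} {x : X}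
    (hx : x ∈ 𝒰.U i ∩ 𝒰.U j ∩ 𝒰.U k) :
    intVec n (shift (c.γ i j k x)) + ((vec (c.g j k x)) + (vec (c.g i j x))) =
      (vec (c.g i k x)) := by
  have h : intVec n (shift (c.γ i j k x)) + vec ((TBF.{u} n).src (c.γ i j k x)) =
    vec (c.g i k x) := congrArg vec (c.tgt_γ i j k x hx)
  rwa [c.src_γ i j k x hx] at h

theorem tgt_snd (c : Cocycle d (TBF.{u} n) 𝒰) {i j k : 𝒰.ι} {x : X}
    (hx : x ∈ 𝒰.U i ∩ 𝒰.U j ∩ 𝒰.U k) :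
    (mat (c.g j k x)) + (mat (c.g i j x)) = (mat (c.g i k x)) := by
  have h := congrArg (mat) (c.tgt_γ i j k x hx)
  have h' := congrArg (mat) (c.src_γ i j k x hx)
  exact h'.symm.trans h

/-- The cocycle identity in its `C^∞(𝕋ⁿ, U(1))`-component. -/
theorem cocycle_fst (c : Cocycle d (TBF.{u} n) 𝒰) {i j k l : 𝒰.ι} {x : X}
    (hx : x ∈ 𝒰.U i ∩ 𝒰.U j ∩ 𝒰.U k ∩ 𝒰.U l) : ∃ s t : UnitAddCircle,
    (torusFn (c.γ i k l x)) + (TorusMap.translate (vec (c.g k l x))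
      ((torusFn (c.γ i j k x)) - TorusMap.linear n ((shift (c.γ i j k x)) ᵥ*
        (mat (c.g k l x)).1) - TorusMap.const n s) - TorusMap.const n t) =
      (torusFn (c.γ i j l x)) + (torusFn (c.γ j k l x)) := by
  have h : torusFn (c.γ i k l x) + (torusFn ((TBF.{u} n).mulM ((TBF.{u} n).idm (c.g k l x))
      (c.γ i j k x)) + -TorusMap.const n (lowU (mat (c.g k l x)).1 (vec (c.g i j x))
        (vec (c.g j k x)))) =
      torusFn (c.γ i j l x) + torusFn ((TBF.{u} n).mulM (c.γ j k l x)
        ((TBF.{u} n).idm (c.g i j x))) :=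
    congrArg torusFn (c.cocycle i j k l x hx)
  rw [torusFn_mulM_idm, torusFn_idm_mulM, ← sub_eq_add_neg] at h
  exact ⟨_, _, h⟩

/-- The oscillations form a cocycle twisted by translations. -/
theorem cocycle_osc (c : Cocycle d (TBF.{u} n) 𝒰) {i j k l : 𝒰.ι} {x : X}
    (hx : x ∈ 𝒰.U i ∩ 𝒰.U j ∩ 𝒰.U k ∩ 𝒰.U l) (y : Fin n → UnitAddCircle) :
    TorusMap.osc (torusFn (c.γ i k l x)) y +
      TorusMap.osc (torusFn (c.γ i j k x)) (y - toTorus (vec (c.g k l x))) =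
    TorusMap.osc (torusFn (c.γ i j l x)) y + TorusMap.osc (torusFn (c.γ j k l x)) y := by
  obtain ⟨s, t, h⟩ := cocycle_fst c hx
  have := congrFun (congrArg TorusMap.osc h) y
  simpa [TorusMap.osc_add, TorusMap.osc_sub, map_sub] using this

/-- The degrees form a cocycle twisted by the skew-symmetric matrices. -/
theorem cocycle_deg (c : Cocycle d (TBF.{u} n) 𝒰) {i j k l : 𝒰.ι} {x : X}
    (hx : x ∈ 𝒰.U i ∩ 𝒰.U j ∩ 𝒰.U k ∩ 𝒰.U l) :
    degVec (c.γ i k l x) + (degVec (c.γ i j k x) +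
        realMul (mat (c.g k l x)).1 (intVec n (shift (c.γ i j k x)))) =
      degVec (c.γ i j l x) + degVec (c.γ j k l x) := by
  have h := congrArg degVec (c.cocycle i j k l x hx)
  rwa [degVec_comp, degVec_comp, degVec_comp, degVec_lam, degVec_idm_mulM, degVec_mulM_idm,
    add_zero] at h

theorem realMul_mat (c : Cocycle d (TBF.{u} n) 𝒰) {i j k : 𝒰.ι} {x : X}
    (hx : x ∈ 𝒰.U i ∩ 𝒰.U j ∩ 𝒰.U k) (v : Fin n → ℝ) :
    realMul (mat (c.g i k x)).1 v =
      realMul (mat (c.g j k x)).1 v + realMul (mat (c.g i j x)).1 v := by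
  rw [← tgt_snd c hx, realMul_add_left]

theorem exists_subordinate_partition [T2Space X] [SecondCountableTopology X]
    [IsManifold (𝓡 d) ∞ X] (𝒰 : OpenCover X) :
    ∃ ψ : SmoothPartitionOfUnity 𝒰.ι (𝓡 d) X univ, ψ.IsSubordinate 𝒰.U := by
  have : LocallyCompactSpace X :=
    ChartedSpace.locallyCompactSpace (EuclideanSpace ℝ (Fin d)) X
  refine SmoothPartitionOfUnity.exists_isSubordinate (𝓡 d) isClosed_univ 𝒰.U 𝒰.isOpen ?_
  intro x _
  exact mem_iUnion.2 (𝒰.covers x)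

end Components

/-! ### Cocycles lifting the affine part of a cocycle -/

section Lifts

variable {n d : ℕ} {X : Type u} [TopologicalSpace X] [ChartedSpace (EuclideanSpace ℝ (Fin d)) X]
  {𝒰 𝒱 : OpenCover X}

/-- The half-geometric T-duality correspondence `a` lifts `c` if the left leg of `a` is the affine
part of `c`. -/
structure Lifts (a : Cocycle d (TFgeo.{u} n) 𝒰) (c : Cocycle d (TBF.{u} n) 𝒰) : Prop where
  obj : ∀ i j, ∀ x ∈ 𝒰.U i ∩ 𝒰.U j, (leftLeg.{u} n).obj (a.g i j x) = c.g i j x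
  mor : ∀ i j k, ∀ x ∈ 𝒰.U i ∩ 𝒰.U j ∩ 𝒰.U k,
    (leftLeg.{u} n).imγ (a.g j k x) (a.g i j x) (a.γ i j k x) = affineMor (c.γ i j k x)

theorem Lifts.restrict {a : Cocycle d (TFgeo.{u} n) 𝒰} {c : Cocycle d (TBF.{u} n) 𝒰}
    (h : Lifts a c) (r : 𝒱.ι → 𝒰.ι) (hr : ∀ i, 𝒱.U i ⊆ 𝒰.U (r i)) :
    Lifts (a.restrict r hr) (c.restrict r hr) where
  obj i j x hx := h.obj _ _ x ⟨hr i hx.1, hr j hx.2⟩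
  mor i j k x hx := h.mor _ _ _ x ⟨⟨hr i hx.1.1, hr j hx.1.2⟩, hr k hx.2⟩

variable [T2Space X] [SecondCountableTopology X] [IsManifold (𝓡 d) ∞ X]

/-- A cocycle is equivalent to its affine part: the oscillations form a cocycle with values in a
fine sheaf, so that they are a coboundary. -/
theorem Lifts.equivalent_map {a : Cocycle d (TFgeo.{u} n) 𝒰} {c : Cocycle d (TBF.{u} n) 𝒰}
    (h : Lifts a c) : c.Equivalent (a.map (leftLeg n)) := by
  obtain ⟨ψ, hψ⟩ := exists_subordinate_partition (d := d) 𝒰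
  -- Averaging the cocycle identity for `(p, i, j, k)` over `p` shows that the coboundary of `σ` is
  -- the family of oscillations.
  let σ : 𝒰.ι → 𝒰.ι → X → (Fin n → UnitAddCircle) → ℝ := fun i j x y =>
    average ψ x fun p => TorusMap.osc (torusFn (c.γ p i j x)) y
  have hσ : ∀ i j, ContMDiffOn ((𝓡 d).prod 𝓘(ℝ, Fin n → ℝ)) 𝓘(ℝ, ℝ) ∞
      (fun q : X × (Fin n → ℝ) => σ i j q.1 (toTorus q.2)) ((𝒰.U i ∩ 𝒰.U j) ×ˢ univ) := by
    intro i j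
    refine contMDiffOn_average_family ψ 𝒰.isOpen hψ ((𝒰.isOpen i).inter (𝒰.isOpen j))
      (K := fun p x v => TorusMap.osc (torusFn (c.γ p i j x)) (toTorus v)) fun p => ?_
    rw [← inter_assoc]
    exact (TorusMap.smoothOn_components (((𝒰.isOpen p).inter (𝒰.isOpen i)).inter (𝒰.isOpen j))
      (c.smooth_γ p i j).1.1).2.2
  have hcob : ∀ i j k, ∀ x ∈ 𝒰.U i ∩ 𝒰.U j ∩ 𝒰.U k, ∀ y,
      σ j k x y + σ i j x (y - toTorus (vec (c.g j k x))) =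
        σ i k x y + TorusMap.osc (torusFn (c.γ i j k x)) y := by
    intro i j k x hx y
    have hc := average_const ψ x (TorusMap.osc (torusFn (c.γ i j k x)) y)
    simp only [σ]
    rw [← hc, ← average_add, ← average_add]
    refine average_congr ψ hψ fun p hp => ?_
    exact cocycle_osc c ⟨⟨⟨hp, hx.1.1⟩, hx.1.2⟩, hx.2⟩ y
  let T : 𝒰.ι → 𝒰.ι → X → TorusMap n := fun i j x => TorusMap.ofReal (σ i j x)
  have hT : ∀ i j, ∀ x ∈ 𝒰.U i ∩ 𝒰.U j, ∀ y, (T i j x).1 y = (σ i j x y : UnitAddCircle) :=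
    fun i j x hx y => TorusMap.ofReal_apply_of_family (hσ i j) hx y
  have hcobT : ∀ i j k, ∀ x ∈ 𝒰.U i ∩ 𝒰.U j ∩ 𝒰.U k,
      TorusMap.affine n (torusFn (c.γ i j k x)) +
        (TorusMap.translate (vec (c.g j k x)) (T i j x) + T j k x) =
      T i k x + (torusFn (c.γ i j k x)) := by
    intro i j k x hx
    refine Subtype.ext (funext fun y => ?_)
    change (TorusMap.affine n (torusFn (c.γ i j k x))).1 y +
      ((T i j x).1 (y - toTorus (vec (c.g j k x))) + (T j k x).1 y) =
      (T i k x).1 y + (torusFn (c.γ i j k x)).1 y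
    rw [hT i j x hx.1, hT j k x ⟨hx.1.2, hx.2⟩, hT i k x ⟨hx.1.1, hx.2⟩,
      TorusMap.apply_eq_affine_add_osc (torusFn (c.γ i j k x))]
    have := congrArg (fun s : ℝ => (s : UnitAddCircle)) (hcob i j k x hx y)
    simp only [AddCircle.coe_add] at this
    rw [add_comm (((σ i j x _ : ℝ)) : UnitAddCircle), this]
    abel
  -- The equivalence has trivial objects, and `T i j` as morphisms.
  refine ⟨fun _ _ => (TBF.{u} n).one, fun i j x => torusMor (T i j x) (c.g i j x),
    fun i => (TBF.{u} n).smObj.const d _ _, fun i j => ⟨⟨TorusMap.smoothOn_ofReal (hσ i j),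
      SmoothStructure.const _ d _ _⟩, c.smooth_g i j⟩, ?_, ?_, ?_, ?_⟩
  · intro i x hx
    refine Prod.ext (Prod.ext (Subtype.ext (funext fun y => ?_)) rfl) (c.g_self i x hx)
    change (T i i x).1 y = 0
    rw [hT i i x ⟨hx, hx⟩]
    have : σ i i x y = 0 := by
      rw [← average_const ψ x (0 : ℝ)]
      refine average_congr ψ hψ fun p hp => ?_
      have h0 : torusFn (c.γ p i i x) = 0 :=
        congrArg (torusFn) (c.γ_right p i x ⟨hp, hx⟩)
      rw [h0, TorusMap.osc_zero]
      rfl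
    rw [this, AddCircle.coe_zero]
  · intro i j x hx
    exact (TwoGroup.one_mul (Γ := TBF.{u} n) (c.g i j x)).symm
  · intro i j x hx
    rw [TwoGroup.mul_one]
    refine Eq.trans ?_ (h.obj i j x hx).symm
    refine Prod.ext ?_ rfl
    change intVec n 0 + (vec (c.g i j x)) = _
    rw [map_zero, zero_add]
    rfl
  · intro i j k x hx
    have e1 : (a.map (leftLeg n)).g j k x = c.g j k x := h.obj j k x ⟨hx.1.2, hx.2⟩
    have e2 : (a.map (leftLeg n)).g i j x = c.g i j x := h.obj i j x hx.1
    have e3 : (a.map (leftLeg n)).γ i j k x = affineMor (c.γ i j k x) := h.mor i j k x hx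
    rw [e1, e2, e3, TwoGroup.lam_one_right, TwoGroup.lam_one_left, (TBF.{u} n).lam_one,
      (TBF.{u} n).mulM_one, (TBF.{u} n).one_mulM, TwoGroup.minv_idm]
    refine Prod.ext (Prod.ext ?_ ?_) ?_
    · change TorusMap.affine n (torusFn (c.γ i j k x)) + (0 + (torusFn ((TBF.{u} n).mulM
        ((TBF.{u} n).idm (c.g j k x)) (torusMor (T i j x) (c.g i j x))) + (0 + torusFn
        ((TBF.{u} n).mulM (torusMor (T j k x) (c.g j k x))
          ((TBF.{u} n).idm (c.g i j x)))))) = T i k x + (torusFn (c.γ i j k x) + 0)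
      rw [torusFn_mulM_idm, torusFn_idm_mulM, shift_torusMor, torusFn_torusMor, torusFn_torusMor]
      rw [lowU_intVec_zero, Matrix.zero_vecMul, map_zero (TorusMap.linear n),
        map_zero (TorusMap.const n), sub_zero, sub_zero, zero_add, zero_add, add_zero]
      exact hcobT i j k x hx
    · change shift (c.γ i j k x) + (0 + (shift ((TBF.{u} n).mulM
        ((TBF.{u} n).idm (c.g j k x)) (torusMor (T i j x) (c.g i j x))) + (0 + shift
        ((TBF.{u} n).mulM (torusMor (T j k x) (c.g j k x))
          ((TBF.{u} n).idm (c.g i j x)))))) = 0 + (shift (c.γ i j k x) + 0)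
      rw [shift_mulM, shift_mulM, shift_idm, shift_idm, shift_torusMor, shift_torusMor]
      simp only [add_zero, zero_add]
    · rfl

end Lifts

/-! ### Existence and uniqueness of lifts -/

section LiftProperties

variable {n : ℕ}

theorem affineMor_mor (α : (TFgeo.{u} n).Mor) :
    affineMor ((leftLeg.{u} n).mor α) = (leftLeg.{u} n).mor α := by
  refine Prod.ext (Prod.ext ?_ rfl) rfl
  refine (congrArg (TorusMap.affine n) (leftLeg_mor_fst_fst.{u} α)).trans ?_
  rw [map_sub, map_add, TorusMap.affine_const, TorusMap.affine_const, TorusMap.affine_linear]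
  rfl

/-- The object of `TFgeo n` over `b` with second component `v`. -/
def withDual (b : (TBF.{u} n).Obj) (v : Fin n → ℝ) : (TFgeo.{u} n).Obj :=
  (((vec b, v), mat b) : TFObj n)

theorem liftγ_idm_right (a : (TFgeo.{u} n).Obj) :
    liftγ.{u} a (TFgeo.{u} n).one ((TBF.{u} n).idm ((leftLeg n).obj a)) = (TFgeo n).idm a := by
  refine faithful_leftLeg n ?_ ?_
  · rw [(TFgeo n).src_idm]
    exact TwoGroup.mul_one (Γ := TFgeo.{u} n) a
  · rw [liftγ, TwoHom.χ_one_right, TwoGroup.idm_comp_idm, TwoGroup.mul_one, leftLeg_liftMor,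
      affineMor_idm, TwoHom.mor_idm]
    exact (TBF n).src_idm _

theorem liftγ_idm_left (a : (TFgeo.{u} n).Obj) :
    liftγ.{u} (TFgeo.{u} n).one a ((TBF.{u} n).idm ((leftLeg n).obj a)) = (TFgeo n).idm a := by
  refine faithful_leftLeg n ?_ ?_
  · rw [(TFgeo n).src_idm]
    exact TwoGroup.one_mul (Γ := TFgeo.{u} n) a
  · rw [liftγ, TwoHom.χ_one_left, TwoGroup.idm_comp_idm, TwoGroup.one_mul, leftLeg_liftMor,
      affineMor_idm, TwoHom.mor_idm]
    exact (TBF n).src_idm _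

theorem liftε_idm (a : (TFgeo.{u} n).Obj) :
    liftε.{u} (TFgeo.{u} n).one a a (TFgeo.{u} n).one ((TBF.{u} n).idm ((leftLeg n).obj a)) =
      (TFgeo n).idm a := by
  refine faithful_leftLeg n ?_ ?_
  · rw [(TFgeo n).src_idm]
    exact TwoGroup.mul_one (Γ := TFgeo.{u} n) a
  · rw [liftε, TwoHom.χ_one_left, TwoHom.χ_one_right, TwoGroup.minv_idm, TwoGroup.idm_comp_idm,
      TwoGroup.idm_comp_idm, TwoGroup.mul_one, leftLeg_liftMor, affineMor_idm, TwoHom.mor_idm]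
    exact (TBF n).src_idm _

variable {d : ℕ} {X : Type u} [TopologicalSpace X] [ChartedSpace (EuclideanSpace ℝ (Fin d)) X]

theorem smoothOn_realMul {b b' : X → (TBF.{u} n).Obj} {U : Set X}
    (hb : (TBF.{u} n).smObj.SmoothOn d b U) (hb' : (TBF.{u} n).smObj.SmoothOn d b' U) :
    ContMDiffOn (𝓡 d) 𝓘(ℝ, Fin n → ℝ) ∞ (fun x => realMul (mat (b x)).1 (vec (b' x))) U :=
  SmoothStructure.smoothOn_param (A := SmoothStructure.ofNormed (Fin n → ℝ))
    (B := SmoothStructure.ofNormed (Fin n → ℝ))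
    (F := fun (B : so n) v => realMul B.1 v) (fun B => smooth_realMul B.1) d hb'.1 hb.2

variable [IsManifold (𝓡 d) ∞ X]

theorem smoothOn_liftγ {c b : X → (TFgeo.{u} n).Obj} {β : X → (TBF.{u} n).Mor} {U : Set X}
    (hU : IsOpen U) (hc : (TFgeo.{u} n).smObj.SmoothOn d c U)
    (hb : (TFgeo.{u} n).smObj.SmoothOn d b U) (hβ : (TBF.{u} n).smMor.SmoothOn d β U)
    (h : ∀ x ∈ U, (TBF.{u} n).src (β x) =
      (TBF.{u} n).mul ((leftLeg.{u} n).obj (c x)) ((leftLeg.{u} n).obj (b x))) :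
    (TFgeo.{u} n).smMor.SmoothOn d (fun x => liftγ (c x) (b x) (β x)) U := by
  refine smoothOn_liftMor hU ((TFgeo.{u} n).smooth_mul d (fun x => (c x, b x)) U ⟨hc, hb⟩) ?_
  refine (TBF.{u} n).smooth_comp d _ _ _ hβ
    ((leftLeg.{u} n).smooth_χ d (fun x => (c x, b x)) U ⟨hc, hb⟩) fun x hx => ?_
  rw [h x hx, TwoHom.tgt_χ]

theorem smoothOn_liftε {c' b' c b : X → (TFgeo.{u} n).Obj} {β : X → (TBF.{u} n).Mor} {U : Set X}
    (hU : IsOpen U) (hc' : (TFgeo.{u} n).smObj.SmoothOn d c' U)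
    (hb' : (TFgeo.{u} n).smObj.SmoothOn d b' U) (hc : (TFgeo.{u} n).smObj.SmoothOn d c U)
    (hb : (TFgeo.{u} n).smObj.SmoothOn d b U) (hβ : (TBF.{u} n).smMor.SmoothOn d β U)
    (h : ∀ x ∈ U, (TBF.{u} n).src (β x) =
      (TBF.{u} n).mul ((leftLeg.{u} n).obj (c x)) ((leftLeg.{u} n).obj (b x)))
    (h' : ∀ x ∈ U, (TBF.{u} n).tgt (β x) =
      (TBF.{u} n).mul ((leftLeg.{u} n).obj (c' x)) ((leftLeg.{u} n).obj (b' x))) :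
    (TFgeo.{u} n).smMor.SmoothOn d (fun x => liftε (c' x) (b' x) (c x) (b x) (β x)) U := by
  refine smoothOn_liftMor hU ((TFgeo.{u} n).smooth_mul d (fun x => (c x, b x)) U ⟨hc, hb⟩) ?_
  have h1 : ∀ x ∈ U, (TBF.{u} n).src (β x) = (TBF.{u} n).tgt ((leftLeg.{u} n).χ (c x) (b x)) :=
    fun x hx => by rw [h x hx, TwoHom.tgt_χ]
  refine (TBF.{u} n).smooth_comp d _ _ _ ((TBF.{u} n).smooth_minv d _ U
    ((leftLeg.{u} n).smooth_χ d (fun x => (c' x, b' x)) U ⟨hc', hb'⟩))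
    ((TBF.{u} n).smooth_comp d _ _ _ hβ
    ((leftLeg.{u} n).smooth_χ d (fun x => (c x, b x)) U ⟨hc, hb⟩) h1) fun x hx => ?_
  rw [(TBF.{u} n).src_minv, (TBF.{u} n).tgt_comp _ _ (h1 x hx), h' x hx, TwoHom.tgt_χ]

theorem smoothOn_degVec {β : X → (TBF.{u} n).Mor} {U : Set X} (hU : IsOpen U)
    (hβ : (TBF.{u} n).smMor.SmoothOn d β U) :
    ContMDiffOn (𝓡 d) 𝓘(ℝ, Fin n → ℝ) ∞ (fun x => degVec (β x)) U :=
  SmoothStructure.smooth_of_discrete (SmoothStructure.ofNormed _) (fun m : Fin n → ℤ => intVec n m)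
    d _ U (TorusMap.smoothOn_components hU hβ.1.1).1

end LiftProperties

section Existence

variable {n d : ℕ} {X : Type u} [TopologicalSpace X] [ChartedSpace (EuclideanSpace ℝ (Fin d)) X]
  [T2Space X] [SecondCountableTopology X] [IsManifold (𝓡 d) ∞ X] {𝒰 : OpenCover X}

/-- The degrees and the matrices of a cocycle determine a Čech 2-cocycle with values in the fine sheaf
of smooth `ℝⁿ`-valued functions; it is the coboundary of the family `v`. -/
theorem exists_dual (c : Cocycle d (TBF.{u} n) 𝒰) : ∃ v : 𝒰.ι → 𝒰.ι → X → Fin n → ℝ,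
    (∀ i j, ContMDiffOn (𝓡 d) 𝓘(ℝ, Fin n → ℝ) ∞ (v i j) (𝒰.U i ∩ 𝒰.U j)) ∧
    (∀ i, ∀ x ∈ 𝒰.U i, v i i x = 0) ∧
    ∀ i j k, ∀ x ∈ 𝒰.U i ∩ 𝒰.U j ∩ 𝒰.U k, degVec (c.γ i j k x) +
      (v j k x + (realMul (mat (c.g j k x)).1 (vec (c.g i j x)) + v i j x)) = v i k x := by
  obtain ⟨ψ, hψ⟩ := exists_subordinate_partition (d := d) 𝒰
  -- The identity for `v` is the average over `p` of the degree identity for `(p, i, j, k)`, in which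
  -- `vec (g p j)` is expressed by the target condition for `γ p i j`.
  refine ⟨fun i j x => average ψ x fun p =>
    -(degVec (c.γ p i j x) + realMul (mat (c.g i j x)).1 (vec (c.g p i x))), ?_, ?_, ?_⟩
  · intro i j
    refine contMDiffOn_average ψ 𝒰.isOpen hψ ((𝒰.isOpen i).inter (𝒰.isOpen j)) fun p => ?_
    rw [← inter_assoc]
    refine smooth_vec_neg d _ _ (smooth_vec_add d (fun x => (degVec (c.γ p i j x),
      realMul (mat (c.g i j x)).1 (vec (c.g p i x)))) _ ⟨smoothOn_degVec (((𝒰.isOpen p).inter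
        (𝒰.isOpen i)).inter (𝒰.isOpen j)) (c.smooth_γ p i j), smoothOn_realMul ?_ ?_⟩)
    · exact (TBF n).smObj.mono d (c.smooth_g i j) fun x hx => ⟨hx.1.2, hx.2⟩
    · exact (TBF n).smObj.mono d (c.smooth_g p i) fun x hx => hx.1
  · intro i x hx
    refine Eq.trans ?_ (average_const ψ x (0 : Fin n → ℝ))
    refine average_congr ψ hψ fun p hp => ?_
    have e : mat (TBF.{u} n).one = 0 := rfl
    rw [c.γ_right p i x ⟨hp, hx⟩, c.g_self i x hx, degVec_idm, e]
    change -(0 + realMul (0 : Matrix (Fin n) (Fin n) ℤ) _) = 0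
    rw [realMul_zero_left, add_zero, neg_zero]
  · intro i j k x hx
    have hc := average_const ψ x (degVec (c.γ i j k x) +
      realMul (mat (c.g j k x)).1 (vec (c.g i j x)))
    rw [add_left_comm, ← add_assoc (degVec _), ← hc, ← average_add, ← average_add]
    refine average_congr ψ hψ fun p hp => ?_
    have h1 := cocycle_deg c ⟨⟨⟨hp, hx.1.1⟩, hx.1.2⟩, hx.2⟩
    have h2 := congrArg (realMul (mat (c.g j k x)).1) (tgt_fst c ⟨⟨hp, hx.1.1⟩, hx.1.2⟩)
    rw [map_add, map_add] at h2
    rw [realMul_mat c hx, ← h2]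
    grind

theorem exists_lifts (c : Cocycle d (TBF.{u} n) 𝒰) :
    ∃ a : Cocycle d (TFgeo.{u} n) 𝒰, Lifts a c := by
  obtain ⟨v, hv, hv0, hvt⟩ := exists_dual c
  let g : 𝒰.ι → 𝒰.ι → X → (TFgeo.{u} n).Obj := fun i j x => withDual (c.g i j x) (v i j x)
  let γ : 𝒰.ι → 𝒰.ι → 𝒰.ι → X → (TFgeo.{u} n).Mor :=
    fun i j k x => liftγ (g j k x) (g i j x) (c.γ i j k x)
  have hg : ∀ i j, (TFgeo.{u} n).smObj.SmoothOn d (g i j) (𝒰.U i ∩ 𝒰.U j) :=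
    fun i j => ⟨⟨(c.smooth_g i j).1, hv i j⟩, (c.smooth_g i j).2⟩
  have hg1 : ∀ i, ∀ x ∈ 𝒰.U i, g i i x = (TFgeo.{u} n).one := fun i x hx => by
    simp only [g]
    rw [c.g_self i x hx, hv0 i x hx]
    rfl
  have im : ∀ i j k, ∀ x ∈ 𝒰.U i ∩ 𝒰.U j ∩ 𝒰.U k,
      (leftLeg.{u} n).imγ (g j k x) (g i j x) (γ i j k x) = affineMor (c.γ i j k x) :=
    fun i j k x hx => imγ_liftγ (c.src_γ i j k x hx)
  have src : ∀ i j k, ∀ x ∈ 𝒰.U i ∩ 𝒰.U j ∩ 𝒰.U k,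
      (TFgeo.{u} n).src (γ i j k x) = (TFgeo.{u} n).mul (g j k x) (g i j x) :=
    fun _ _ _ _ _ => rfl
  have tgt : ∀ i j k, ∀ x ∈ 𝒰.U i ∩ 𝒰.U j ∩ 𝒰.U k, (TFgeo.{u} n).tgt (γ i j k x) = g i k x :=
    fun i j k x hx => (tgt_liftγ _ _ _).trans
      (Prod.ext (Prod.ext (tgt_fst c hx) (hvt i j k x hx)) (tgt_snd c hx))
  refine ⟨⟨g, γ, hg, ?_, hg1, ?_, ?_, src, tgt, ?_⟩, ⟨fun _ _ _ _ => rfl, im⟩⟩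
  · intro i j k
    refine smoothOn_liftγ (((𝒰.isOpen i).inter (𝒰.isOpen j)).inter (𝒰.isOpen k)) ?_ ?_
      (c.smooth_γ i j k) (c.src_γ i j k)
    · exact (TFgeo n).smObj.mono d (hg j k) fun x hx => ⟨hx.1.2, hx.2⟩
    · exact (TFgeo n).smObj.mono d (hg i j) fun x hx => hx.1
  · intro i j x hx
    simp only [γ]
    rw [c.γ_left i j x hx, hg1 i x hx.1]
    exact liftγ_idm_right (g i j x)
  · intro i j x hx
    simp only [γ]
    rw [c.γ_right i j x hx, hg1 j x hx.2]
    exact liftγ_idm_left (g i j x)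
  · intro i j k l x hx
    have h1 : x ∈ 𝒰.U i ∩ 𝒰.U k ∩ 𝒰.U l := ⟨⟨hx.1.1.1, hx.1.2⟩, hx.2⟩
    have h2 : x ∈ 𝒰.U i ∩ 𝒰.U j ∩ 𝒰.U l := ⟨hx.1.1, hx.2⟩
    have h3 : x ∈ 𝒰.U j ∩ 𝒰.U k ∩ 𝒰.U l := ⟨⟨hx.1.1.2, hx.1.2⟩, hx.2⟩
    refine (faithful_leftLeg n).cocycle (src i k l x h1) (tgt i k l x h1) (src i j k x hx.1)
      (tgt i j k x hx.1) (src i j l x h2) (tgt i j l x h2) (src j k l x h3) (tgt j k l x h3) ?_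
    rw [im i k l x h1, im i j k x hx.1, im i j l x h2, im j k l x h3]
    have h := congrArg affineMor (c.cocycle i j k l x hx)
    rwa [affineMor_comp, affineMor_comp, affineMor_comp, affineMor_mulM, affineMor_mulM,
      affineMor_idm, affineMor_idm, affineMor_lam] at h

end Existence

section Uniqueness

variable {n d : ℕ} {X : Type u} [TopologicalSpace X] [ChartedSpace (EuclideanSpace ℝ (Fin d)) X]
  {𝒰 : OpenCover X}

/-- The second component of the target condition for a lift. -/
theorem Lifts.tgt_dual {a : Cocycle d (TFgeo.{u} n) 𝒰} {c : Cocycle d (TBF.{u} n) 𝒰}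
    (h : Lifts a c) {i j k : 𝒰.ι} {x : X} (hx : x ∈ 𝒰.U i ∩ 𝒰.U j ∩ 𝒰.U k) :
    degVec (c.γ i j k x) + (dualVec (a.g j k x) +
      (realMul (mat (c.g j k x)).1 (vec (c.g i j x)) + dualVec (a.g i j x))) =
        dualVec (a.g i k x) := by
  have h1 : degVec (c.γ i j k x) = intVec n (a.γ i j k x : TFMor n).1.1.2 := by
    have e := congrArg degVec (h.mor i j k x hx)
    have e1 : degVec (affineMor (c.γ i j k x)) = degVec (c.γ i j k x) :=
      congrArg (intVec n) (deg_affineMor _)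
    have e2 : degVec ((leftLeg.{u} n).imγ (a.g j k x) (a.g i j x) (a.γ i j k x)) =
      intVec n (a.γ i j k x : TFMor n).1.1.2 := congrArg (intVec n) (deg_imγ _ _ _)
    rw [← e1, ← e, e2]
  have h2 : intVec n (a.γ i j k x : TFMor n).1.1.2 + dualVec ((TFgeo.{u} n).src (a.γ i j k x)) =
    dualVec (a.g i k x) := congrArg dualVec (a.tgt_γ i j k x hx)
  rw [a.src_γ i j k x hx] at h2
  rw [h1, ← h.obj j k x ⟨hx.1.2, hx.2⟩, ← h.obj i j x hx.1]
  exact h2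

/-- The left leg of a cocycle of `TFgeo n` is its own affine part. -/
theorem lifts_map (a : Cocycle d (TFgeo.{u} n) 𝒰) : Lifts a (a.map (leftLeg n)) where
  obj _ _ _ _ := rfl
  mor i j k x _ := by
    change _ = affineMor ((TBF.{u} n).comp ((leftLeg.{u} n).mor (a.γ i j k x))
      ((TBF.{u} n).minv ((leftLeg.{u} n).χ (a.g j k x) (a.g i j x))))
    rw [affineMor_comp, affineMor_minv, affineMor_χ, affineMor_mor]
    rfl

variable [T2Space X] [SecondCountableTopology X] [IsManifold (𝓡 d) ∞ X]

/-- Equivalences of cocycles of `TBF n` lift to equivalences of cocycles of `TFgeo n`. In particular,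
a lift is unique up to equivalence. -/
theorem Lifts.equivalent {a a' : Cocycle d (TFgeo.{u} n) 𝒰} {c c' : Cocycle d (TBF.{u} n) 𝒰}
    (hL : Lifts a c) (hL' : Lifts a' c') (e : c.Equivalent c') : a.Equivalent a' := by
  obtain ⟨h, ε, sh, sε, hε, s, t, eq⟩ := e
  obtain ⟨ψ, hψ⟩ := exists_subordinate_partition (d := d) 𝒰
  -- A lift of the equivalence amounts to functions `b i`, the dual components of its objects, with
  -- `b i - b j = κ i j`.
  let κ : 𝒰.ι → 𝒰.ι → X → Fin n → ℝ := fun i j x => degVec (ε i j x) +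
    (realMul (mat (h j x)).1 (vec (c.g i j x)) + dualVec (a.g i j x)) -
      (dualVec (a'.g i j x) + realMul (mat (c'.g i j x)).1 (vec (h i x)))
  have t1 : ∀ i j, ∀ x ∈ 𝒰.U i ∩ 𝒰.U j, intVec n (shift (ε i j x)) +
      (vec (h j x) + vec (c.g i j x)) = vec (c'.g i j x) + vec (h i x) := by
    intro i j x hx
    have h1 : intVec n (shift (ε i j x)) + vec ((TBF.{u} n).src (ε i j x)) =
      vec (c'.g i j x) + vec (h i x) := congrArg vec (t i j x hx)
    rwa [s i j x hx] at h1
  have t2 : ∀ i j, ∀ x ∈ 𝒰.U i ∩ 𝒰.U j,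
      mat (h j x) + mat (c.g i j x) = mat (c'.g i j x) + mat (h i x) := by
    intro i j x hx
    have h1 : mat ((TBF.{u} n).src (ε i j x)) = mat (c'.g i j x) + mat (h i x) :=
      congrArg mat (t i j x hx)
    rwa [s i j x hx] at h1
  have hκ : ∀ i j k, ∀ x ∈ 𝒰.U i ∩ 𝒰.U j ∩ 𝒰.U k, κ i j x + κ j k x = κ i k x := by
    intro i j k x hx
    have h0 := congrArg degVec (eq i j k x hx)
    simp only [degVec_comp, degVec_mulM_idm, degVec_idm_mulM, degVec_minv, degVec_lam, neg_zero,
      zero_add, add_zero] at h0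
    have h1 := congrArg (realMul (mat (c'.g j k x)).1) (t1 i j x hx.1)
    have h2 := congrArg (realMul (mat (h k x)).1) (tgt_fst c hx)
    have h3 : realMul (mat (h k x)).1 (vec (c.g i j x)) +
        realMul (mat (c.g j k x)).1 (vec (c.g i j x)) =
        realMul (mat (c'.g j k x)).1 (vec (c.g i j x)) +
        realMul (mat (h j x)).1 (vec (c.g i j x)) := by
      rw [← realMul_add_left, ← realMul_add_left, t2 j k x ⟨hx.1.2, hx.2⟩]
    have h4 := realMul_mat c' hx (vec (h i x))
    have h5 := hL.tgt_dual hx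
    have h6 := hL'.tgt_dual hx
    simp only [map_add] at h1 h2
    simp only [κ]
    rw [h4, ← h5, ← h6, ← h2]
    grind
  let b : 𝒰.ι → X → Fin n → ℝ := fun i x => average ψ x fun p => κ i p x
  have hb : ∀ i j, ∀ x ∈ 𝒰.U i ∩ 𝒰.U j, b i x = κ i j x + b j x := by
    intro i j x hx
    rw [← average_const ψ x (κ i j x), ← average_add]
    exact average_congr ψ hψ fun p hp => (hκ i j p x ⟨hx, hp⟩).symm
  have sb : ∀ i, ContMDiffOn (𝓡 d) 𝓘(ℝ, Fin n → ℝ) ∞ (b i) (𝒰.U i) := by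
    intro i
    refine contMDiffOn_average ψ 𝒰.isOpen hψ (𝒰.isOpen i) fun p => ?_
    rw [inter_comm]
    have m1 := (TBF n).smObj.mono d (sh i) (inter_subset_left (t := 𝒰.U p))
    have m2 := (TBF n).smObj.mono d (sh p) (inter_subset_right (s := 𝒰.U i))
    exact ((smoothOn_degVec ((𝒰.isOpen i).inter (𝒰.isOpen p)) (sε i p)).add
      ((smoothOn_realMul m2 (c.smooth_g i p)).add (a.smooth_g i p).1.2)).sub
        (ContMDiffOn.add (a'.smooth_g i p).1.2 (smoothOn_realMul (c'.smooth_g i p) m1))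
  let H : 𝒰.ι → X → (TFgeo.{u} n).Obj := fun i x => withDual (h i x) (b i x)
  have sH : ∀ i, (TFgeo.{u} n).smObj.SmoothOn d (H i) (𝒰.U i) :=
    fun i => ⟨⟨(sh i).1, sb i⟩, (sh i).2⟩
  let E : 𝒰.ι → 𝒰.ι → X → (TFgeo.{u} n).Mor :=
    fun i j x => liftε (a'.g i j x) (H i x) (H j x) (a.g i j x) (ε i j x)
  have s' : ∀ i j, ∀ x ∈ 𝒰.U i ∩ 𝒰.U j, (TBF.{u} n).src (ε i j x) =
      (TBF.{u} n).mul ((leftLeg.{u} n).obj (H j x)) ((leftLeg.{u} n).obj (a.g i j x)) := by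
    intro i j x hx
    rw [s i j x hx, hL.obj i j x hx]
    rfl
  have t' : ∀ i j, ∀ x ∈ 𝒰.U i ∩ 𝒰.U j, (TBF.{u} n).tgt (ε i j x) =
      (TBF.{u} n).mul ((leftLeg.{u} n).obj (a'.g i j x)) ((leftLeg.{u} n).obj (H i x)) := by
    intro i j x hx
    rw [t i j x hx, hL'.obj i j x hx]
    rfl
  have im : ∀ i j, ∀ x ∈ 𝒰.U i ∩ 𝒰.U j, (leftLeg.{u} n).imε (a'.g i j x) (H i x) (H j x)
      (a.g i j x) (E i j x) = affineMor (ε i j x) :=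
    fun i j x hx => imε_liftε (s' i j x hx) (t' i j x hx)
  have srcE : ∀ i j, ∀ x ∈ 𝒰.U i ∩ 𝒰.U j,
      (TFgeo.{u} n).src (E i j x) = (TFgeo.{u} n).mul (H j x) (a.g i j x) :=
    fun _ _ _ _ => rfl
  have tgtE : ∀ i j, ∀ x ∈ 𝒰.U i ∩ 𝒰.U j,
      (TFgeo.{u} n).tgt (E i j x) = (TFgeo.{u} n).mul (a'.g i j x) (H i x) := by
    intro i j x hx
    refine (tgt_liftε _ _ _ _ _).trans (Prod.ext (Prod.ext ?_ ?_) ?_)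
    · have := t1 i j x hx
      rw [← hL.obj i j x hx, ← hL'.obj i j x hx] at this
      exact this
    · have h1 := hb i j x hx
      simp only [κ] at h1
      rw [← hL.obj i j x hx, ← hL'.obj i j x hx] at h1
      change degVec (ε i j x) + (b j x + (realMul (mat (h j x)).1 (vec
        ((leftLeg.{u} n).obj (a.g i j x))) + dualVec (a.g i j x))) = dualVec (a'.g i j x) +
        (realMul (mat ((leftLeg.{u} n).obj (a'.g i j x))).1 (vec (h i x)) + b i x)
      rw [h1]
      abel
    · have := t2 i j x hx
      rw [← hL.obj i j x hx, ← hL'.obj i j x hx] at this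
      exact this
  refine ⟨H, E, sH, ?_, ?_, srcE, tgtE, ?_⟩
  · intro i j
    exact smoothOn_liftε ((𝒰.isOpen i).inter (𝒰.isOpen j)) (a'.smooth_g i j)
      ((TFgeo n).smObj.mono d (sH i) inter_subset_left)
      ((TFgeo n).smObj.mono d (sH j) inter_subset_right) (a.smooth_g i j) (sε i j) (s' i j) (t' i j)
  · intro i x hx
    simp only [E]
    rw [a.g_self i x hx, a'.g_self i x hx, hε i x hx]
    exact liftε_idm (H i x)
  · intro i j k x hx
    have h1 : x ∈ 𝒰.U i ∩ 𝒰.U k := ⟨hx.1.1, hx.2⟩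
    have h2 : x ∈ 𝒰.U j ∩ 𝒰.U k := ⟨hx.1.2, hx.2⟩
    refine (faithful_leftLeg n).equivalence (a.src_γ i j k x hx) (a.tgt_γ i j k x hx)
      (a'.src_γ i j k x hx) (a'.tgt_γ i j k x hx) (srcE i j x hx.1) (tgtE i j x hx.1)
      (srcE j k x h2) (tgtE j k x h2) (srcE i k x h1) (tgtE i k x h1) ?_
    rw [im i j x hx.1, im j k x h2, im i k x h1, hL.mor i j k x hx, hL'.mor i j k x hx,
      hL.obj i j x hx.1, hL.obj j k x h2, hL'.obj i j x hx.1, hL'.obj j k x h2]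
    have h := congrArg affineMor (eq i j k x hx)
    simp only [affineMor_comp, affineMor_mulM, affineMor_idm, affineMor_lam, affineMor_minv] at h
    exact h

end Uniqueness

end HalfGeo

theorem mainTheorem1 (n : ℕ) {d : ℕ} (X : Type*) [TopologicalSpace X] [T2Space X]
    [SecondCountableTopology X] [ChartedSpace (EuclideanSpace ℝ (Fin d)) X]
    [IsManifold (𝓡 d) ∞ X] :
    Function.Bijective (HalfGeo.H1.map d X (HalfGeo.leftLeg n) :
      HalfGeo.H1 d X (HalfGeo.TFgeo n) → HalfGeo.H1 d X (HalfGeo.TBF n)) := by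
  choose s hs using fun c : Σ 𝒰 : HalfGeo.OpenCover X,
    HalfGeo.Cocycle d (HalfGeo.TBF n) 𝒰 => HalfGeo.exists_lifts c.2
  let inv : HalfGeo.H1 d X (HalfGeo.TBF n) → HalfGeo.H1 d X (HalfGeo.TFgeo n) :=
    Quot.map (fun c => ⟨c.1, s c⟩) fun c c' ⟨𝒲, r, r', hr, hr', e⟩ =>
      ⟨𝒲, r, r', hr, hr', ((hs c).restrict r hr).equivalent ((hs c').restrict r' hr') e⟩
  refine Function.bijective_iff_has_inverse.2 ⟨inv, ?_, ?_⟩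
  · rintro ⟨𝒰, a⟩
    exact Quot.sound ⟨𝒰, id, id, fun _ => Subset.rfl, fun _ => Subset.rfl,
      ((hs ⟨𝒰, a.map (HalfGeo.leftLeg n)⟩).restrict id fun _ => Subset.rfl).equivalent
        (HalfGeo.lifts_map a) (HalfGeo.lifts_map a).equivalent_map⟩
  · rintro ⟨𝒰, c⟩
    refine (Quot.sound ⟨𝒰, id, id, fun _ => Subset.rfl, fun _ => Subset.rfl, ?_⟩).symm
    exact (hs ⟨𝒰, c⟩).equivalent_map
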